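/- Let $\mathfrak g$ be a finite-dimensional complex semisimple Lie algebra with a Cartan subalgebra $\mathfrak h$ and a fixed base of simple roots; let $P^+$ be the set of dominant integral weights, $\Lambda = P^+\times\mathbb Z$, and for $\lambda\in P^+$ let $V(\lambda)$ be the finite-dimensional simple $\mathfrak g$-module of highest weight $\lambda$. Let $V$ be a finite-dimensional $\mathfrak g$-module with weight spaces $V_\xi$ and set of weights $\mathrm{wt}(V)$, and let $\mathfrak g\ltimes V$ be the Lie algebra in which $V$ is an abelian ideal, graded with $\mathfrak g$ in degree $0$ and $V$ in degree $1$. Let $\Psi\subseteq \mathrm{wt}(V)$ be nonempty and such that, whenever $\sum_{\alpha\in\Psi} m_\alpha\alpha=\sum_{\beta\in \mathrm{wt}(V)} r_\beta\beta$ with $m_\alpha,r_\beta\in\mathbb Z_{\ge 0}$, one has $\sum_\alpha m_\alpha\le\sum_\beta r_\beta$, with equality if and only if $\beta\in\Psi$ for all $\beta$ with $r_\beta>0$. Write $\mu\le_\Psi\nu$ if $\nu-\mu\in\mathbb Z_{\ge0}\Psi$, and in this case let $d_\Psi(\mu,\nu)$ be the minimum of $\sum_{\beta\in\Psi} m_\beta$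 over all $m_\beta\in\mathbb Z_{\ge 0}$ with $\nu-\mu=\sum_{\beta\in\Psi} m_\beta\beta$. Define $(\mu,r)\preccurlyeq_\Psi(\nu,s)$ on $\Lambda$ to mean $\mu\le_\Psi\nu$ and $d_\Psi(\mu,\nu)=s-r$. Put $N_\Psi=\sum_{\xi\in\Psi}\dim V_\xi$. For $\Gamma\subseteq\Lambda$ let $\mathcal G[\Gamma]$ be the category of finite-dimensional $\mathbb Z$-graded $\mathfrak g\ltimes V$-modules $M=\bigoplus_r M[r]$, with degree-zero morphisms, such that $V(\lambda)$ occurs in the $\mathfrak g$-module $M[r]$ only if $(\lambda,r)\in\Gamma$. Let $V(\lambda,r)$ be $V(\lambda)$ placed in degree $r$ with $V$ acting by zero, let $P(\lambda,r)=U(\mathfrak g\ltimes V)\otimes_{U(\mathfrak g)}V(\lambda,r)$, and let $P(\lambda,r)^\Gamma$ be the quotient of $P(\lambda,r)$ by the submodule generated by all vectors $v\in P(\lambda,r)[s]$ that are annihilated by $\mathfrak n^+$ and have a weight $\nu\in P^+$ with $(\nu,s)\notin\Gamma$. Let $(\mu,r)\in\Lambda$, and let $\Gamma\subseteq\Lambda$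 be finite, interval-closed with respect to $\preccurlyeq_\Psi$, and such that $(\mu,r)\preccurlyeq_\Psi(\nu,s)$ for all $(\nu,s)\in\Gamma$. Then for all $(\nu,s),(\nu',s')\in\Gamma$ the modules $P(\nu,s)^\Gamma$ and $V(\nu,s)$ are objects of $\mathcal G[\Gamma]$, and: 1. If $\mathrm{Hom}_{\mathcal G[\Gamma]}(P(\nu,s)^\Gamma,P(\nu',s')^\Gamma)\ne0$, then $(\nu',s')\preccurlyeq_\Psi(\nu,s)$. 2. If $\mathrm{Ext}^j_{\mathcal G[\Gamma]}(V(\nu',s'),V(\nu,s))\neq 0$, then $(\nu',s')\preccurlyeq_\Psi(\nu,s)$ and $j=d_\Psi(\nu',\nu)$. 3. The global dimension of $\mathcal G[\Gamma]$ is at most $N_\Psi$. Moreover, there are $(\mu,r)\in\Lambda$ and a set $\Gamma$ as above for which the global dimension of $\mathcal G[\Gamma]$ equals $N_\Psi$. -/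

import Mathlib

open CategoryTheory CategoryTheory.Limits CategoryTheory.Abelian
open scoped TensorProduct

universe u v w

noncomputable section

namespace GrRep

/-! ## Two constructions of module homomorphisms -/

section Homs

set_option linter.unusedSectionVars false

variable {L : Type u} [LieRing L] [LieAlgebra ℂ L] {M N Q : Type*}
  [AddCommGroup M] [Module ℂ M] [LieRingModule L M]
  [AddCommGroup N] [Module ℂ N] [LieRingModule L N]
  [AddCommGroup Q] [Module ℂ Q] [LieRingModule L Q]

/-- Factor `f` through a surjection `p` whose kernel it kills. -/
def descHom (p : M →ₗ⁅ℂ, L⁆ N) (hp : Function.Surjective p) (f : M →ₗ⁅ℂ, L⁆ Q)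
    (h : ∀ m, p m = 0 → f m = 0) : N →ₗ⁅ℂ, L⁆ Q :=
  have key : ∀ m m', p m = p m' → f m = f m' := fun m m' e => by
    rw [← sub_eq_zero, ← map_sub]
    exact h _ (by rw [map_sub, e, sub_self])
  { toFun := fun n => f (hp n).choose
    map_add' := fun x y => by
      rw [← map_add]; exact key _ _ (by rw [map_add, (hp _).choose_spec, (hp _).choose_spec,
        (hp _).choose_spec])
    map_smul' := fun c x => by
      rw [RingHom.id_apply, ← map_smul]
      exact key _ _ (by rw [map_smul, (hp _).choose_spec, (hp _).choose_spec])
    map_lie' := fun {x m} => by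
      rw [← LieModuleHom.map_lie]
      exact key _ _ (by rw [LieModuleHom.map_lie, (hp _).choose_spec, (hp _).choose_spec]) }

theorem descHom_apply (p : M →ₗ⁅ℂ, L⁆ N) (hp : Function.Surjective p) (f : M →ₗ⁅ℂ, L⁆ Q)
    (h : ∀ m, p m = 0 → f m = 0) (m : M) : descHom p hp f h (p m) = f m := by
  change f (hp (p m)).choose = f m
  rw [← sub_eq_zero, ← map_sub]
  exact h _ (by rw [map_sub, (hp _).choose_spec, sub_self])

/-- Factor `f` through an injection `i` whose range contains that of `f`. -/
def liftHom (i : M →ₗ⁅ℂ, L⁆ N) (hi : Function.Injective i) (f : Q →ₗ⁅ℂ, L⁆ N)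
    (h : ∀ q, ∃ m, i m = f q) : Q →ₗ⁅ℂ, L⁆ M :=
  have sp : ∀ q, i (h q).choose = f q := fun q => (h q).choose_spec
  { toFun := fun q => (h q).choose
    map_add' := fun x y => hi ((sp _).trans (by rw [map_add, map_add, sp, sp]))
    map_smul' := fun c x => hi ((sp _).trans (by rw [RingHom.id_apply, map_smul, map_smul, sp]))
    map_lie' := fun {x m} => hi (by
      refine (sp _).trans ?_
      rw [LieModuleHom.map_lie, LieModuleHom.map_lie, sp]) }

theorem liftHom_apply (i : M →ₗ⁅ℂ, L⁆ N) (hi : Function.Injective i) (f : Q →ₗ⁅ℂ, L⁆ N)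
    (h : ∀ q, ∃ m, i m = f q) (q : Q) : i (liftHom i hi f h q) = f q :=
  (h q).choose_spec

end Homs

/-! ## Weights and highest weight modules -/

section Weights

variable {L : Type u} [LieRing L] [LieAlgebra ℂ L] [FiniteDimensional ℂ L]
  [LieAlgebra.IsSemisimple ℂ L] {H : LieSubalgebra ℂ L} [H.IsCartanSubalgebra]

/-- `λ` is dominant integral: its value at every simple coroot is a non-negative integer. -/
def IsDominant (b : (LieAlgebra.IsKilling.rootSystem H).Base) (lam : Module.Dual ℂ H) : Prop :=
  ∀ i ∈ b.support, ∃ n : ℕ, lam ((LieAlgebra.IsKilling.rootSystem H).coroot i) = n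

/-- The set `P⁺` of dominant integral weights. -/
abbrev DomWeight (b : (LieAlgebra.IsKilling.rootSystem H).Base) : Type u :=
  {lam : Module.Dual ℂ H // IsDominant b lam}

/-- The set `Λ = P⁺ × ℤ`. -/
abbrev Lam (b : (LieAlgebra.IsKilling.rootSystem H).Base) : Type u := DomWeight b × ℤ

/-- A root is positive if it is a sum of simple roots. -/
def IsPosRoot (b : (LieAlgebra.IsKilling.rootSystem H).Base) (i : H.root) : Prop :=
  (LieAlgebra.IsKilling.rootSystem H).root i ∈
    AddSubmonoid.closure ((LieAlgebra.IsKilling.rootSystem H).root '' b.support)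

/-- `v` is killed by `𝔫⁺` (the sum of the positive root spaces) and has weight `λ`
(`v = 0` is allowed). -/
def IsMaximalVector (b : (LieAlgebra.IsKilling.rootSystem H).Base) (lam : Module.Dual ℂ H)
    {M : Type w} [AddCommGroup M] [Module ℂ M] [LieRingModule L M] (v : M) : Prop :=
  (∀ i : H.root, IsPosRoot b i → ∀ x ∈ LieAlgebra.rootSpace H (i : LieModule.Weight ℂ H L),
    ⁅x, v⁆ = 0) ∧ ∀ h : H, ⁅(h : L), v⁆ = lam h • v

/-- `M` is a finite-dimensional simple module of highest weight `λ`. -/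
def IsSimpleHW (b : (LieAlgebra.IsKilling.rootSystem H).Base) (lam : Module.Dual ℂ H)
    (M : Type w) [AddCommGroup M] [Module ℂ M] [LieRingModule L M] [LieModule ℂ L M] : Prop :=
  FiniteDimensional ℂ M ∧ LieModule.IsIrreducible ℂ L M ∧
    ∃ v : M, v ≠ 0 ∧ IsMaximalVector b lam v

/-- A model of the finite-dimensional simple module `V(λ)` of highest weight `λ`
(any two are isomorphic). -/
structure SimpleModel (b : (LieAlgebra.IsKilling.rootSystem H).Base) (lam : DomWeight b) :
    Type (max u (w + 1)) where
  carrier : Type w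
  [instAddCommGroup : AddCommGroup carrier]
  [instModule : Module ℂ carrier]
  [instLieRingModule : LieRingModule L carrier]
  [instLieModule : LieModule ℂ L carrier]
  isSimpleHW : IsSimpleHW b lam.1 carrier

attribute [instance] SimpleModel.instAddCommGroup SimpleModel.instModule
  SimpleModel.instLieRingModule SimpleModel.instLieModule

/-- `[M : V(λ)] > 0`: the simple module `V(λ)` is a constituent of `M`, i.e. a quotient of a
submodule of `M`.  (For finite-dimensional `M` complete reducibility makes this the same as
`Hom_𝔤(V(λ), M) ≠ 0`.) -/
def HasConstituent (b : (LieAlgebra.IsKilling.rootSystem H).Base) (lam : DomWeight b)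
    (M : Type w) [AddCommGroup M] [Module ℂ M] [LieRingModule L M] [LieModule ℂ L M] : Prop :=
  ∃ (N : LieSubmodule ℂ L M) (S : SimpleModel.{u, w} b lam) (f : N →ₗ⁅ℂ, L⁆ S.carrier),
    Function.Surjective f

section Closure

set_option linter.unusedSectionVars false

variable {b : (LieAlgebra.IsKilling.rootSystem H).Base} {lam : DomWeight b}
  {M N Q : Type w}
  [AddCommGroup M] [Module ℂ M] [LieRingModule L M] [LieModule ℂ L M]
  [AddCommGroup N] [Module ℂ N] [LieRingModule L N] [LieModule ℂ L N]
  [AddCommGroup Q] [Module ℂ Q] [LieRingModule L Q] [LieModule ℂ L Q]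

theorem SimpleModel.surjective_of_ne_zero (S : SimpleModel.{u, w} b lam) (f : N →ₗ⁅ℂ, L⁆ S.carrier)
    (hf : f ≠ 0) : Function.Surjective f := by
  have := S.isSimpleHW.2.1
  rw [← LieModuleHom.range_eq_top]
  refine (eq_bot_or_eq_top f.range).resolve_left fun h => hf ?_
  ext n
  have : f n ∈ f.range := by simp
  rw [h] at this
  simpa using this

/-- A span `M ← T → S` with injective left leg exhibits a constituent of `M`. -/
theorem HasConstituent.of_span {T : Type w} [AddCommGroup T] [Module ℂ T] [LieRingModule L T]
    [LieModule ℂ L T] (S : SimpleModel.{u, w} b lam) (i : T →ₗ⁅ℂ, L⁆ M)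
    (hi : Function.Injective i) (f : T →ₗ⁅ℂ, L⁆ S.carrier) (hf : Function.Surjective f) :
    HasConstituent b lam M := by
  refine ⟨i.range, S, f.comp (liftHom i hi i.range.incl fun y =>
    (LieModuleHom.mem_range i y.1).1 y.2), hf.comp fun t => ?_⟩
  refine ⟨⟨i t, (LieModuleHom.mem_range i _).2 ⟨t, rfl⟩⟩, hi ?_⟩
  exact liftHom_apply i hi i.range.incl _ _

theorem HasConstituent.of_injective (i : N →ₗ⁅ℂ, L⁆ M) (hi : Function.Injective i)
    (h : HasConstituent b lam N) : HasConstituent b lam M := by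
  obtain ⟨K, S, f, hf⟩ := h
  exact .of_span S (i.comp K.incl) (hi.comp Subtype.val_injective) f hf

theorem HasConstituent.of_surjective (p : M →ₗ⁅ℂ, L⁆ N) (hp : Function.Surjective p)
    (h : HasConstituent b lam N) : HasConstituent b lam M := by
  obtain ⟨K, S, f, hf⟩ := h
  let g : (K.comap p) →ₗ⁅ℂ, L⁆ K :=
    { toFun := fun x => ⟨p x.1, x.2⟩
      map_add' := fun x y => by ext; simp
      map_smul' := fun c x => by ext; simp
      map_lie' := fun {x m} => by ext; simp }
  refine ⟨K.comap p, S, f.comp g, hf.comp ?_⟩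
  rintro ⟨k, hk⟩
  obtain ⟨m, rfl⟩ := hp k
  exact ⟨⟨m, hk⟩, rfl⟩

/-- A constituent of the middle term of `0 → M → Q → N` is one of an outer term. -/
theorem HasConstituent.of_exact (i : M →ₗ⁅ℂ, L⁆ Q) (p : Q →ₗ⁅ℂ, L⁆ N)
    (hip : ∀ q, p q = 0 → ∃ m, i m = q)
    (h : HasConstituent b lam Q) : HasConstituent b lam M ∨ HasConstituent b lam N := by
  obtain ⟨K, S, f, hf⟩ := h
  by_cases hz : ∀ k : K, p k.1 = 0 → f k = 0
  · right
    let g : K →ₗ⁅ℂ, L⁆ N := p.comp K.incl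
    have hr : ∀ k, g k ∈ g.range := fun k => (LieModuleHom.mem_range g _).2 ⟨k, rfl⟩
    let g' : K →ₗ⁅ℂ, L⁆ g.range := liftHom g.range.incl Subtype.val_injective g
      fun k => ⟨⟨g k, hr k⟩, rfl⟩
    have hg' : ∀ k, (g' k : N) = g k := fun k => liftHom_apply g.range.incl _ g _ k
    have hg's : Function.Surjective g' := fun y => by
      obtain ⟨k, hk⟩ := (LieModuleHom.mem_range g _).1 y.2
      exact ⟨k, Subtype.ext (by rw [hg', hk])⟩
    refine ⟨g.range, S, descHom g' hg's f fun k hk => hz k ?_, fun t => ?_⟩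
    · have := hg' k
      rw [hk] at this
      exact this.symm
    · obtain ⟨k, rfl⟩ := hf t
      exact ⟨g' k, descHom_apply _ _ _ _ _⟩
  · left
    push Not at hz
    obtain ⟨k, hk, hfk⟩ := hz
    let g : (K.comap i) →ₗ⁅ℂ, L⁆ K :=
      { toFun := fun x => ⟨i x.1, x.2⟩
        map_add' := fun x y => by ext; simp
        map_smul' := fun c x => by ext; simp
        map_lie' := fun {x m} => by ext; simp }
    refine ⟨K.comap i, S, f.comp g, S.surjective_of_ne_zero _ fun h0 => hfk ?_⟩
    obtain ⟨m, hm⟩ := hip _ hk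
    have hmem : m ∈ K.comap i := by
      change i m ∈ K
      rw [hm]; exact k.2
    have h1 : f.comp g ⟨m, hmem⟩ = 0 := by rw [h0]; rfl
    have h2 : g ⟨m, hmem⟩ = k := Subtype.ext hm
    rw [← h2]; exact h1

theorem HasConstituent.nontrivial (h : HasConstituent b lam M) : Nontrivial M := by
  obtain ⟨K, S, f, hf⟩ := h
  obtain ⟨v, hv, -⟩ := S.isSimpleHW.2.2
  obtain ⟨k, hk⟩ := hf v
  refine ⟨k.1, 0, fun h0 => hv ?_⟩
  have : k = 0 := Subtype.ext h0
  rw [← hk, this, map_zero]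

end Closure

end Weights

/-! ## The category of `ℤ`-graded modules over `𝔤 ⋉ V` -/

section Category

set_option linter.unusedSectionVars false

variable (L : Type u) [LieRing L] [LieAlgebra ℂ L]
  (V : Type v) [AddCommGroup V] [Module ℂ V] [LieRingModule L V] [LieModule ℂ L V]

/-- A `ℤ`-graded module `⨁ r, X r` over the graded Lie algebra `L ⋉ V`, where `L` sits in degree
`0` and the abelian ideal `V` sits in degree `1`: every `X r` is an `L`-module, `V` maps `X r` to
`X (r + 1)`, and the relations `[v, w] = 0` and `[x, v] = x • v` of `L ⋉ V` hold. -/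
structure GrMod : Type (max u (v + 1)) where
  X : ℤ → Type v
  [instAddCommGroup : ∀ r, AddCommGroup (X r)]
  [instModule : ∀ r, Module ℂ (X r)]
  [instLieRingModule : ∀ r, LieRingModule L (X r)]
  [instLieModule : ∀ r, LieModule ℂ L (X r)]
  act (r : ℤ) : V →ₗ[ℂ] X r →ₗ[ℂ] X (r + 1)
  act_comm (r : ℤ) (v w : V) (m : X r) : act (r + 1) v (act r w m) = act (r + 1) w (act r v m)
  lie_act (r : ℤ) (x : L) (v : V) (m : X r) :
    ⁅x, act r v m⁆ = act r ⁅x, v⁆ m + act r v ⁅x, m⁆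

attribute [instance] GrMod.instAddCommGroup GrMod.instModule GrMod.instLieRingModule
  GrMod.instLieModule

variable {L V}

namespace GrMod

/-- Morphisms: degree zero maps of `L ⋉ V`-modules. -/
@[ext] structure Hom (M N : GrMod L V) : Type v where
  f (r : ℤ) : M.X r →ₗ⁅ℂ, L⁆ N.X r
  f_act (r : ℤ) (v : V) (m : M.X r) : f (r + 1) (M.act r v m) = N.act r v (f r m)

instance : Category (GrMod L V) where
  Hom := Hom
  id M := { f := fun _ => LieModuleHom.id, f_act := fun _ _ _ => rfl }
  comp g h := { f := fun r => (h.f r).comp (g.f r), f_act := fun r v m => by simp [g.f_act, h.f_act] }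

variable {M N Q : GrMod L V}

@[ext] theorem hom_ext {g h : M ⟶ N} (e : ∀ r m, g.f r m = h.f r m) : g = h :=
  Hom.ext (funext fun r => LieModuleHom.ext (e r))

@[simp] theorem id_f (r : ℤ) (m : M.X r) : Hom.f (𝟙 M) r m = m := rfl

@[simp] theorem comp_f (g : M ⟶ N) (h : N ⟶ Q) (r : ℤ) (m : M.X r) :
    (g ≫ h).f r m = h.f r (g.f r m) := rfl

instance : Zero (M ⟶ N) := ⟨{ f := fun _ => 0, f_act := fun r v m => by simp }⟩
instance : Add (M ⟶ N) :=
  ⟨fun g h => { f := fun r => g.f r + h.f r, f_act := fun r v m => by simp [g.f_act, h.f_act] }⟩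
instance : Neg (M ⟶ N) :=
  ⟨fun g => { f := fun r => -g.f r, f_act := fun r v m => by simp [g.f_act] }⟩

@[simp] theorem zero_f (r : ℤ) (m : M.X r) : Hom.f (0 : M ⟶ N) r m = 0 := rfl
@[simp] theorem add_f (g h : M ⟶ N) (r : ℤ) (m : M.X r) : (g + h).f r m = g.f r m + h.f r m := rfl
@[simp] theorem neg_f (g : M ⟶ N) (r : ℤ) (m : M.X r) : (-g).f r m = -g.f r m := rfl

instance : AddCommGroup (M ⟶ N) where
  add_assoc _ _ _ := by ext; simp [add_assoc]
  zero_add _ := by ext; simp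
  add_zero _ := by ext; simp
  add_comm _ _ := by ext; simp [add_comm]
  neg_add_cancel _ := by ext; simp
  nsmul := nsmulRec
  zsmul := zsmulRec

instance : Preadditive (GrMod L V) where
  add_comp _ _ _ _ _ _ := by ext; simp
  comp_add _ _ _ _ _ _ := by ext; simp

/-- The zero module. -/
def zeroObj : GrMod L V :=
  letI : LieRingModule L PUnit.{v + 1} :=
    { bracket := fun _ _ => 0
      add_lie := fun _ _ _ => rfl
      lie_add := fun _ _ _ => rfl
      leibniz_lie := fun _ _ _ => rfl }
  { X := fun _ => PUnit
    instLieModule := fun _ => { smul_lie := fun _ _ _ => rfl, lie_smul := fun _ _ _ => rfl }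
    act := fun _ => 0
    act_comm := fun _ _ _ _ => rfl
    lie_act := fun _ _ _ _ => rfl }

theorem isZero_of_subsingleton (h : ∀ r, Subsingleton (M.X r)) : IsZero M := by
  rw [IsZero.iff_id_eq_zero]
  ext r m
  exact (h r).elim _ _

instance : HasZeroObject (GrMod L V) :=
  ⟨⟨zeroObj, isZero_of_subsingleton fun _ => inferInstanceAs (Subsingleton PUnit)⟩⟩

/-- A graded submodule: a family of `L`-submodules stable under `V`. -/
structure Sub (M : GrMod L V) where
  N (r : ℤ) : LieSubmodule ℂ L (M.X r)
  act_mem (r : ℤ) (v : V) (m : M.X r) : m ∈ N r → M.act r v m ∈ N (r + 1)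

/-- A graded submodule, as a graded module. -/
def Sub.obj (W : Sub M) : GrMod L V where
  X r := W.N r
  act r := LinearMap.mk₂ ℂ (fun v m => ⟨M.act r v m.1, W.act_mem r v m.1 m.2⟩)
    (fun _ _ _ => by ext; simp) (fun _ _ _ => by ext; simp) (fun _ _ _ => by ext; simp)
    (fun _ _ _ => by ext; simp)
  act_comm r v w m := Subtype.ext (M.act_comm r v w m.1)
  lie_act r x v m := Subtype.ext (M.lie_act r x v m.1)

/-- The inclusion of a graded submodule. -/
def Sub.incl (W : Sub M) : W.obj ⟶ M where
  f r := (W.N r).incl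
  f_act _ _ _ := rfl

/-- The quotient by a graded submodule. -/
def Sub.quot (W : Sub M) : GrMod L V where
  X r := M.X r ⧸ W.N r
  act r := LinearMap.flip <| (W.N r).toSubmodule.liftQ
    ((LinearMap.flip (M.act r)).compr₂ (LieSubmodule.Quotient.mk' (W.N (r + 1)) :
      M.X (r + 1) →ₗ[ℂ] M.X (r + 1) ⧸ W.N (r + 1)))
    (fun m hm => by
      ext v
      exact (LieSubmodule.Quotient.mk_eq_zero' ).2 (W.act_mem r v m hm))
  act_comm r v w m := by
    obtain ⟨m, rfl⟩ := LieSubmodule.Quotient.surjective_mk' _ m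
    exact congrArg (LieSubmodule.Quotient.mk' (W.N (r + 1 + 1))) (M.act_comm r v w m)
  lie_act r x v m := by
    obtain ⟨m, rfl⟩ := LieSubmodule.Quotient.surjective_mk' _ m
    exact congrArg (LieSubmodule.Quotient.mk' (W.N (r + 1))) (M.lie_act r x v m)

/-- The projection to the quotient by a graded submodule. -/
def Sub.proj (W : Sub M) : M ⟶ W.quot where
  f r := LieSubmodule.Quotient.mk' (W.N r)
  f_act _ _ _ := rfl

theorem Sub.incl_injective (W : Sub M) (r : ℤ) : Function.Injective (W.incl.f r) :=
  Subtype.val_injective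

theorem Sub.proj_surjective (W : Sub M) (r : ℤ) : Function.Surjective (W.proj.f r) :=
  LieSubmodule.Quotient.surjective_mk' _

theorem Sub.proj_eq_zero_iff (W : Sub M) (r : ℤ) (m : M.X r) :
    W.proj.f r m = 0 ↔ m ∈ W.N r :=
  LieSubmodule.Quotient.mk_eq_zero (W.N r)

/-- The kernel of a morphism. -/
def kerSub (g : M ⟶ N) : Sub M where
  N r := (g.f r).ker
  act_mem r v m hm := by
    rw [LieModuleHom.mem_ker] at hm ⊢
    rw [g.f_act, hm, map_zero]

/-- The image of a morphism. -/
def rangeSub (g : M ⟶ N) : Sub N where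
  N r := (g.f r).range
  act_mem r v n hn := by
    obtain ⟨m, rfl⟩ := (LieModuleHom.mem_range _ _).1 hn
    exact (LieModuleHom.mem_range _ _).2 ⟨M.act r v m, g.f_act r v m⟩

theorem injective_of_mono (g : M ⟶ N) [Mono g] (r : ℤ) : Function.Injective (g.f r) := by
  have h : (kerSub g).incl = 0 := by
    rw [← cancel_mono g]
    ext s m
    exact (LieModuleHom.mem_ker.1 m.2).trans (map_zero (g.f s)).symm
  rw [injective_iff_map_eq_zero]
  intro m hm
  exact congrArg (fun k : (kerSub g).obj ⟶ M => k.f r ⟨m, LieModuleHom.mem_ker.2 hm⟩) h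

theorem surjective_of_epi (g : M ⟶ N) [Epi g] (r : ℤ) : Function.Surjective (g.f r) := by
  have h : (rangeSub g).proj = 0 := by
    rw [← cancel_epi g]
    ext s m
    exact ((rangeSub g).proj_eq_zero_iff s _).2 ((LieModuleHom.mem_range _ _).2 ⟨m, rfl⟩)
  intro n
  have := congrArg (fun k : N ⟶ (rangeSub g).quot => k.f r n) h
  exact (LieModuleHom.mem_range _ _).1 (((rangeSub g).proj_eq_zero_iff r n).1 this)

/-- An injection onto the kernel of `h` is a kernel of `h`. -/
def isLimitOfExact (g : M ⟶ N) (h : N ⟶ Q) (w : g ≫ h = 0)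
    (hg : ∀ r, Function.Injective (g.f r)) (e : ∀ r n, h.f r n = 0 → ∃ m, g.f r m = n) :
    IsLimit (KernelFork.ofι g w) :=
  have sp : ∀ {T : GrMod L V} (k : T ⟶ N) (hk : k ≫ h = 0) (r : ℤ) (t : T.X r),
      ∃ m, g.f r m = k.f r t := fun k hk r t =>
    e r _ (congrArg (fun l : _ ⟶ Q => l.f r t) hk)
  KernelFork.IsLimit.ofι g w
    (fun k hk =>
      { f := fun r => liftHom (g.f r) (hg r) (k.f r) (sp k hk r)
        f_act := fun r v m => hg _ (by
          rw [liftHom_apply, g.f_act, liftHom_apply, k.f_act]) })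
    (fun k hk => by ext r m; exact liftHom_apply (g.f r) (hg r) (k.f r) (sp k hk r) m)
    (fun k hk l hl => by
      ext r m
      refine hg r (Eq.trans ?_ (liftHom_apply (g.f r) (hg r) (k.f r) (sp k hk r) m).symm)
      rw [← hl]; rfl)

/-- A surjection with kernel the image of `g` is a cokernel of `g`. -/
def isColimitOfExact (g : M ⟶ N) (h : N ⟶ Q) (w : g ≫ h = 0)
    (hh : ∀ r, Function.Surjective (h.f r)) (e : ∀ r n, h.f r n = 0 → ∃ m, g.f r m = n) :
    IsColimit (CokernelCofork.ofπ h w) :=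
  have sp : ∀ {T : GrMod L V} (k : N ⟶ T) (hk : g ≫ k = 0) (r : ℤ) (n : N.X r),
      h.f r n = 0 → k.f r n = 0 := fun k hk r n hn => by
    obtain ⟨m, rfl⟩ := e r n hn
    exact congrArg (fun l : M ⟶ _ => l.f r m) hk
  CokernelCofork.IsColimit.ofπ h w
    (fun k hk =>
      { f := fun r => descHom (h.f r) (hh r) (k.f r) (sp k hk r)
        f_act := fun r v m => by
          obtain ⟨n, rfl⟩ := hh r m
          rw [← h.f_act, descHom_apply, descHom_apply, k.f_act] })
    (fun k hk => by ext r m; exact descHom_apply (h.f r) (hh r) (k.f r) (sp k hk r) m)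
    (fun k hk l hl => by
      ext r m
      obtain ⟨n, rfl⟩ := hh r m
      refine Eq.trans ?_ (descHom_apply (h.f r) (hh r) (k.f r) (sp k hk r) n).symm
      rw [← hl]; rfl)

instance : HasKernels (GrMod L V) where
  has_limit g := HasLimit.mk ⟨_, isLimitOfExact (kerSub g).incl g
    (by ext r m; exact LieModuleHom.mem_ker.1 m.2) (Sub.incl_injective _)
    (fun _ m hm => ⟨⟨m, LieModuleHom.mem_ker.2 hm⟩, rfl⟩)⟩

instance : HasCokernels (GrMod L V) where
  has_colimit g := HasColimit.mk ⟨_, isColimitOfExact g (rangeSub g).proj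
    (by ext r m; exact (Sub.proj_eq_zero_iff _ _ _).2 ((LieModuleHom.mem_range _ _).2 ⟨m, rfl⟩))
    (Sub.proj_surjective _)
    (fun r n hn => (LieModuleHom.mem_range _ _).1 (((rangeSub g).proj_eq_zero_iff r n).1 hn))⟩

/-- The direct sum of two graded modules. -/
def prodObj (M N : GrMod L V) : GrMod L V :=
  letI (r : ℤ) : LieRingModule L (M.X r × N.X r) :=
    { bracket := fun x p => (⁅x, p.1⁆, ⁅x, p.2⁆)
      add_lie := fun x y p => Prod.ext (add_lie x y p.1) (add_lie x y p.2)
      lie_add := fun x p q => Prod.ext (lie_add x p.1 q.1) (lie_add x p.2 q.2)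
      leibniz_lie := fun x y p => Prod.ext (leibniz_lie x y p.1) (leibniz_lie x y p.2) }
  { X := fun r => M.X r × N.X r
    instLieModule := fun r =>
      { smul_lie := fun c x p => Prod.ext (smul_lie c x p.1) (smul_lie c x p.2)
        lie_smul := fun c x p => Prod.ext (lie_smul c x p.1) (lie_smul c x p.2) }
    act := fun r => LinearMap.mk₂ ℂ (fun v p => (M.act r v p.1, N.act r v p.2))
      (fun _ _ _ => by ext <;> simp) (fun _ _ _ => by ext <;> simp)
      (fun _ _ _ => by ext <;> simp) (fun _ _ _ => by ext <;> simp)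
    act_comm := fun r v w p => Prod.ext (M.act_comm r v w p.1) (N.act_comm r v w p.2)
    lie_act := fun r x v p => Prod.ext (M.lie_act r x v p.1) (N.lie_act r x v p.2) }

def prodFst (M N : GrMod L V) : prodObj M N ⟶ M where
  f r := { LinearMap.fst ℂ (M.X r) (N.X r) with map_lie' := fun {_ _} => rfl }
  f_act _ _ _ := rfl

def prodSnd (M N : GrMod L V) : prodObj M N ⟶ N where
  f r := { LinearMap.snd ℂ (M.X r) (N.X r) with map_lie' := fun {_ _} => rfl }
  f_act _ _ _ := rfl

def prodInl (M N : GrMod L V) : M ⟶ prodObj M N where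
  f r :=
    { LinearMap.inl ℂ (M.X r) (N.X r) with
      map_lie' := fun {x _} => Prod.ext rfl (lie_zero x).symm }
  f_act r v _ := Prod.ext rfl (map_zero (N.act r v)).symm

def prodInr (M N : GrMod L V) : N ⟶ prodObj M N where
  f r :=
    { LinearMap.inr ℂ (M.X r) (N.X r) with
      map_lie' := fun {x _} => Prod.ext (lie_zero x).symm rfl }
  f_act r v _ := Prod.ext (map_zero (M.act r v)).symm rfl

def prodBicone (M N : GrMod L V) : BinaryBicone M N where
  pt := prodObj M N
  fst := prodFst M N
  snd := prodSnd M N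
  inl := prodInl M N
  inr := prodInr M N
  inl_fst := rfl
  inl_snd := rfl
  inr_fst := rfl
  inr_snd := rfl

theorem prod_total (M N : GrMod L V) :
    prodFst M N ≫ prodInl M N + prodSnd M N ≫ prodInr M N = 𝟙 (prodObj M N) :=
  hom_ext fun _ m => Prod.ext (add_zero m.1) (zero_add m.2)

instance : HasBinaryBiproducts (GrMod L V) where
  has_binary_biproduct M N := hasBinaryBiproduct_of_total (prodBicone M N) (prod_total M N)

instance : HasFiniteProducts (GrMod L V) :=
  hasFiniteProducts_of_has_binary_and_terminal

instance : Abelian (GrMod L V) where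
  normalMonoOfMono g _ :=
    ⟨{ Z := (rangeSub g).quot
       g := (rangeSub g).proj
       w := by
        ext r m; exact (Sub.proj_eq_zero_iff _ _ _).2 ((LieModuleHom.mem_range _ _).2 ⟨m, rfl⟩)
       isLimit := isLimitOfExact g (rangeSub g).proj _ (injective_of_mono g) fun r n hn =>
        (LieModuleHom.mem_range _ _).1 (((rangeSub g).proj_eq_zero_iff r n).1 hn) }⟩
  normalEpiOfEpi g _ :=
    ⟨{ W := (kerSub g).obj
       g := (kerSub g).incl
       w := by ext r m; exact LieModuleHom.mem_ker.1 m.2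
       isColimit := isColimitOfExact (kerSub g).incl g _ (surjective_of_epi g) fun _ m hm =>
        ⟨⟨m, LieModuleHom.mem_ker.2 hm⟩, rfl⟩ }⟩

end GrMod

end Category

/-! ## The symmetric algebra as a graded representation, and the modules `P(λ, r)` -/

section Projectives

variable {L : Type u} [LieRing L] [LieAlgebra ℂ L]
  {V : Type v} [AddCommGroup V] [Module ℂ V] [LieRingModule L V] [LieModule ℂ L V]

/-- The algebra homomorphism `v ↦ v + ε • ⁅x, v⁆` of `Sym V` into its dual numbers. -/
def symDual (x : L) : SymmetricAlgebra ℂ V →ₐ[ℂ]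
    TrivSqZeroExt (SymmetricAlgebra ℂ V) (SymmetricAlgebra ℂ V) :=
  SymmetricAlgebra.lift
    ((TrivSqZeroExt.inlAlgHom ℂ (SymmetricAlgebra ℂ V) (SymmetricAlgebra ℂ V)).toLinearMap ∘ₗ
        SymmetricAlgebra.ι ℂ V +
      (TrivSqZeroExt.inrHom (SymmetricAlgebra ℂ V) (SymmetricAlgebra ℂ V)).restrictScalars ℂ ∘ₗ
        SymmetricAlgebra.ι ℂ V ∘ₗ LieModule.toEnd ℂ L V x)

theorem fst_symDual (x : L) (a : SymmetricAlgebra ℂ V) : (symDual x a).fst = a := by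
  have : (TrivSqZeroExt.fstHom ℂ (SymmetricAlgebra ℂ V) (SymmetricAlgebra ℂ V)).comp (symDual x) =
      AlgHom.id ℂ _ := by
    apply SymmetricAlgebra.algHom_ext
    ext v
    simp [symDual]
  exact congrArg (fun f : SymmetricAlgebra ℂ V →ₐ[ℂ] SymmetricAlgebra ℂ V => f a) this

/-- The derivation of `Sym V` that extends the action of `x` on `V`. -/
def symDer (x : L) : Derivation ℂ (SymmetricAlgebra ℂ V) (SymmetricAlgebra ℂ V) where
  toLinearMap :=
    (TrivSqZeroExt.sndHom (SymmetricAlgebra ℂ V) (SymmetricAlgebra ℂ V)).restrictScalars ℂ ∘ₗ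
      (symDual x).toLinearMap
  map_one_eq_zero' := by simp
  leibniz' a b := by simp [fst_symDual, mul_comm]

@[simp] theorem symDer_ι (x : L) (v : V) :
    symDer x (SymmetricAlgebra.ι ℂ V v) = SymmetricAlgebra.ι ℂ V ⁅x, v⁆ := by
  change (symDual x (SymmetricAlgebra.ι ℂ V v)).snd = _
  simp [symDual]

theorem symDer_ext {D E : Derivation ℂ (SymmetricAlgebra ℂ V) (SymmetricAlgebra ℂ V)}
    (h : ∀ v, D (SymmetricAlgebra.ι ℂ V v) = E (SymmetricAlgebra.ι ℂ V v)) : D = E := by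
  ext a
  induction a using SymmetricAlgebra.induction with
  | algebraMap r => simp
  | ι x => exact h x
  | mul a b ha hb => simp [ha, hb]
  | add a b ha hb => simp [ha, hb]

/-- `L` acts on `Sym V` by derivations. -/
instance : LieRingModule L (SymmetricAlgebra ℂ V) where
  bracket x a := symDer x a
  add_lie x y a := by
    have : symDer (V := V) (x + y) = symDer x + symDer y := symDer_ext fun v => by simp
    exact congrArg (fun D : Derivation ℂ _ _ => D a) this
  lie_add x a b := map_add _ a b
  leibniz_lie x y a := by
    have : symDer (V := V) ⁅x, y⁆ = ⁅symDer x, symDer y⁆ :=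
      symDer_ext fun v => by
        rw [Derivation.commutator_apply, symDer_ι, symDer_ι, symDer_ι, symDer_ι, symDer_ι, lie_lie,
          map_sub]
    have h := congrArg (fun D : Derivation ℂ _ _ => D a) this
    change symDer x (symDer y a) = symDer ⁅x, y⁆ a + symDer y (symDer x a)
    rw [show symDer ⁅x, y⁆ a = _ from h, Derivation.commutator_apply, sub_add_cancel]

instance : LieModule ℂ L (SymmetricAlgebra ℂ V) where
  smul_lie c x a := by
    have : symDer (V := V) (c • x) = c • symDer x := symDer_ext fun v => by simp
    exact congrArg (fun D : Derivation ℂ _ _ => D a) this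
  lie_smul c x a := (symDer x).map_smul c a

theorem lie_ι (x : L) (v : V) :
    ⁅x, SymmetricAlgebra.ι ℂ V v⁆ = SymmetricAlgebra.ι ℂ V ⁅x, v⁆ := symDer_ι x v

theorem lie_mul_sym (x : L) (a b : SymmetricAlgebra ℂ V) : ⁅x, a * b⁆ = a * ⁅x, b⁆ + b * ⁅x, a⁆ :=
  (symDer x).leibniz a b

variable (L V) in
/-- The homogeneous part `Symᵏ V` of the symmetric algebra, for `k : ℤ` (zero if `k < 0`). -/
def symPart (k : ℤ) : LieSubmodule ℂ L (SymmetricAlgebra ℂ V) where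
  toSubmodule := if 0 ≤ k then LinearMap.range (SymmetricAlgebra.ι ℂ V) ^ k.toNat else ⊥
  lie_mem := by
    intro x a ha
    change a ∈ (if 0 ≤ k then LinearMap.range (SymmetricAlgebra.ι ℂ V) ^ k.toNat else ⊥ :
      Submodule ℂ _) at ha
    change ⁅x, a⁆ ∈ (if 0 ≤ k then LinearMap.range (SymmetricAlgebra.ι ℂ V) ^ k.toNat else ⊥ :
      Submodule ℂ _)
    split_ifs at ha ⊢ with hk
    · generalize k.toNat = n at ha ⊢
      induction ha using Submodule.pow_induction_on_left' with
      | algebraMap r =>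
        have : ⁅x, algebraMap ℂ (SymmetricAlgebra ℂ V) r⁆ = 0 := (symDer x).map_algebraMap r
        rw [this]; exact Submodule.zero_mem _
      | add a b i ha hb h1 h2 => rw [lie_add]; exact Submodule.add_mem _ h1 h2
      | mem_mul m hm i a ha h =>
        obtain ⟨v, rfl⟩ := hm
        rw [lie_mul_sym, lie_ι, pow_succ', mul_comm a]
        exact Submodule.add_mem _ (Submodule.mul_mem_mul ⟨v, rfl⟩ h)
          (Submodule.mul_mem_mul ⟨_, rfl⟩ ha)
    · rw [Submodule.mem_bot] at ha ⊢
      rw [ha, lie_zero]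

theorem mul_mem_symPart {k l : ℤ} (h : l = k + 1) (v : V) {a : SymmetricAlgebra ℂ V}
    (ha : a ∈ symPart L V k) : SymmetricAlgebra.ι ℂ V v * a ∈ symPart L V l := by
  subst h
  change a ∈ (if 0 ≤ k then LinearMap.range (SymmetricAlgebra.ι ℂ V) ^ k.toNat else ⊥ :
    Submodule ℂ _) at ha
  change _ ∈ (if 0 ≤ k + 1 then LinearMap.range (SymmetricAlgebra.ι ℂ V) ^ (k + 1).toNat else ⊥ :
    Submodule ℂ _)
  split_ifs at ha with hk
  · rw [if_pos (by omega), show (k + 1).toNat = k.toNat + 1 by omega, pow_succ']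
    exact Submodule.mul_mem_mul ⟨v, rfl⟩ ha
  · rw [Submodule.mem_bot] at ha
    rw [ha, mul_zero]
    exact Submodule.zero_mem _

variable (L) in
/-- Multiplication `V × Symᵏ V → Symᵏ⁺¹ V`. -/
def symMul {k l : ℤ} (h : l = k + 1) : V →ₗ[ℂ] symPart L V k →ₗ[ℂ] symPart L V l :=
  LinearMap.mk₂ ℂ (fun v a => ⟨SymmetricAlgebra.ι ℂ V v * a.1, mul_mem_symPart h v a.2⟩)
    (fun _ _ _ => by ext; simp [add_mul]) (fun _ _ _ => by ext; simp)
    (fun _ _ _ => by ext; simp [mul_add]) (fun _ _ _ => by ext; simp)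

variable (V) in
/-- The induced module `U(L ⋉ V) ⊗_{U(L)} S`, with `S` in degree `r`.  As `U(L ⋉ V)` is the smash
product of `Sym V` and `U(L)`, it is `Sym V ⊗ S`, with `Symᵏ V ⊗ S` in degree `r + k`; here `L`
acts diagonally and `V` by multiplication. -/
def inducedObj (S : Type v) [AddCommGroup S] [Module ℂ S] [LieRingModule L S] [LieModule ℂ L S]
    (r : ℤ) : GrMod L V where
  X k := symPart L V (k - r) ⊗[ℂ] S
  act k := LinearMap.rTensorHom S ∘ₗ symMul L (show k + 1 - r = k - r + 1 by ring)
  act_comm k v w m := by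
    induction m using TensorProduct.induction_on with
    | zero => simp
    | add a b ha hb => simp only [map_add, ha, hb]
    | tmul a s =>
      refine congrArg (fun t => t ⊗ₜ[ℂ] s) (Subtype.ext ?_)
      exact mul_left_comm _ _ _
  lie_act k x v m := by
    induction m using TensorProduct.induction_on with
    | zero => simp
    | add a b ha hb =>
      simp only [map_add, lie_add, ha, hb]
      abel
    | tmul a s =>
      have h : ⁅x, symMul L (show k + 1 - r = k - r + 1 by ring) v a⁆ =
          symMul L (show k + 1 - r = k - r + 1 by ring) ⁅x, v⁆ a +
            symMul L (show k + 1 - r = k - r + 1 by ring) v ⁅x, a⁆ := by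
        refine Subtype.ext ?_
        change ⁅x, SymmetricAlgebra.ι ℂ V v * a.1⁆ =
          SymmetricAlgebra.ι ℂ V ⁅x, v⁆ * a.1 + SymmetricAlgebra.ι ℂ V v * ⁅x, a.1⁆
        rw [lie_mul_sym, lie_ι, mul_comm a.1, add_comm]
      change ⁅x, symMul L (show k + 1 - r = k - r + 1 by ring) v a ⊗ₜ[ℂ] s⁆ =
        symMul L (show k + 1 - r = k - r + 1 by ring) ⁅x, v⁆ a ⊗ₜ[ℂ] s +
          (LinearMap.rTensor S (symMul L (show k + 1 - r = k - r + 1 by ring) v)) ⁅x, a ⊗ₜ[ℂ] s⁆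
      rw [TensorProduct.LieModule.lie_tmul_right, TensorProduct.LieModule.lie_tmul_right, h,
        map_add, LinearMap.rTensor_tmul, LinearMap.rTensor_tmul, TensorProduct.add_tmul, add_assoc]

variable (V) in
/-- The `L`-module `S` placed in degree `r`, with `V` acting by zero. -/
def concObj (S : Type v) [AddCommGroup S] [Module ℂ S] [LieRingModule L S] [LieModule ℂ L S]
    (r : ℤ) : GrMod L V where
  X k := (if k = r then ⊤ else ⊥ : LieSubmodule ℂ L S)
  act _ := 0
  act_comm _ _ _ _ := rfl
  lie_act k x v m := by simp

end Projectives

/-! ## The truncated categories -/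

section Truncation

set_option linter.unusedSectionVars false

variable {L : Type u} [LieRing L] [LieAlgebra ℂ L] [FiniteDimensional ℂ L]
  [LieAlgebra.IsSemisimple ℂ L] {H : LieSubalgebra ℂ L} [H.IsCartanSubalgebra]
  (b : (LieAlgebra.IsKilling.rootSystem H).Base)
  (V : Type v) [AddCommGroup V] [Module ℂ V] [LieRingModule L V] [LieModule ℂ L V]

/-- The objects of `𝒢[Γ]`: finite-dimensional graded modules `M` such that
`[M : V(λ, r)] > 0` (that is, `V(λ)` is a constituent of `M[r]`) only for `(λ, r) ∈ Γ`. -/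
def inTrunc (Γ : Set (Lam b)) : ObjectProperty (GrMod L V) := fun M =>
  (∀ r, FiniteDimensional ℂ (M.X r)) ∧ {r | Nontrivial (M.X r)}.Finite ∧
    ∀ (lam : DomWeight b) (r : ℤ), HasConstituent b lam (M.X r) → (lam, r) ∈ Γ

/-- The category `𝒢[Γ]`. -/
abbrev TruncCat (Γ : Set (Lam b)) : Type (max u (v + 1)) :=
  (inTrunc b V Γ).FullSubcategory

variable {b V}

theorem inTrunc.of_injective {Γ : Set (Lam b)} {M N : GrMod L V} (g : M ⟶ N)
    (hg : ∀ r, Function.Injective (g.f r)) (h : inTrunc b V Γ N) : inTrunc b V Γ M :=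
  ⟨fun r => have := h.1 r
    FiniteDimensional.of_injective (g.f r : M.X r →ₗ[ℂ] N.X r) (hg r),
   h.2.1.subset fun r (_ : Nontrivial (M.X r)) => (hg r).nontrivial,
   fun lam r hl => h.2.2 lam r (hl.of_injective (g.f r) (hg r))⟩

theorem inTrunc.of_surjective {Γ : Set (Lam b)} {M N : GrMod L V} (g : M ⟶ N)
    (hg : ∀ r, Function.Surjective (g.f r)) (h : inTrunc b V Γ M) : inTrunc b V Γ N :=
  ⟨fun r => have := h.1 r
    Module.Finite.of_surjective (g.f r : M.X r →ₗ[ℂ] N.X r) (hg r),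
   h.2.1.subset fun r (_ : Nontrivial (N.X r)) => (hg r).nontrivial,
   fun lam r hl => h.2.2 lam r (hl.of_surjective (g.f r) (hg r))⟩

theorem inTrunc.prod {Γ : Set (Lam b)} {M N : GrMod L V} (hM : inTrunc b V Γ M)
    (hN : inTrunc b V Γ N) : inTrunc b V Γ (GrMod.prodObj M N) := by
  refine ⟨fun r => ?_, (hM.2.1.union hN.2.1).subset fun r hr => ?_, fun lam r hl => ?_⟩
  · have := hM.1 r
    have := hN.1 r
    exact inferInstanceAs (FiniteDimensional ℂ (M.X r × N.X r))
  · by_contra hc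
    have h1 : Subsingleton (M.X r) := not_nontrivial_iff_subsingleton.1 fun h => hc (Or.inl h)
    have h2 : Subsingleton (N.X r) := not_nontrivial_iff_subsingleton.1 fun h => hc (Or.inr h)
    exact not_nontrivial_iff_subsingleton.2
      (inferInstanceAs (Subsingleton (M.X r × N.X r))) hr
  · rcases hl.of_exact ((GrMod.prodInl M N).f r) ((GrMod.prodSnd M N).f r)
      (fun q hq => ⟨q.1, Prod.ext rfl (Eq.symm hq)⟩) with h | h
    · exact hM.2.2 lam r h
    · exact hN.2.2 lam r h

instance (Γ : Set (Lam b)) : (inTrunc b V Γ).ContainsZero where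
  exists_zero := by
    refine ⟨GrMod.zeroObj, GrMod.isZero_of_subsingleton fun _ =>
      inferInstanceAs (Subsingleton PUnit), fun r => ?_, ?_, fun lam r hl => ?_⟩
    · exact inferInstanceAs (FiniteDimensional ℂ PUnit)
    · refine Set.finite_empty.subset fun r hr => ?_
      exact not_nontrivial_iff_subsingleton.2 (inferInstanceAs (Subsingleton PUnit)) hr
    · exact absurd hl.nontrivial
        (not_nontrivial_iff_subsingleton.2 (inferInstanceAs (Subsingleton PUnit)))

instance (Γ : Set (Lam b)) : (inTrunc b V Γ).IsClosedUnderSubobjects where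
  prop_of_mono g _ h := inTrunc.of_injective g (GrMod.injective_of_mono g) h

instance (Γ : Set (Lam b)) : (inTrunc b V Γ).IsClosedUnderQuotients where
  prop_of_epi g _ h := inTrunc.of_surjective g (GrMod.surjective_of_epi g) h

instance (Γ : Set (Lam b)) : (inTrunc b V Γ).IsClosedUnderBinaryProducts where
  limitsOfShape_le := by
    rintro X ⟨p⟩
    let M := p.diag.obj ⟨WalkingPair.left⟩
    let N := p.diag.obj ⟨WalkingPair.right⟩
    let p1 : X ⟶ M := p.π.app ⟨WalkingPair.left⟩
    let p2 : X ⟶ N := p.π.app ⟨WalkingPair.right⟩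
    let g : X ⟶ GrMod.prodObj M N := p1 ≫ GrMod.prodInl M N + p2 ≫ GrMod.prodInr M N
    have h1 : g ≫ GrMod.prodFst M N = p1 := by
      ext r m; exact add_zero (p1.f r m)
    have h2 : g ≫ GrMod.prodSnd M N = p2 := by
      ext r m; exact zero_add (p2.f r m)
    have : Mono g := ⟨fun k l e => p.isLimit.hom_ext (by
      rintro ⟨_ | _⟩
      · change k ≫ p1 = l ≫ p1
        rw [← h1, ← Category.assoc, e, Category.assoc]
      · change k ≫ p2 = l ≫ p2
        rw [← h2, ← Category.assoc, e, Category.assoc])⟩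
    exact ObjectProperty.prop_of_mono _ g
      (inTrunc.prod (p.prop_diag_obj ⟨WalkingPair.left⟩) (p.prop_diag_obj ⟨WalkingPair.right⟩))

instance (Γ : Set (Lam b)) : (inTrunc b V Γ).IsClosedUnderFiniteProducts :=
  ObjectProperty.IsClosedUnderFiniteProducts.mk'

instance (Γ : Set (Lam b)) : HasExt.{max u (v + 1)} (TruncCat b V Γ) := HasExt.standard _

variable (Γ : Set (Lam b))

/-- `W` contains all maximal vectors of `M` whose weight `(λ, r)` lies outside `Γ`. -/
def ContainsBad {M : GrMod L V} (W : GrMod.Sub M) : Prop :=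
  ∀ (s : ℤ) (lam : DomWeight b) (m : M.X s), (lam, s) ∉ Γ → IsMaximalVector b lam.1 m → m ∈ W.N s

/-- The graded `L ⋉ V`-submodule of `M` generated by the maximal vectors of weights `(λ, r) ∉ Γ`.
It is `M_{Λ∖Γ}` whenever the latter (the `L`-submodule generated by these vectors) is stable
under `V`. -/
def genSub (M : GrMod L V) : GrMod.Sub M where
  N r :=
    { carrier := {m | ∀ W : GrMod.Sub M, ContainsBad Γ W → m ∈ W.N r}
      add_mem' := fun h1 h2 W hW => (W.N r).add_mem (h1 W hW) (h2 W hW)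
      zero_mem' := fun W _ => (W.N r).zero_mem
      smul_mem' := fun c _ h W hW => (W.N r).smul_mem c (h W hW)
      lie_mem := fun h W hW => (W.N r).lie_mem (h W hW) }
  act_mem r v m hm W hW := W.act_mem r v m (hm W hW)

/-- The truncation `M^Γ = M / M_{Λ∖Γ}`. -/
def truncObj (M : GrMod L V) : GrMod L V := (genSub Γ M).quot

variable (V)

/-- The simple object `V(λ, r)`: the module `V(λ)` in degree `r`. -/
def simpleObj {lam : DomWeight b} (S : SimpleModel.{u, v} b lam) (r : ℤ) : GrMod L V :=
  concObj V S.carrier r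

/-- `P(λ, r)^Γ`, the truncation of `P(λ, r) = U(L ⋉ V) ⊗_{U(L)} V(λ, r)`. -/
def truncProj {lam : DomWeight b} (S : SimpleModel.{u, v} b lam) (r : ℤ) : GrMod L V :=
  truncObj Γ (inducedObj V S.carrier r)

end Truncation

/-- The global dimension of an abelian category. -/
def globalDim (C : Type u) [Category.{v} C] [Abelian C] : WithBot ℕ∞ :=
  ⨆ X : C, projectiveDimension X

/-! ## The orders defined by a set of weights -/

section Orders

variable {L : Type u} [LieRing L] [LieAlgebra ℂ L] [FiniteDimensional ℂ L]
  [LieAlgebra.IsSemisimple ℂ L] {H : LieSubalgebra ℂ L} [H.IsCartanSubalgebra]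

variable (H) in
/-- The set `wt(V)` of weights of `V`. -/
def weights (V : Type v) [AddCommGroup V] [Module ℂ V] [LieRingModule L V] [LieModule ℂ L V] :
    Set (Module.Dual ℂ H) :=
  {ξ | LieModule.weightSpace V (ξ : H → ℂ) ≠ ⊥}

/-- `∑ m_β β = ∑ r_β β` with `m` supported on `Ψ` and `r` supported on `W` implies
`∑ m_β ≤ ∑ r_β`, with equality if and only if `r` is supported on `Ψ`. -/
def IsRigid (Ψ : Finset (Module.Dual ℂ H)) (W : Set (Module.Dual ℂ H)) : Prop :=
  ∀ m r : Module.Dual ℂ H →₀ ℕ, m.support ⊆ Ψ → (r.support : Set (Module.Dual ℂ H)) ⊆ W →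
    m.sum (fun β c => c • β) = r.sum (fun β c => c • β) →
    m.sum (fun _ c => c) ≤ r.sum (fun _ c => c) ∧
      (m.sum (fun _ c => c) = r.sum (fun _ c => c) ↔ ∀ β, 0 < r β → β ∈ Ψ)

/-- `μ ≤_Ψ ν`: the difference `ν - μ` is a sum of elements of `Ψ`. -/
def psiLe (Ψ : Finset (Module.Dual ℂ H)) (μ ν : Module.Dual ℂ H) : Prop :=
  ν - μ ∈ AddSubmonoid.closure (Ψ : Set (Module.Dual ℂ H))

/-- `d_Ψ(μ, ν)`: the least number of summands in an expression of `ν - μ` as a sum of elements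
of `Ψ` (meaningful if `μ ≤_Ψ ν`). -/
def psiDist (Ψ : Finset (Module.Dual ℂ H)) (μ ν : Module.Dual ℂ H) : ℕ :=
  sInf {n | ∃ m : Module.Dual ℂ H →₀ ℕ, m.support ⊆ Ψ ∧
    ν - μ = m.sum (fun β c => c • β) ∧ n = m.sum (fun _ c => c)}

/-- The order `≼_Ψ` on `Λ`: `(μ, r) ≼_Ψ (ν, s)` iff `μ ≤_Ψ ν` and `d_Ψ(μ, ν) = s - r`. -/
def preceq {b : (LieAlgebra.IsKilling.rootSystem H).Base} (Ψ : Finset (Module.Dual ℂ H))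
    (p q : Lam b) : Prop :=
  psiLe Ψ p.1.1 q.1.1 ∧ (psiDist Ψ p.1.1 q.1.1 : ℤ) = q.2 - p.2

/-- `Γ` is interval-closed with respect to `≼_Ψ`. -/
def IsIntervalClosed {b : (LieAlgebra.IsKilling.rootSystem H).Base}
    (Ψ : Finset (Module.Dual ℂ H)) (Γ : Set (Lam b)) : Prop :=
  ∀ p q t : Lam b, p ∈ Γ → t ∈ Γ → preceq Ψ p q → preceq Ψ q t → q ∈ Γ

end Orders

end GrRep

end

noncomputable section

namespace GrRep

/-! ## Complete reducibility of finite-dimensional representations -/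

section CompleteReducibility

set_option linter.unusedSectionVars false

variable {L : Type*} [LieRing L] [LieAlgebra ℂ L] [FiniteDimensional ℂ L]
  [LieAlgebra.IsSemisimple ℂ L]

open LieModule

/-! The engine is the Koszul complex. Its terms `Sym V ⊗ ⋀ʲ V ⊗ V(λ)`, induced from `⋀ʲ V ⊗ V(λ)`
placed `j` degrees above `V(λ)`, resolve the simple graded module `V(λ, r)`: the partial-derivative
homotopy satisfies `dh + hd = ` total degree, which is invertible away from degree `r`
(`koszulLin_koszulH`, `koszulD_exact`, `koszulAug_exact`).

Truncating every term to `Γ` gives projective objects of the truncated category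
(`projective_truncObj`), but exactness could be lost, since the submodule generated by bad maximal
vectors might swallow good ones. It does not: every constituent of a Koszul term is reached from
`(λ, r)` by adding weights of `V`, one per degree. When the end point lies in `Γ`, rigidity forces
all these weights into `Ψ`; hence each intermediate point lies in an interval with ends in `Γ`, so
in `Γ` itself. The action of `V` therefore never leads from a constituent outside `Γ` back into `Γ`
(`goodKer_act_mem`, `eq_zero_of_mem_genSub`), and the truncated complex is a projective resolution
(`isResolution_truncKoszul`). Weyl's theorem (`exists_retraction`), proved from Whitehead's first
lemma by a Casimir operator, lets every such question be tested on maximal vectors, and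
`IsMaximalVector.exists_of_tensor` controls their weights in tensor products.

The three claims follow. A nonzero map of truncated projectives produces a maximal vector whose
weight differs by a sum of weights of `V`, and rigidity turns this into the order. A map from the
`j`-th resolution term to a simple object is a `𝔤`-map from `⋀ʲ V ⊗ V(ν')` and needs degrees
differing by exactly `j`, which is then the distance (`preceq_of_ext`). A weight of `⋀ʲ V` is a sum
over `j` distinct members of a weight basis; if the corresponding constituent survives truncation
they all have weights in `Ψ`, so the terms vanish for `j > N_Ψ` (`isZero_truncKoszul`). Splitting
off simple objects in the top degree extends the bound to all objects.

For sharpness, the wedge of all weight basis vectors with weight in `Ψ` has some weight `κ` in `⋀ᴺ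
V`, with `N = N_Ψ`. For a suitable `λ` the module `V(λ + κ)` occurs in `⋀ᴺ V ⊗ V(λ)`
(`exists_isMaximalVector_tensor`). With `Γ` the points above `(λ, 0)` in degree at most `N`, the
resulting map on the `N`-th resolution term is a cocycle that cannot be a coboundary for degree
reasons, so an `Ext` group in degree `N` is nonzero (`exists_ext_simpleObj_ne_zero`). -/

theorem lie_top_top_eq_top : ⁅(⊤ : LieIdeal ℂ L), (⊤ : LieIdeal ℂ L)⁆ = ⊤ := by
  set I : LieIdeal ℂ L := ⁅(⊤ : LieIdeal ℂ L), (⊤ : LieIdeal ℂ L)⁆ with hI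
  have hc : IsCompl I Iᶜ := isCompl_compl
  -- Brackets of the complementary ideal lie both in it and in `I`, so it is abelian, and
  -- semisimplicity kills it.
  have h0 : Iᶜ = ⊥ := by
    have : IsLieAbelian (Iᶜ : LieIdeal ℂ L) := by
      constructor
      intro x y
      have h1 : ⁅(x : L), (y : L)⁆ ∈ I := LieSubmodule.lie_mem_lie trivial trivial
      have h2 : ⁅(x : L), (y : L)⁆ ∈ Iᶜ := lie_mem_right ℂ L _ _ _ y.2
      have h3 : ⁅(x : L), (y : L)⁆ ∈ I ⊓ Iᶜ := ⟨h1, h2⟩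
      rw [hc.inf_eq_bot] at h3
      exact Subtype.ext h3
    exact LieAlgebra.HasTrivialRadical.eq_bot_of_isSolvable Iᶜ
  have := hc.sup_eq_top
  rwa [h0, sup_bot_eq] at this

/-- A linear map that kills all brackets vanishes. -/
theorem linearMap_eq_zero_of_lie {N : Type*} [AddCommGroup N] [Module ℂ N] (f : L →ₗ[ℂ] N)
    (h : ∀ x y : L, f ⁅x, y⁆ = 0) : f = 0 := by
  have h1 : ∀ z ∈ ⁅(⊤ : LieIdeal ℂ L), (⊤ : LieIdeal ℂ L)⁆, f z = 0 := by
    intro z hz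
    rw [← LieSubmodule.mem_toSubmodule, LieSubmodule.lieIdeal_oper_eq_linear_span'] at hz
    induction hz using Submodule.span_induction with
    | mem z hz => obtain ⟨x, -, y, -, rfl⟩ := hz; exact h x y
    | zero => exact map_zero f
    | add a b _ _ ha hb => rw [map_add, ha, hb, add_zero]
    | smul c a _ ha => rw [map_smul, ha, smul_zero]
  rw [lie_top_top_eq_top] at h1
  ext z
  exact h1 z trivial

variable {M : Type*} [AddCommGroup M] [Module ℂ M] [LieRingModule L M] [LieModule ℂ L M]

/-- The radical of the trace form. -/
def traceRadical (L M : Type*) [LieRing L] [LieAlgebra ℂ L]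
    [AddCommGroup M] [Module ℂ M] [LieRingModule L M] [LieModule ℂ L M] : LieIdeal ℂ L where
  toSubmodule := LinearMap.ker (traceForm ℂ L M)
  lie_mem := by
    intro x y hy
    change traceForm ℂ L M ⁅x, y⁆ = 0
    have hy : traceForm ℂ L M y = 0 := hy
    ext z
    rw [← lie_skew, map_neg, LinearMap.neg_apply, traceForm_apply_lie_apply, hy]
    simp

/-- With zero trace form the derived algebra acts nilpotently, and here it is all of `L`. Nilpotency
yields a nonzero invariant vector, and irreducibility then makes every vector invariant. -/
theorem trivial_of_traceForm_eq_zero [FiniteDimensional ℂ M] [IsIrreducible ℂ L M]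
    (h : traceForm ℂ L M = 0) (x : L) (m : M) : ⁅x, m⁆ = 0 := by
  have hn := isNilpotent_derivedSeries_of_traceForm_eq_zero h
  have : Nontrivial M := nontrivial_of_isIrreducible ℂ L M
  have h1 := nontrivial_max_triv_of_isNilpotent ℂ (LieAlgebra.derivedSeries ℂ L 1) M
  have hD : ∀ x : L, x ∈ LieAlgebra.derivedSeries ℂ L 1 := by
    intro x
    have : LieAlgebra.derivedSeries ℂ L 1 = ⊤ := by
      rw [← lie_top_top_eq_top]
      simp [LieAlgebra.derivedSeriesOfIdeal_succ]
    rw [this]; trivial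
  obtain ⟨⟨m₀, hm₀⟩, hne⟩ := exists_ne (0 : maxTrivSubmodule ℂ (LieAlgebra.derivedSeries ℂ L 1) M)
  have hm : m₀ ∈ maxTrivSubmodule ℂ L M := fun x => hm₀ ⟨x, hD x⟩
  have htop : maxTrivSubmodule ℂ L M = ⊤ := by
    refine (eq_bot_or_eq_top _).resolve_left fun hb => hne ?_
    rw [hb] at hm
    exact Subtype.ext hm
  have : m ∈ maxTrivSubmodule ℂ L M := by rw [htop]; trivial
  exact this x

/-- Invariance of the Casimir tensor `∑ xᵢ ⊗ yᵢ`. -/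
theorem casimir_invariant {ι : Type*} [Fintype ι] [DecidableEq ι] {J : LieIdeal ℂ L}
    (B : LinearMap.BilinForm ℂ L) (hB : ∀ x y z : L, B ⁅x, y⁆ z = - B y ⁅x, z⁆)
    (hs : ∀ x y : L, B x y = B y x) (X : Module.Basis ι ℂ J) (Y : Module.Basis ι ℂ J)
    (hXY : ∀ i j, B (X i) (Y j) = if i = j then 1 else 0)
    (Φ : L →ₗ[ℂ] L →ₗ[ℂ] M) (x : L) :
    ∑ i, (Φ ⁅x, (X i : L)⁆ (Y i) + Φ (X i) ⁅x, (Y i : L)⁆) = 0 := by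
  -- Dual bases: the coordinates in `X` are the pairings with `Y`, and conversely in `e2`.
  have e1 : ∀ z : J, (z : L) = ∑ j, B z (Y j) • (X j : L) := by
    intro z
    have hz : (z : L) = ∑ k, X.repr z k • (X k : L) :=
      (congrArg J.toSubmodule.subtype (X.sum_repr z)).symm.trans (by rw [map_sum]; rfl)
    have h : ∀ j, X.repr z j = B z (Y j) := by
      intro j
      rw [hz]
      simp only [map_sum, map_smul, LinearMap.sum_apply, LinearMap.smul_apply, hXY]
      simp
    simp only [← h]
    exact hz
  have e2 : ∀ z : J, (z : L) = ∑ j, B z (X j) • (Y j : L) := by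
    intro z
    have hz : (z : L) = ∑ k, Y.repr z k • (Y k : L) :=
      (congrArg J.toSubmodule.subtype (Y.sum_repr z)).symm.trans (by rw [map_sum]; rfl)
    have h : ∀ j, Y.repr z j = B z (X j) := by
      intro j
      rw [hs, hz]
      simp only [map_sum, map_smul, hXY]
      simp
    simp only [← h]
    exact hz
  have e3 : ∀ i, Φ ⁅x, (X i : L)⁆ (Y i) = ∑ j, B ⁅x, (X i : L)⁆ (Y j) • Φ (X j) (Y i) := by
    intro i
    have := e1 ⟨⁅x, (X i : L)⁆, J.lie_mem (X i).2⟩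
    conv_lhs => rw [show ⁅x, (X i : L)⁆ = _ from this]
    simp
  have e4 : ∀ i, Φ (X i) ⁅x, (Y i : L)⁆ = ∑ j, B ⁅x, (Y i : L)⁆ (X j) • Φ (X i) (Y j) := by
    intro i
    have := e2 ⟨⁅x, (Y i : L)⁆, J.lie_mem (Y i).2⟩
    conv_lhs => rw [show ⁅x, (Y i : L)⁆ = _ from this]
    simp
  rw [Finset.sum_add_distrib, Finset.sum_congr rfl fun i _ => e3 i,
    Finset.sum_congr rfl fun i _ => e4 i, Finset.sum_comm, ← Finset.sum_add_distrib]
  refine Finset.sum_eq_zero fun j _ => ?_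
  rw [← Finset.sum_add_distrib]
  refine Finset.sum_eq_zero fun i _ => ?_
  -- After exchanging the indices of the first sum, the two coefficients of `Φ (X j) (Y i)` are
  -- opposite by invariance and symmetry of `B`.
  rw [← add_smul, hB, hs (X i : L), neg_add_cancel, zero_smul]

/-- `f` is a `1`-cocycle of `L` with values in `M`. -/
def IsCocycle (f : L →ₗ[ℂ] M) : Prop := ∀ x y : L, f ⁅x, y⁆ = ⁅x, f y⁆ - ⁅y, f x⁆

/-- The trace form is nondegenerate on a complement `J` of its radical. The Casimir operator of `J`
commutes with `L` and has trace `dim J`, so if the form is nonzero it is invertible by Schur's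
argument; inverting it solves the coboundary equation. If the form is zero, the module is trivial
and the cocycle kills all brackets, hence vanishes. -/
theorem IsCocycle.exists_of_irreducible [FiniteDimensional ℂ M] [IsIrreducible ℂ L M]
    {f : L →ₗ[ℂ] M} (hf : IsCocycle f) : ∃ m, ∀ x, f x = ⁅x, m⁆ := by
  classical
  by_cases h0 : traceForm ℂ L M = 0
  · have ht := trivial_of_traceForm_eq_zero h0
    have : f = 0 := linearMap_eq_zero_of_lie f fun x y => by rw [hf, ht, ht, sub_zero]
    exact ⟨0, fun x => by simp [this]⟩
  set B := traceForm ℂ L M with hBdef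
  have hs : ∀ x y, B x y = B y x := traceForm_comm ℂ L M
  have hB : ∀ x y z : L, B ⁅x, y⁆ z = - B y ⁅x, z⁆ := fun x y z => traceForm_apply_lie_apply' ℂ L M x y z
  set I := traceRadical L M
  set J : LieIdeal ℂ L := Iᶜ
  have hc : IsCompl I J := isCompl_compl
  have hIB : ∀ x ∈ I, ∀ y, B x y = 0 := fun x hx y => by
    have : B x = 0 := hx
    rw [this]; rfl
  have hsplit : ∀ z : L, ∃ a ∈ I, ∃ c ∈ J, a + c = z := fun z => by
    have : z ∈ I ⊔ J := by rw [hc.sup_eq_top]; trivial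
    exact (LieSubmodule.mem_sup _ _ _).1 this
  have hsep : ∀ x : J, (∀ y : J, B x y = 0) → x = 0 := by
    intro x hx
    have h1 : (x : L) ∈ I := by
      change B x = 0
      ext z
      obtain ⟨a, ha, c, hc', rfl⟩ := hsplit z
      rw [map_add, hs _ a, hIB a ha, hx ⟨c, hc'⟩, add_zero]; rfl
    have h2 : (x : L) ∈ I ⊓ J := ⟨h1, x.2⟩
    rw [hc.inf_eq_bot] at h2
    exact Subtype.ext h2
  let BJ : LinearMap.BilinForm ℂ J := B.domRestrict₁₂ J.toSubmodule J.toSubmodule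
  have hBJ : ∀ x y : J, BJ x y = B x y := fun _ _ => rfl
  have hnd : BJ.Nondegenerate :=
    ⟨fun x hx => hsep x hx, fun x hx => hsep x fun y => by rw [hs]; exact hx y⟩
  let X := Module.finBasis ℂ J
  let Y := LinearMap.BilinForm.dualBasis BJ hnd X
  have hXY : ∀ i j, B (X i) (Y j) = if i = j then 1 else 0 := fun i j => by
    rw [hs]; exact LinearMap.BilinForm.apply_dualBasis_left hnd X j i
  let c : M →ₗ[ℂ] M := ∑ i, toEnd ℂ L M (X i) ∘ₗ toEnd ℂ L M (Y i)
  have hcapp : ∀ m, c m = ∑ i, ⁅(X i : L), ⁅(Y i : L), m⁆⁆ := fun m => by simp [c]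
  have hcl : ∀ (x : L) (m : M), c ⁅x, m⁆ = ⁅x, c m⁆ := by
    intro x m
    have := casimir_invariant B hB hs X Y hXY
      (LinearMap.mk₂ ℂ (fun a d : L => ⁅a, ⁅d, m⁆⁆) (by simp) (by simp) (by simp) (by simp)) x
    simp only [LinearMap.mk₂_apply] at this
    rw [hcapp, hcapp, lie_sum, ← sub_eq_zero, ← Finset.sum_sub_distrib, ← neg_eq_zero,
      ← Finset.sum_neg_distrib, ← this]
    refine Finset.sum_congr rfl fun i _ => ?_
    simp only [lie_lie, lie_sub]
    abel
  let cL : M →ₗ⁅ℂ, L⁆ M := { c with map_lie' := fun {x m} => hcl x m }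
  have htr : LinearMap.trace ℂ M c = Module.finrank ℂ J := by
    have : ∀ i, LinearMap.trace ℂ M (toEnd ℂ L M (X i) ∘ₗ toEnd ℂ L M (Y i)) = 1 := fun i => by
      have := hXY i i
      rw [if_pos rfl] at this
      exact this
    simp only [c, map_sum, this]
    simp
  have hJ : 0 < Module.finrank ℂ J := by
    rw [Module.finrank_pos_iff]
    by_contra hn
    rw [not_nontrivial_iff_subsingleton] at hn
    refine h0 ?_
    ext z y
    obtain ⟨a, ha, d, hd, rfl⟩ := hsplit z
    have hd0 : (⟨d, hd⟩ : J) = 0 := Subsingleton.elim _ _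
    have hd0 : d = 0 := congrArg Subtype.val hd0
    rw [hd0, add_zero]
    exact hIB a ha y
  have hinj : Function.Injective c := by
    have hk : cL.ker = ⊥ := by
      refine (eq_bot_or_eq_top _).resolve_right fun ht => ?_
      have : c = 0 := by
        ext m
        have : m ∈ cL.ker := by rw [ht]; trivial
        exact LieModuleHom.mem_ker.1 this
      rw [this, map_zero] at htr
      exact hJ.ne (by exact_mod_cast htr)
    exact (LieModuleHom.ker_eq_bot cL).1 hk
  have hsurj : Function.Surjective c := LinearMap.injective_iff_surjective.1 hinj
  -- If `f x = ⁅x, m⁆` then the Casimir operator sends `m` to this sum; invariance of the Casimir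
  -- tensor shows that the preimage so defined works.
  obtain ⟨m, hm⟩ := hsurj (∑ i, ⁅(X i : L), f (Y i)⁆)
  refine ⟨m, fun x => hinj ?_⟩
  rw [hcl, hm]
  have := casimir_invariant B hB hs X Y hXY
    (LinearMap.mk₂ ℂ (fun a d : L => ⁅a, f d⁆) (by simp) (by simp) (by simp) (by simp)) x
  simp only [LinearMap.mk₂_apply] at this
  rw [hcapp, lie_sum, ← sub_eq_zero, ← Finset.sum_sub_distrib, ← neg_eq_zero,
      ← Finset.sum_neg_distrib, ← this]
  refine Finset.sum_congr rfl fun i _ => ?_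
  rw [hf, lie_sub, lie_lie]
  abel

/-- Whitehead's first lemma: `H¹(L, M) = 0`. -/
theorem IsCocycle.exists_coboundary [FiniteDimensional ℂ M]
    {f : L →ₗ[ℂ] M} (hf : IsCocycle f) : ∃ m, ∀ x, f x = ⁅x, m⁆ := by
  induction hn : Module.finrank ℂ M using Nat.strong_induction_on generalizing M with
  | _ n ih =>
  by_cases hs : Subsingleton M
  · exact ⟨0, fun x => Subsingleton.elim _ _⟩
  rw [not_subsingleton_iff_nontrivial] at hs
  by_cases hirr : ∀ N : LieSubmodule ℂ L M, N ≠ ⊥ → N = ⊤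
  · have : IsIrreducible ℂ L M := IsIrreducible.mk hirr
    exact hf.exists_of_irreducible
  push Not at hirr
  obtain ⟨N, hb, ht⟩ := hirr
  have ht' : N.toSubmodule ≠ ⊤ := fun h => ht (by rwa [← LieSubmodule.toSubmodule_eq_top])
  have hb' : N.toSubmodule ≠ ⊥ := fun h => hb (by rwa [← LieSubmodule.toSubmodule_eq_bot])
  have hN : Module.finrank ℂ N < n := hn ▸ Submodule.finrank_lt ht'
  have hQ : Module.finrank ℂ (M ⧸ N) < n := by
    have h1 := Submodule.finrank_quotient_add_finrank N.toSubmodule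
    have h2 : 0 < Module.finrank ℂ N.toSubmodule := by
      rw [Module.finrank_pos_iff]; exact Submodule.nontrivial_iff_ne_bot.2 hb'
    have h3 : Module.finrank ℂ (M ⧸ N) = Module.finrank ℂ (M ⧸ N.toSubmodule) := rfl
    omega
  let π := LieSubmodule.Quotient.mk' N
  -- Solve modulo `N` first; subtracting the coboundary of a lift leaves a cocycle with values in
  -- `N`, to which the induction hypothesis applies again.
  obtain ⟨q, hq⟩ := ih _ hQ (f := (π : M →ₗ[ℂ] M ⧸ N) ∘ₗ f) (fun x y => by
    change π (f ⁅x, y⁆) = ⁅x, π (f y)⁆ - ⁅y, π (f x)⁆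
    rw [hf, map_sub, LieModuleHom.map_lie, LieModuleHom.map_lie]) rfl
  obtain ⟨m₀, rfl⟩ := LieSubmodule.Quotient.surjective_mk' N q
  have hmem : ∀ x, f x - ⁅x, m₀⁆ ∈ N := fun x => by
    rw [← LieSubmodule.Quotient.mk_eq_zero]
    have : π (f x) = ⁅x, π m₀⁆ := hq x
    rw [map_sub, LieModuleHom.map_lie]
    exact sub_eq_zero.2 this
  let g : L →ₗ[ℂ] N :=
    { toFun := fun x => ⟨f x - ⁅x, m₀⁆, hmem x⟩
      map_add' := fun x y => Subtype.ext (by simp; abel)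
      map_smul' := fun c x => Subtype.ext (by simp [smul_sub]) }
  obtain ⟨m₁, hm₁⟩ := ih _ hN (f := g) (fun x y => Subtype.ext (by
    change f ⁅x, y⁆ - ⁅⁅x, y⁆, m₀⁆ = ⁅x, f y - ⁅y, m₀⁆⁆ - ⁅y, f x - ⁅x, m₀⁆⁆
    rw [hf, lie_lie, lie_sub, lie_sub]; abel)) rfl
  refine ⟨m₀ + m₁, fun x => ?_⟩
  have : f x - ⁅x, m₀⁆ = ⁅x, (m₁ : M)⁆ := congrArg Subtype.val (hm₁ x)
  rw [lie_add, ← this]; abel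

/-- Weyl's theorem: a submodule of a finite-dimensional module is a retract. -/
theorem exists_retraction [FiniteDimensional ℂ M] (N : LieSubmodule ℂ L M) :
    ∃ p : M →ₗ⁅ℂ, L⁆ N, ∀ n : N, p n = n := by
  obtain ⟨p, hp⟩ := LinearMap.exists_leftInverse_of_injective N.toSubmodule.subtype
    (Submodule.ker_subtype _)
  let p : M →ₗ[ℂ] N := p
  have hp : ∀ n : N, p n = n := fun n => LinearMap.congr_fun hp n
  -- The failure `x ↦ ⁅x, p⁆` of a linear retraction to be equivariant takes values in the maps that
  -- vanish on `N`. Writing this cocycle as the coboundary of some `φ` in `W` makes `p - φ`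
  -- equivariant and leaves its values on `N` unchanged.
  let W : LieSubmodule ℂ L (M →ₗ[ℂ] N) :=
    { carrier := {φ | ∀ n ∈ N, φ n = 0}
      add_mem' := fun h1 h2 n hn => by simp [h1 n hn, h2 n hn]
      zero_mem' := fun _ _ => rfl
      smul_mem' := fun c φ h n hn => by simp [h n hn]
      lie_mem := fun {x φ} h n hn => by
        change ⁅x, φ⁆ n = 0
        rw [LieHom.lie_apply, h n hn, h _ (N.lie_mem hn), lie_zero, sub_zero] }
  have hW : ∀ x : L, ⁅x, p⁆ ∈ W := fun x n hn => by
    rw [LieHom.lie_apply, hp ⟨n, hn⟩]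
    have := hp ⟨⁅x, n⁆, N.lie_mem hn⟩
    rw [this]; exact sub_eq_zero.2 (Subtype.ext rfl)
  let f : L →ₗ[ℂ] W :=
    { toFun := fun x => ⟨⁅x, p⁆, hW x⟩
      map_add' := fun x y => Subtype.ext (add_lie x y p)
      map_smul' := fun c x => Subtype.ext (smul_lie c x p) }
  obtain ⟨φ, hφ⟩ := IsCocycle.exists_coboundary (f := f) (fun x y => Subtype.ext (lie_lie x y p))
  refine ⟨{ p - φ.1 with map_lie' := fun {x m} => ?_ }, fun n => ?_⟩
  · have h : ⁅x, p⁆ = ⁅x, φ.1⁆ := congrArg Subtype.val (hφ x)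
    have h := LinearMap.congr_fun h m
    rw [LieHom.lie_apply, LieHom.lie_apply] at h
    change p ⁅x, m⁆ - φ.1 ⁅x, m⁆ = ⁅x, p m - φ.1 m⁆
    rw [lie_sub, ← sub_eq_zero]
    rw [← sub_eq_zero] at h
    rw [← neg_eq_zero, ← h]; abel
  · change p n - φ.1 n = n
    rw [hp, φ.2 n n.2, sub_zero]

variable {N : Type*} [AddCommGroup N] [Module ℂ N] [LieRingModule L N] [LieModule ℂ L N]

/-- A surjection out of a finite-dimensional module splits. -/
theorem exists_section [FiniteDimensional ℂ M] (g : M →ₗ⁅ℂ, L⁆ N) (hg : Function.Surjective g) :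
    ∃ s : N →ₗ⁅ℂ, L⁆ M, ∀ n, g (s n) = n := by
  obtain ⟨p, hp⟩ := exists_retraction g.ker
  -- The projection along a retraction onto the kernel factors through `g`.
  refine ⟨descHom g hg (LieModuleHom.id - g.ker.incl.comp p) (fun m hm => ?_), fun n => ?_⟩
  · have := hp ⟨m, LieModuleHom.mem_ker.2 hm⟩
    simp only [LieModuleHom.sub_apply, LieModuleHom.id_apply, LieModuleHom.comp_apply, this]
    exact sub_self m
  · obtain ⟨m, rfl⟩ := hg n
    rw [descHom_apply]
    have : g (p m : M) = 0 := LieModuleHom.mem_ker.1 (p m).2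
    simp [this]

end CompleteReducibility

/-! ## Weights and maximal vectors -/

section HighestWeight

set_option linter.unusedSectionVars false

open LieModule LieAlgebra

variable {L : Type u} [LieRing L] [LieAlgebra ℂ L] [FiniteDimensional ℂ L]
  [LieAlgebra.IsSemisimple ℂ L] {H : LieSubalgebra ℂ L} [H.IsCartanSubalgebra]
  (b : (LieAlgebra.IsKilling.rootSystem H).Base)

/-- `x` is a root vector for the positive root `α`. -/
def IsPosVec (α : Module.Dual ℂ H) (x : L) : Prop :=
  ∃ i : H.root, IsPosRoot b i ∧ (IsKilling.rootSystem H).root i = α ∧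
    x ∈ rootSpace H (i : Weight ℂ H L)

/-- `x` is a root vector for the negative of the positive root `α`. -/
def IsNegVec (α : Module.Dual ℂ H) (x : L) : Prop :=
  ∃ i : H.root, IsPosRoot b i ∧ (IsKilling.rootSystem H).root i = α ∧
    x ∈ rootSpace H (-(i : Weight ℂ H L) : H → ℂ)

variable {b} in
theorem IsPosVec.lie_cartan {α : Module.Dual ℂ H} {x : L} (hx : IsPosVec b α x) (h : H) :
    ⁅(h : L), x⁆ = α h • x := by
  obtain ⟨i, -, rfl, hx⟩ := hx
  exact IsKilling.lie_eq_smul_of_mem_rootSpace hx h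

variable {b} in
theorem IsNegVec.lie_cartan {α : Module.Dual ℂ H} {x : L} (hx : IsNegVec b α x) (h : H) :
    ⁅(h : L), x⁆ = -(α h • x) := by
  obtain ⟨i, -, rfl, hx⟩ := hx
  have := IsKilling.lie_eq_smul_of_mem_rootSpace hx h
  rw [← neg_smul]
  exact this

/-- `L` is spanned by the Cartan subalgebra and the positive and negative root vectors. -/
theorem cartan_root_induction {p : L → Prop} (zero : p 0) (add : ∀ x y, p x → p y → p (x + y))
    (cartan : ∀ h : H, p h) (pos : ∀ α x, IsPosVec b α x → p x)
    (neg : ∀ α x, IsNegVec b α x → p x) (x : L) : p x := by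
  have hx : x ∈ ⨆ χ : Weight ℂ H L, genWeightSpace L χ := by
    rw [iSup_genWeightSpace_eq_top' ℂ H L]; trivial
  refine LieSubmodule.iSup_induction _ (motive := p) hx (fun χ y hy => ?_) zero
    (fun y z hy hz => add y z hy hz)
  by_cases hχ : χ.IsZero
  · have : y ∈ rootSpace H (0 : H → ℂ) := by rw [← hχ]; exact hy
    rw [rootSpace_zero_eq] at this
    exact cartan ⟨y, this⟩
  · have hmem : χ ∈ H.root := by simpa using hχ
    rcases b.root_mem_or_neg_mem ⟨χ, hmem⟩ with h | h
    · exact pos _ y ⟨⟨χ, hmem⟩, h, rfl, hy⟩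
    · have hneg : -χ ∈ H.root := by simpa using hχ
      refine neg (IsKilling.rootSystem H |>.root ⟨-χ, hneg⟩) y ⟨⟨-χ, hneg⟩, ?_, rfl, ?_⟩
      · have e : (IsKilling.rootSystem H).root ⟨-χ, hneg⟩ =
          -(IsKilling.rootSystem H).root ⟨χ, hmem⟩ := by ext; simp
        unfold IsPosRoot
        rw [e]; exact h
      · simpa using hy

/-- The cone spanned by the simple roots. -/
def rootCone : AddSubmonoid (Module.Dual ℂ H) :=
  AddSubmonoid.closure ((IsKilling.rootSystem H).root '' b.support)

/-- The linear functional that is `1` on the simple roots. -/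
def height : Module.Dual ℂ H →ₗ[ℂ] ℂ := b.toWeightBasis.constr ℂ fun _ => (1 : ℂ)

theorem height_root {i : H.root} (hi : i ∈ b.support) :
    height b ((IsKilling.rootSystem H).root i) = 1 := by
  have := b.toWeightBasis.constr_basis ℂ (fun _ => (1 : ℂ)) ⟨i, hi⟩
  rwa [RootPairing.Base.toWeightBasis_apply] at this

/-- Heights of simple roots are one and heights add. This makes the cone pointed, and it is the
measure behind every extremal choice of a weight below. Real parts are taken because the height is a
complex functional. -/
theorem height_of_mem_rootCone {ξ : Module.Dual ℂ H} (h : ξ ∈ rootCone b) :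
    ξ = 0 ∨ 1 ≤ (height b ξ).re := by
  induction h using AddSubmonoid.closure_induction with
  | mem x hx =>
    obtain ⟨i, hi, rfl⟩ := hx
    right; rw [height_root b hi]; simp
  | zero => left; rfl
  | add x y _ _ hx hy =>
    rcases hx with rfl | hx
    · simpa using hy
    · rcases hy with rfl | hy
      · right; simpa using hx
      · right; rw [map_add, Complex.add_re]; linarith

variable {b} in
theorem IsPosVec.mem_rootCone {α : Module.Dual ℂ H} {x : L} (hx : IsPosVec b α x) :
    α ∈ rootCone b := by
  obtain ⟨i, hi, rfl, -⟩ := hx; exact hi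

variable {b} in
theorem IsNegVec.mem_rootCone {α : Module.Dual ℂ H} {x : L} (hx : IsNegVec b α x) :
    α ∈ rootCone b := by
  obtain ⟨i, hi, rfl, -⟩ := hx; exact hi

theorem root_ne_zero' (i : H.root) : (IsKilling.rootSystem H).root i ≠ 0 :=
  (IsKilling.rootSystem H).ne_zero i

variable {b} in
theorem IsPosVec.one_le_height {α : Module.Dual ℂ H} {x : L} (hx : IsPosVec b α x) :
    1 ≤ (height b α).re := by
  refine (height_of_mem_rootCone b hx.mem_rootCone).resolve_left ?_
  obtain ⟨i, hi, rfl, -⟩ := hx; exact root_ne_zero' i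

variable {b} in
theorem IsNegVec.one_le_height {α : Module.Dual ℂ H} {x : L} (hx : IsNegVec b α x) :
    1 ≤ (height b α).re := by
  refine (height_of_mem_rootCone b hx.mem_rootCone).resolve_left ?_
  obtain ⟨i, hi, rfl, -⟩ := hx; exact root_ne_zero' i

/-! ### Weight spaces and maximal vectors of a module -/

section Modules

variable {M : Type w} [AddCommGroup M] [Module ℂ M] [LieRingModule L M] [LieModule ℂ L M]
  {N : Type w} [AddCommGroup N] [Module ℂ N] [LieRingModule L N] [LieModule ℂ L N]

variable (M) in
/-- The weight space of `M` of weight `ξ`. -/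
def wtSub (ξ : Module.Dual ℂ H) : Submodule ℂ M where
  carrier := {m | ∀ h : H, ⁅(h : L), m⁆ = ξ h • m}
  add_mem' := fun {x y} hx hy h => by rw [lie_add, hx h, hy h, smul_add]
  zero_mem' := fun h => by simp
  smul_mem' := fun c x hx h => by rw [lie_smul, hx h, smul_comm]

theorem wtSub_eq_weightSpace (ξ : Module.Dual ℂ H) :
    wtSub M ξ = (weightSpace M (ξ : H → ℂ)).toSubmodule := by
  ext m
  rw [LieSubmodule.mem_toSubmodule, mem_weightSpace]
  rfl

theorem iSupIndep_wtSub : iSupIndep fun ξ : Module.Dual ℂ H => wtSub M ξ := by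
  have h := LieSubmodule.iSupIndep_toSubmodule.2 (iSupIndep_genWeightSpace ℂ H M)
  have h2 := h.comp (f := fun ξ : Module.Dual ℂ H => (ξ : H → ℂ)) DFunLike.coe_injective
  refine h2.mono fun ξ => ?_
  rw [wtSub_eq_weightSpace]
  exact weightSpace_le_genWeightSpace M _

/-- By independence of the weight spaces, the possible weights of a module can be read off from any
family of weight vectors that spans it. -/
theorem weight_mem_of_mem_iSup {A : Set (Module.Dual ℂ H)} {ξ : Module.Dual ℂ H} {m : M}
    (h : m ∈ wtSub M ξ) (h0 : m ≠ 0) (hA : m ∈ ⨆ η ∈ A, wtSub M η) : ξ ∈ A := by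
  by_contra hc
  refine h0 ?_
  have h1 := iSupIndep_wtSub (M := M) ξ
  have h2 : (⨆ η ∈ A, wtSub M η) ≤ ⨆ η, ⨆ _ : η ≠ ξ, wtSub M η :=
    iSup₂_le fun η hη => le_iSup₂_of_le η (fun e => hc (e ▸ hη)) le_rfl
  have := h1.le_bot ⟨h, h2 hA⟩
  simpa using this

theorem mem_biSup_wtSub {A : Set (Module.Dual ℂ H)} {ξ : Module.Dual ℂ H} (hξ : ξ ∈ A) {m : M}
    (hm : m ∈ wtSub M ξ) : m ∈ ⨆ η ∈ A, wtSub M η :=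
  Submodule.mem_iSup_of_mem ξ (Submodule.mem_iSup_of_mem hξ hm)

theorem lie_mem_wtSub_of_pos {α ξ : Module.Dual ℂ H} {x : L} (hx : IsPosVec b α x) {m : M}
    (hm : m ∈ wtSub M ξ) : ⁅x, m⁆ ∈ wtSub M (ξ + α) := fun h => by
  rw [leibniz_lie, hx.lie_cartan, hm h, smul_lie, lie_smul, LinearMap.add_apply, add_smul, add_comm]

theorem lie_mem_wtSub_of_neg {α ξ : Module.Dual ℂ H} {x : L} (hx : IsNegVec b α x) {m : M}
    (hm : m ∈ wtSub M ξ) : ⁅x, m⁆ ∈ wtSub M (ξ - α) := fun h => by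
  rw [leibniz_lie, hx.lie_cartan, hm h, neg_lie, smul_lie, lie_smul, LinearMap.sub_apply, sub_smul,
    sub_eq_neg_add]

theorem map_mem_wtSub {ξ : Module.Dual ℂ H} (g : M →ₗ⁅ℂ, L⁆ N) {m : M} (hm : m ∈ wtSub M ξ) :
    g m ∈ wtSub N ξ := fun h => by rw [← LieModuleHom.map_lie, hm h, map_smul]

variable {b}

theorem IsMaximalVector.mem_wtSub {lam : Module.Dual ℂ H} {m : M} (h : IsMaximalVector b lam m) :
    m ∈ wtSub M lam := h.2

theorem IsMaximalVector.lie_pos {lam : Module.Dual ℂ H} {m : M} (h : IsMaximalVector b lam m)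
    {α : Module.Dual ℂ H} {x : L} (hx : IsPosVec b α x) : ⁅x, m⁆ = 0 := by
  obtain ⟨i, hi, -, hx⟩ := hx
  exact h.1 i hi x hx

theorem isMaximalVector_iff {lam : Module.Dual ℂ H} {m : M} :
    IsMaximalVector b lam m ↔ (∀ α x, IsPosVec b α x → ⁅x, m⁆ = 0) ∧ m ∈ wtSub M lam :=
  ⟨fun h => ⟨fun _ _ hx => h.lie_pos hx, h.2⟩, fun h =>
    ⟨fun i hi x hx => h.1 _ x ⟨i, hi, rfl, hx⟩, h.2⟩⟩

theorem IsMaximalVector.map {lam : Module.Dual ℂ H} {m : M} (h : IsMaximalVector b lam m)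
    (g : M →ₗ⁅ℂ, L⁆ N) : IsMaximalVector b lam (g m) :=
  isMaximalVector_iff.2 ⟨fun α x hx => by rw [← LieModuleHom.map_lie, h.lie_pos hx, map_zero],
    map_mem_wtSub g h.2⟩

theorem IsMaximalVector.of_injective {lam : Module.Dual ℂ H} {m : M} (g : M →ₗ⁅ℂ, L⁆ N)
    (hg : Function.Injective g) (h : IsMaximalVector b lam (g m)) : IsMaximalVector b lam m :=
  isMaximalVector_iff.2 ⟨fun α x hx => hg (by rw [LieModuleHom.map_lie, h.lie_pos hx, map_zero]),
    fun x => hg (by rw [LieModuleHom.map_lie, h.2 x, map_smul])⟩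

/-- The highest weight of a finite-dimensional module is dominant. -/
theorem IsMaximalVector.isDominant [FiniteDimensional ℂ M] {lam : Module.Dual ℂ H} {m : M}
    (h : IsMaximalVector b lam m) (h0 : m ≠ 0) : IsDominant b lam := by
  intro i hi
  obtain ⟨t, e, f, ht, he, hf⟩ := IsKilling.exists_isSl2Triple_of_weight_isNonZero
    (H.isNonZero_coe_root i)
  have hh := ht.h_eq_coroot (H.isNonZero_coe_root i) he hf
  -- For the `sl₂`-triple of a simple root a maximal vector is primitive, so its eigenvalue under
  -- the coroot is a natural number.
  have P : IsSl2Triple.HasPrimitiveVectorWith ht m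
      (lam ((IsKilling.rootSystem H).coroot i)) :=
    { ne_zero := h0
      lie_h := by rw [hh]; exact h.2 _
      lie_e := h.lie_pos ⟨i, AddSubmonoid.subset_closure ⟨i, hi, rfl⟩, rfl, he⟩ }
  exact P.exists_nat

/-- A nonzero subspace stable under the Cartan subalgebra and the positive root vectors contains
a nonzero maximal vector. -/
theorem exists_isMaximalVector_mem [FiniteDimensional ℂ M] (T : Submodule ℂ M) (hT : T ≠ ⊥)
    (hc : ∀ (h : H), ∀ t ∈ T, ⁅(h : L), t⁆ ∈ T)
    (hp : ∀ α x, IsPosVec b α x → ∀ t ∈ T, ⁅x, t⁆ ∈ T) :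
    ∃ (lam : Module.Dual ℂ H) (m : M), m ∈ T ∧ m ≠ 0 ∧ IsMaximalVector b lam m := by
  let T' : LieSubmodule ℂ H M := { T with lie_mem := fun {h t} ht => hc h t ht }
  have : Nontrivial T' := Submodule.nontrivial_iff_ne_bot.2 hT
  -- Lie's theorem for the Cartan subalgebra provides one weight in `T`. Only finitely many occur,
  -- and a weight vector of greatest height is killed by the positive root vectors, as these raise
  -- the height by at least one.
  obtain ⟨χ, hχ⟩ := exists_nontrivial_weightSpace_of_isSolvable ℂ H T'
  have hχ' : T ⊓ wtSub M χ ≠ ⊥ := by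
    obtain ⟨⟨t, ht⟩, hne⟩ := exists_ne (0 : weightSpace T' χ)
    rw [Submodule.ne_bot_iff]
    refine ⟨t, ⟨t.2, fun h => ?_⟩, fun e => hne (Subtype.ext (Subtype.ext e))⟩
    exact congrArg Subtype.val ((mem_weightSpace _ t).1 ht h)
  let S : Set (Module.Dual ℂ H) := {ξ | T ⊓ wtSub M ξ ≠ ⊥}
  have hS : S.Finite := WellFoundedGT.finite_ne_bot_of_iSupIndep
    (iSupIndep_wtSub.mono fun ξ => inf_le_right)
  obtain ⟨ξ, hξ, hmax⟩ := Set.exists_max_image S (fun ξ => (height b ξ).re) hS ⟨χ, hχ'⟩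
  obtain ⟨m, ⟨hmT, hm⟩, h0⟩ := (Submodule.ne_bot_iff _).1 hξ
  refine ⟨ξ, m, hmT, h0, isMaximalVector_iff.2 ⟨fun α x hx => ?_, hm⟩⟩
  by_contra hne
  have : ξ + α ∈ S := (Submodule.ne_bot_iff _).2
    ⟨_, ⟨hp α x hx m hmT, lie_mem_wtSub_of_pos b hx hm⟩, hne⟩
  have h1 := hmax _ this
  have h2 := hx.one_le_height
  simp only [map_add, Complex.add_re] at h1
  linarith

variable (b) (M) in
theorem exists_isMaximalVector [FiniteDimensional ℂ M] [Nontrivial M] :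
    ∃ (lam : Module.Dual ℂ H) (m : M), m ≠ 0 ∧ IsMaximalVector b lam m := by
  obtain ⟨lam, m, -, h⟩ := exists_isMaximalVector_mem (b := b) (⊤ : Submodule ℂ M)
    top_ne_bot (fun _ _ _ => trivial) (fun _ _ _ _ _ => trivial)
  exact ⟨lam, m, h⟩

/-- A submodule that contains all maximal vectors is everything. -/
theorem eq_top_of_forall_isMaximalVector [FiniteDimensional ℂ M] (K : LieSubmodule ℂ L M)
    (h : ∀ (lam : DomWeight b) (m : M), IsMaximalVector b lam.1 m → m ∈ K) : K = ⊤ := by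
  obtain ⟨p, hp⟩ := exists_retraction K
  by_contra hK
  have hker : p.ker.toSubmodule ≠ ⊥ := by
    intro hb
    refine hK (eq_top_iff.2 fun m _ => ?_)
    have : m - (p m : M) ∈ p.ker.toSubmodule := by
      change p (m - (p m : M)) = 0
      rw [map_sub, hp, sub_self]
    rw [hb, Submodule.mem_bot, sub_eq_zero] at this
    rw [this]; exact (p m).2
  -- The kernel of the retraction is a complement of `K`; a maximal vector in it would lie in `K` as
  -- well.
  obtain ⟨lam, m, hm, h0, hmax⟩ := exists_isMaximalVector_mem (b := b) p.ker.toSubmodule hker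
    (fun x t ht => p.ker.lie_mem ht) (fun _ _ _ t ht => p.ker.lie_mem ht)
  have hmK := h ⟨lam, hmax.isDominant h0⟩ m hmax
  have h1 := hp ⟨m, hmK⟩
  have h2 : p m = 0 := hm
  rw [h2] at h1
  exact h0 (congrArg Subtype.val h1).symm

theorem le_of_forall_isMaximalVector [FiniteDimensional ℂ M] (K K' : LieSubmodule ℂ L M)
    (h : ∀ (lam : DomWeight b) (m : M), m ∈ K → IsMaximalVector b lam.1 m → m ∈ K') : K ≤ K' := by
  have := eq_top_of_forall_isMaximalVector (b := b) (K'.comap K.incl)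
    (fun lam m hm => h lam m.1 m.2 (hm.map K.incl))
  intro m hm
  have h1 : (⟨m, hm⟩ : K) ∈ K'.comap K.incl := by rw [this]; trivial
  exact h1

/-- Maximal vectors lift along surjections. -/
theorem IsMaximalVector.exists_lift [FiniteDimensional ℂ M] (g : M →ₗ⁅ℂ, L⁆ N)
    (hg : Function.Surjective g) {lam : Module.Dual ℂ H} {n : N} (h : IsMaximalVector b lam n) :
    ∃ m, g m = n ∧ IsMaximalVector b lam m := by
  obtain ⟨s, hs⟩ := exists_section g hg
  exact ⟨s n, hs n, h.map s⟩

/-- A subspace that contains a maximal vector and is stable under the negative root vectors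
contains the submodule generated by the vector. -/
theorem IsMaximalVector.lieSpan_le {lam : Module.Dual ℂ H} {m : M} (h : IsMaximalVector b lam m)
    (P : Submodule ℂ M) (hm : m ∈ P) (hP : ∀ α x, IsNegVec b α x → ∀ p ∈ P, ⁅x, p⁆ ∈ P) :
    (LieSubmodule.lieSpan ℂ L {m}).toSubmodule ≤ P := by
  -- `W` is the least subspace containing `m` and stable under the negative root vectors. Those of
  -- its elements that all of `L` sends into `W` form a subspace `P'` with the same two properties,
  -- so `W = P'` is already a submodule. This replaces the triangular decomposition of the
  -- enveloping algebra.
  let W : Submodule ℂ M :=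
    sInf {P | m ∈ P ∧ ∀ α x, IsNegVec b α x → ∀ p ∈ P, ⁅x, p⁆ ∈ P}
  have hmW : m ∈ W := by
    simp only [W, Submodule.mem_sInf]; exact fun P hP => hP.1
  have hWP : ∀ P : Submodule ℂ M, m ∈ P → (∀ α x, IsNegVec b α x → ∀ p ∈ P, ⁅x, p⁆ ∈ P) →
      W ≤ P := fun P h1 h2 => sInf_le ⟨h1, h2⟩
  have hneg : ∀ α x, IsNegVec b α x → ∀ p ∈ W, ⁅x, p⁆ ∈ W := by
    intro α x hx p hp
    simp only [W, Submodule.mem_sInf] at hp ⊢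
    exact fun P hP => hP.2 α x hx p (hp P hP)
  let P' : Submodule ℂ M :=
    { carrier := {w | w ∈ W ∧ ∀ x : L, ⁅x, w⁆ ∈ W}
      add_mem' := fun h1 h2 => ⟨W.add_mem h1.1 h2.1, fun x => by
        rw [lie_add]; exact W.add_mem (h1.2 x) (h2.2 x)⟩
      zero_mem' := ⟨W.zero_mem, fun x => by rw [lie_zero]; exact W.zero_mem⟩
      smul_mem' := fun c w h => ⟨W.smul_mem c h.1, fun x => by
        rw [lie_smul]; exact W.smul_mem c (h.2 x)⟩ }
  have hWP' : W ≤ P' := by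
    refine hWP P' ⟨hmW, fun x => ?_⟩ fun α x hx p hp => ⟨hneg α x hx p hp.1, fun y => ?_⟩
    · induction x using cartan_root_induction b with
      | zero => rw [zero_lie]; exact W.zero_mem
      | add x y hx hy => rw [add_lie]; exact W.add_mem hx hy
      | cartan x => rw [h.2 x]; exact W.smul_mem _ hmW
      | pos α x hx => rw [h.lie_pos hx]; exact W.zero_mem
      | neg α x hx => exact hneg α x hx m hmW
    · rw [leibniz_lie]
      exact W.add_mem (hp.2 _) (hneg α x hx _ (hp.2 y))
  let WL : LieSubmodule ℂ L M := { W with lie_mem := fun {x w} hw => (hWP' hw).2 x }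
  have h1 : LieSubmodule.lieSpan ℂ L {m} ≤ WL :=
    LieSubmodule.lieSpan_le.2 (by rintro _ rfl; exact hmW)
  exact fun x hx => hWP P hm hP (h1 hx)

variable (b) (M) in
/-- The sum of the weight spaces strictly below `lam`. -/
def belowSub (lam : Module.Dual ℂ H) : Submodule ℂ M :=
  ⨆ ξ ∈ {ξ | lam - ξ ∈ rootCone b ∧ ξ ≠ lam}, wtSub M ξ

/-- Lowering stays in the cone below `lam` and cannot return to `lam`, since that would put the
negative of a positive root into the cone, against heights. -/
theorem lie_mem_belowSub {lam : Module.Dual ℂ H} {α : Module.Dual ℂ H} {x : L}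
    (hx : IsNegVec b α x) {m : M} (hm : m ∈ wtSub M lam ⊔ belowSub b M lam) :
    ⁅x, m⁆ ∈ belowSub b M lam := by
  have hα := hx.one_le_height
  have key : ∀ ξ, lam - ξ ∈ rootCone b → wtSub M ξ ≤ (belowSub b M lam).comap (toEnd ℂ L M x) := by
    intro ξ hξ m hm
    refine Submodule.mem_iSup_of_mem (ξ - α) (Submodule.mem_iSup_of_mem ⟨?_, ?_⟩
      (lie_mem_wtSub_of_neg b hx hm))
    · rw [sub_sub_eq_add_sub, add_sub_right_comm]
      exact (rootCone b).add_mem hξ hx.mem_rootCone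
    · intro e
      have : lam - ξ = -α := by rw [← e]; abel
      rw [this] at hξ
      rcases height_of_mem_rootCone b hξ with h | h
      · rw [neg_eq_zero] at h
        rw [h] at hα; simp at hα; linarith
      · rw [map_neg, Complex.neg_re] at h; linarith
  have : wtSub M lam ⊔ belowSub b M lam ≤ (belowSub b M lam).comap (toEnd ℂ L M x) :=
    sup_le (key lam (by rw [sub_self]; exact zero_mem _)) (iSup₂_le fun ξ hξ => key ξ hξ.1)
  exact this hm

theorem IsMaximalVector.lieSpan_le_sup {lam : Module.Dual ℂ H} {m : M}
    (h : IsMaximalVector b lam m) :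
    (LieSubmodule.lieSpan ℂ L {m}).toSubmodule ≤ ℂ ∙ m ⊔ belowSub b M lam := by
  refine h.lieSpan_le _ (Submodule.mem_sup_left (Submodule.mem_span_singleton_self m))
    fun α x hx p hp => Submodule.mem_sup_right (lie_mem_belowSub hx ?_)
  have : ℂ ∙ m ⊔ belowSub b M lam ≤ wtSub M lam ⊔ belowSub b M lam :=
    sup_le_sup_right ((Submodule.span_singleton_le_iff_mem _ _).2 h.mem_wtSub) _
  exact this hp

theorem notMem_belowSub {lam : Module.Dual ℂ H} {m : M} (h : m ∈ wtSub M lam) (h0 : m ≠ 0) :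
    m ∉ belowSub b M lam := fun hm => (weight_mem_of_mem_iSup h h0 hm).2 rfl

/-- In a module generated by a maximal vector, the highest weight space is a line. -/
theorem IsMaximalVector.mem_span {lam : Module.Dual ℂ H} {m : M} (h : IsMaximalVector b lam m)
    (hgen : LieSubmodule.lieSpan ℂ L {m} = ⊤) {n : M} (hn : n ∈ wtSub M lam) :
    ∃ c : ℂ, n = c • m := by
  have h1 : n ∈ ℂ ∙ m ⊔ belowSub b M lam := h.lieSpan_le_sup (by rw [hgen]; trivial)
  obtain ⟨y, hy, z, hz, rfl⟩ := Submodule.mem_sup.1 h1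
  obtain ⟨c, rfl⟩ := Submodule.mem_span_singleton.1 hy
  refine ⟨c, ?_⟩
  have hz' : z ∈ wtSub M lam := by
    have := (wtSub M lam).sub_mem hn ((wtSub M lam).smul_mem c h.mem_wtSub)
    simpa using this
  by_cases h0 : z = 0
  · rw [h0, add_zero]
  · exact absurd hz (notMem_belowSub hz' h0)

/-- All weights of a module generated by a maximal vector lie below its weight. -/
theorem IsMaximalVector.sub_mem_rootCone {lam : Module.Dual ℂ H} {m : M}
    (h : IsMaximalVector b lam m)
    (hgen : LieSubmodule.lieSpan ℂ L {m} = ⊤) {ξ : Module.Dual ℂ H} {n : M} (hn : n ∈ wtSub M ξ)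
    (h0 : n ≠ 0) : lam - ξ ∈ rootCone b := by
  have h1 : n ∈ ℂ ∙ m ⊔ belowSub b M lam := h.lieSpan_le_sup (by rw [hgen]; trivial)
  have hlam : lam ∈ {ξ | lam - ξ ∈ rootCone b} := by
    rw [Set.mem_ofPred_eq, sub_self]; exact zero_mem _
  have h2 : ℂ ∙ m ⊔ belowSub b M lam ≤ ⨆ ξ ∈ {ξ | lam - ξ ∈ rootCone b}, wtSub M ξ :=
    sup_le ((Submodule.span_singleton_le_iff_mem _ _).2 (mem_biSup_wtSub hlam h.mem_wtSub))
      (iSup₂_le fun ξ hξ n hn => mem_biSup_wtSub (A := {ξ | lam - ξ ∈ rootCone b}) hξ.1 hn)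
  exact weight_mem_of_mem_iSup (A := {ξ | lam - ξ ∈ rootCone b}) hn h0 (h2 h1)

theorem lieSpan_mk_eq_top (m : M) :
    LieSubmodule.lieSpan ℂ L {(⟨m, LieSubmodule.subset_lieSpan rfl⟩ :
      LieSubmodule.lieSpan ℂ L {m})} = ⊤ := by
  set K := LieSubmodule.lieSpan ℂ L {m}
  set g : K := ⟨m, LieSubmodule.subset_lieSpan rfl⟩
  rw [eq_top_iff]
  rintro ⟨x, hx⟩ -
  have h1 : K ≤ (LieSubmodule.lieSpan ℂ L {g}).map K.incl :=
    LieSubmodule.lieSpan_le.2 (by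
      rintro _ rfl
      exact (LieSubmodule.mem_map _).2 ⟨g, LieSubmodule.subset_lieSpan rfl, rfl⟩)
  obtain ⟨y, hy, hyx⟩ := (LieSubmodule.mem_map _).1 (h1 hx)
  have : y = ⟨x, hx⟩ := Subtype.ext hyx
  exact this ▸ hy

/-- A finite-dimensional module generated by a nonzero maximal vector is simple. -/
theorem IsMaximalVector.isSimpleHW [FiniteDimensional ℂ M] {lam : Module.Dual ℂ H} {m : M}
    (h : IsMaximalVector b lam m) (h0 : m ≠ 0) (hgen : LieSubmodule.lieSpan ℂ L {m} = ⊤) :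
    IsSimpleHW b lam M := by
  have : Nontrivial M := ⟨m, 0, h0⟩
  refine ⟨inferInstance, IsIrreducible.mk fun K hK => ?_, m, h0, h⟩
  obtain ⟨p, hp⟩ := exists_retraction K
  -- The retraction onto `K` preserves weights, so it sends `m` to `c • m`. If `c = 0` it kills the
  -- generator and `K = ⊥`; otherwise `K` contains `m`.
  obtain ⟨c, hc⟩ := h.mem_span hgen (map_mem_wtSub K.incl (map_mem_wtSub p h.mem_wtSub))
  have hc : (p m : M) = c • m := hc
  by_cases hc0 : c = 0
  · exfalso
    apply hK
    have h1 : LieSubmodule.lieSpan ℂ L {m} ≤ p.ker :=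
      LieSubmodule.lieSpan_le.2 (Set.singleton_subset_iff.2
        (LieModuleHom.mem_ker.2 (Subtype.ext (by rw [hc, hc0, zero_smul]; rfl))))
    rw [hgen] at h1
    rw [LieSubmodule.eq_bot_iff]
    intro k hk
    have h2 : p k = 0 := h1 trivial
    rw [hp ⟨k, hk⟩] at h2
    exact congrArg Subtype.val h2
  · rw [eq_top_iff, ← hgen, LieSubmodule.lieSpan_le, Set.singleton_subset_iff]
    have : c⁻¹ • (p m : M) ∈ K := K.smul_mem _ (p m).2
    rw [hc, smul_smul, inv_mul_cancel₀ hc0, one_smul] at this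
    exact this

/-- The simple module generated by a maximal vector. -/
def IsMaximalVector.model [FiniteDimensional ℂ M] {lam : Module.Dual ℂ H} {m : M}
    (h : IsMaximalVector b lam m) (h0 : m ≠ 0) :
    SimpleModel.{u, w} b ⟨lam, h.isDominant h0⟩ where
  carrier := LieSubmodule.lieSpan ℂ L {m}
  isSimpleHW := IsMaximalVector.isSimpleHW
    (m := (⟨m, LieSubmodule.subset_lieSpan rfl⟩ : LieSubmodule.lieSpan ℂ L {m}))
    (.of_injective (LieSubmodule.incl _) Subtype.val_injective h)
    (fun e => h0 (congrArg Subtype.val e)) (lieSpan_mk_eq_top m)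

theorem IsSimpleHW.lieSpan_eq_top {lam : Module.Dual ℂ H} (hM : IsSimpleHW b lam M) {m : M}
    (h0 : m ≠ 0) : LieSubmodule.lieSpan ℂ L {m} = ⊤ := by
  have := hM.2.1
  refine (eq_bot_or_eq_top _).resolve_left fun hb => h0 ?_
  have h1 : m ∈ LieSubmodule.lieSpan ℂ L {m} := LieSubmodule.subset_lieSpan rfl
  rw [hb] at h1
  simpa using h1

/-- A simple module has only one highest weight. -/
theorem IsSimpleHW.eq_of_isMaximalVector {lam ξ : Module.Dual ℂ H} (hM : IsSimpleHW b lam M)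
    {m : M} (h0 : m ≠ 0) (h : IsMaximalVector b ξ m) : ξ = lam := by
  obtain ⟨v, hv0, hv⟩ := hM.2.2
  -- Both vectors generate, so each of the two weights lies below the other.
  have h1 := hv.sub_mem_rootCone (hM.lieSpan_eq_top hv0) h.mem_wtSub h0
  have h2 := h.sub_mem_rootCone (hM.lieSpan_eq_top h0) hv.mem_wtSub hv0
  rcases height_of_mem_rootCone b h1 with h1 | h1
  · exact (sub_eq_zero.1 h1).symm
  · rcases height_of_mem_rootCone b h2 with h2 | h2
    · exact sub_eq_zero.1 h2
    · rw [map_sub, Complex.sub_re] at h1 h2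
      linarith

theorem hasConstituent_of_isMaximalVector [FiniteDimensional ℂ M] {lam : DomWeight b} {m : M}
    (h : IsMaximalVector b lam.1 m) (h0 : m ≠ 0) : HasConstituent b lam M :=
  ⟨LieSubmodule.lieSpan ℂ L {m}, h.model h0, LieModuleHom.id, Function.surjective_id⟩

theorem HasConstituent.exists_isMaximalVector [FiniteDimensional ℂ M] {lam : DomWeight b}
    (h : HasConstituent b lam M) : ∃ m : M, m ≠ 0 ∧ IsMaximalVector b lam.1 m := by
  obtain ⟨K, S, f, hf⟩ := h
  obtain ⟨v, hv0, hv⟩ := S.isSimpleHW.2.2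
  obtain ⟨k, hk, hkm⟩ := hv.exists_lift f hf
  refine ⟨k, fun e => hv0 ?_, hkm.map K.incl⟩
  have : k = 0 := Subtype.ext e
  rw [← hk, this, map_zero]

variable (b) (M) in
theorem exists_hasConstituent [FiniteDimensional ℂ M] [Nontrivial M] :
    ∃ lam : DomWeight b, HasConstituent b lam M := by
  obtain ⟨lam, m, h0, h⟩ := exists_isMaximalVector b M
  exact ⟨⟨lam, h.isDominant h0⟩, hasConstituent_of_isMaximalVector h h0⟩

variable (M) in
/-- A finite-dimensional module is the sum of its weight spaces. -/
theorem iSup_wtSub_eq_top [FiniteDimensional ℂ M]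
    (b : (IsKilling.rootSystem H).Base) : ⨆ ξ : Module.Dual ℂ H, wtSub M ξ = ⊤ := by
  have key : ∀ x : L, (⨆ ξ : Module.Dual ℂ H, wtSub M ξ) ≤
      (⨆ ξ : Module.Dual ℂ H, wtSub M ξ).comap (toEnd ℂ L M x) := by
    intro x
    refine iSup_le fun ξ m hm => ?_
    change ⁅x, m⁆ ∈ ⨆ ξ : Module.Dual ℂ H, wtSub M ξ
    induction x using cartan_root_induction b with
    | zero => rw [zero_lie]; exact Submodule.zero_mem _
    | add x y hx hy => rw [add_lie]; exact Submodule.add_mem _ hx hy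
    | cartan x => rw [hm x]; exact Submodule.smul_mem _ _ (Submodule.mem_iSup_of_mem ξ hm)
    | pos α x hx => exact Submodule.mem_iSup_of_mem _ (lie_mem_wtSub_of_pos b hx hm)
    | neg α x hx => exact Submodule.mem_iSup_of_mem _ (lie_mem_wtSub_of_neg b hx hm)
  -- Root vectors permute weight spaces, so their sum is a submodule; it contains all maximal
  -- vectors.
  let K : LieSubmodule ℂ L M :=
    { (⨆ ξ : Module.Dual ℂ H, wtSub M ξ : Submodule ℂ M) with
      lie_mem := fun {x m} hm => key x hm }
  have : K = ⊤ := eq_top_of_forall_isMaximalVector (b := b) K fun lam m hm =>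
    Submodule.mem_iSup_of_mem lam.1 hm.mem_wtSub
  exact congrArg LieSubmodule.toSubmodule this

/-- The coordinate functional of the highest weight vector. -/
theorem IsMaximalVector.exists_dual {lam : Module.Dual ℂ H} {m : M}
    (h : IsMaximalVector b lam m) (h0 : m ≠ 0) (hgen : LieSubmodule.lieSpan ℂ L {m} = ⊤) :
    ∃ ψ : M →ₗ[ℂ] ℂ, ψ m = 1 ∧ (∀ (x : H) (n : M), ψ ⁅(x : L), n⁆ = lam x * ψ n) ∧
      ∀ α x, IsNegVec b α x → ∀ n : M, ψ ⁅x, n⁆ = 0 := by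
  -- The functional is chosen to vanish on the lower weight spaces and not at `m`; negative root
  -- vectors map the whole module into these spaces.
  obtain ⟨φ, hφ, hker⟩ := Submodule.exists_le_ker_of_notMem
    (notMem_belowSub (b := b) (M := M) h.mem_wtSub h0)
  have hD : ∀ n ∈ belowSub b M lam, φ n = 0 := fun n hn => hker hn
  have hsplit : ∀ n : M, ∃ c : ℂ, ∃ z ∈ belowSub b M lam, n = c • m + z := fun n => by
    have h1 : n ∈ ℂ ∙ m ⊔ belowSub b M lam := h.lieSpan_le_sup (by rw [hgen]; trivial)
    obtain ⟨y, hy, z, hz, rfl⟩ := Submodule.mem_sup.1 h1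
    obtain ⟨c, rfl⟩ := Submodule.mem_span_singleton.1 hy
    exact ⟨c, z, hz, rfl⟩
  have hDH : ∀ (x : H), ∀ z ∈ belowSub b M lam, ⁅(x : L), z⁆ ∈ belowSub b M lam := by
    intro x
    have : belowSub b M lam ≤ (belowSub b M lam).comap (toEnd ℂ L M x) :=
      iSup₂_le fun ξ hξ z hz => by
        change ⁅(x : L), z⁆ ∈ belowSub b M lam
        rw [hz x]
        exact Submodule.smul_mem _ _ (Submodule.mem_iSup_of_mem ξ (Submodule.mem_iSup_of_mem hξ hz))
    exact this
  refine ⟨(φ m)⁻¹ • φ, ?_, fun x n => ?_, fun α x hx n => ?_⟩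
  · simp [hφ]
  · obtain ⟨c, z, hz, rfl⟩ := hsplit n
    simp only [lie_add, lie_smul, h.2 x, LinearMap.smul_apply, map_add, hD z hz,
      hD _ (hDH x z hz), map_smul, smul_eq_mul]
    ring
  · rw [LinearMap.smul_apply, hD _ (lie_mem_belowSub hx ?_), smul_zero]
    obtain ⟨c, z, hz, rfl⟩ := hsplit n
    exact Submodule.add_mem_sup ((wtSub M lam).smul_mem c h.mem_wtSub) hz

end Modules

end HighestWeight

/-! ## Maximal vectors in tensor products -/

section TensorWeights

set_option linter.unusedSectionVars false

open LieModule LieAlgebra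

variable {L : Type u} [LieRing L] [LieAlgebra ℂ L] [FiniteDimensional ℂ L]
  [LieAlgebra.IsSemisimple ℂ L] {H : LieSubalgebra ℂ L} [H.IsCartanSubalgebra]
  {b : (LieAlgebra.IsKilling.rootSystem H).Base}
  {A : Type w} [AddCommGroup A] [Module ℂ A] [LieRingModule L A] [LieModule ℂ L A]
  {F : Type w} [AddCommGroup F] [Module ℂ F] [LieRingModule L F] [LieModule ℂ L F]

variable (A F) in
/-- Contraction of `A ⊗ F` with a functional on `A`. -/
def contractFst : Module.Dual ℂ A →ₗ[ℂ] A ⊗[ℂ] F →ₗ[ℂ] F :=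
  (TensorProduct.lift.equiv (RingHom.id ℂ) A F F).toLinearMap ∘ₗ
    (LinearMap.mk₂ ℂ (fun (ω : Module.Dual ℂ A) (a : A) => ω a • LinearMap.id (R := ℂ) (M := F))
      (fun _ _ _ => by simp [add_smul]) (fun _ _ _ => by simp [mul_smul])
      (fun _ _ _ => by simp [add_smul]) (fun _ _ _ => by simp [mul_smul]))

@[simp] theorem contractFst_tmul (ω : Module.Dual ℂ A) (a : A) (f : F) :
    contractFst A F ω (a ⊗ₜ f) = ω a • f := by
  simp [contractFst]

variable (A F) in
/-- Contraction of `A ⊗ F` with a functional on `F`. -/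
def contractSnd (ψ : Module.Dual ℂ F) : A ⊗[ℂ] F →ₗ[ℂ] A :=
  TensorProduct.lift (LinearMap.mk₂ ℂ (fun (a : A) (f : F) => ψ f • a)
      (fun _ _ _ => by simp) (fun _ _ _ => by simp [smul_smul, mul_comm])
      (fun _ _ _ => by simp [add_smul]) (fun _ _ _ => by simp [mul_smul]))

@[simp] theorem contractSnd_tmul (ψ : Module.Dual ℂ F) (a : A) (f : F) :
    contractSnd A F ψ (a ⊗ₜ f) = ψ f • a := by
  simp [contractSnd]

/-- Leibniz rule for contraction. It shows that the contractions of a maximal vector form a subspace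
stable under the Borel subalgebra. -/
theorem contractFst_lie (ω : Module.Dual ℂ A) (x : L) (m : A ⊗[ℂ] F) :
    contractFst A F ω ⁅x, m⁆ = contractFst A F (ω ∘ₗ toEnd ℂ L A x) m + ⁅x, contractFst A F ω m⁆ := by
  induction m using TensorProduct.induction_on with
  | zero => simp
  | add y z hy hz => simp only [lie_add, map_add, hy, hz]; abel
  | tmul a f => simp [TensorProduct.LieModule.lie_tmul_right]

theorem contractSnd_lie (ψ : Module.Dual ℂ F) (x : L) (m : A ⊗[ℂ] F) :
    contractSnd A F ψ ⁅x, m⁆ = ⁅x, contractSnd A F ψ m⁆ + contractSnd A F (ψ ∘ₗ toEnd ℂ L F x) m := by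
  induction m using TensorProduct.induction_on with
  | zero => simp
  | add y z hy hz => simp only [lie_add, map_add, hy, hz]; abel
  | tmul a f => simp [TensorProduct.LieModule.lie_tmul_right]

theorem contractSnd_smul (c : ℂ) (ψ : Module.Dual ℂ F) (m : A ⊗[ℂ] F) :
    contractSnd A F (c • ψ) m = c • contractSnd A F ψ m := by
  induction m using TensorProduct.induction_on with
  | zero => simp
  | add y z hy hz => simp only [map_add, hy, hz, smul_add]
  | tmul a f => simp [mul_smul]

theorem apply_contractSnd (ω : Module.Dual ℂ A) (ψ : Module.Dual ℂ F) (m : A ⊗[ℂ] F) :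
    ω (contractSnd A F ψ m) = ψ (contractFst A F ω m) := by
  induction m using TensorProduct.induction_on with
  | zero => simp
  | add y z hy hz => simp only [map_add, hy, hz]
  | tmul a f => simp [mul_comm]

theorem exists_contractFst_ne_zero [FiniteDimensional ℂ A] {m : A ⊗[ℂ] F} (h : m ≠ 0) :
    ∃ ω, contractFst A F ω m ≠ 0 := by
  by_contra! hc
  let e := Module.finBasis ℂ A
  have : ∀ m : A ⊗[ℂ] F, m = ∑ i, e i ⊗ₜ contractFst A F (e.coord i) m := by
    intro m
    induction m using TensorProduct.induction_on with
    | zero => simp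
    | add y z hy hz =>
      conv_lhs => rw [hy, hz]
      simp [TensorProduct.tmul_add, Finset.sum_add_distrib]
    | tmul a f =>
      have := congrArg (fun z => z ⊗ₜ[ℂ] f) (e.sum_repr a)
      simp only [TensorProduct.sum_tmul, TensorProduct.smul_tmul] at this
      simpa using this.symm
  apply h
  rw [this m]
  simp [hc]

/-- A maximal vector of weight `ν` in `A ⊗ F` gives a maximal vector of some weight `ξ` in `F` such
that `ν - ξ` is a weight of `A`. -/
theorem IsMaximalVector.exists_of_tensor [FiniteDimensional ℂ A] [FiniteDimensional ℂ F]
    {ν : Module.Dual ℂ H} {m : A ⊗[ℂ] F} (h : IsMaximalVector b ν m) (h0 : m ≠ 0) :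
    ∃ (ξ : Module.Dual ℂ H) (t : F), t ≠ 0 ∧ IsMaximalVector b ξ t ∧
      ∃ a : A, a ≠ 0 ∧ a ∈ wtSub A (ν - ξ) := by
  -- The `F`-components of `m`. Since `m` is an eigenvector of the Cartan subalgebra and is killed
  -- by the positive root vectors, `T` is stable under both and so contains a maximal vector `t`.
  let T : Submodule ℂ F := LinearMap.range ((contractFst A F).flip m)
  have hmem : ∀ ω, contractFst A F ω m ∈ T := fun ω => ⟨ω, rfl⟩
  obtain ⟨ω₀, hω₀⟩ := exists_contractFst_ne_zero h0
  have hT : T ≠ ⊥ := (Submodule.ne_bot_iff _).2 ⟨_, hmem ω₀, hω₀⟩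
  obtain ⟨ξ, t, htT, ht0, ht⟩ := exists_isMaximalVector_mem (b := b) T hT
    (by
      rintro x _ ⟨ω, rfl⟩
      have := contractFst_lie ω (x : L) m
      rw [h.2 x, map_smul, ← sub_eq_iff_eq_add'] at this
      change ⁅(x : L), contractFst A F ω m⁆ ∈ T
      rw [← this]
      exact T.sub_mem (T.smul_mem _ (hmem ω)) (hmem _))
    (by
      rintro α x hx _ ⟨ω, rfl⟩
      have := contractFst_lie ω (x : L) m
      rw [h.lie_pos hx, map_zero, ← sub_eq_iff_eq_add'] at this
      change ⁅(x : L), contractFst A F ω m⁆ ∈ T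
      rw [← this]
      exact T.sub_mem T.zero_mem (hmem _))
  refine ⟨ξ, t, ht0, ht, ?_⟩
  obtain ⟨ω, hω⟩ := htT
  have hω : contractFst A F ω m = t := hω
  let K := LieSubmodule.lieSpan ℂ L {t}
  obtain ⟨p, hp⟩ := exists_retraction K
  let tK : K := ⟨t, LieSubmodule.subset_lieSpan rfl⟩
  obtain ⟨ψ, hψ1, hψH, -⟩ := IsMaximalVector.exists_dual (m := tK) (b := b) (lam := ξ)
    (.of_injective K.incl Subtype.val_injective ht)
    (fun e => ht0 (congrArg Subtype.val e)) (lieSpan_mk_eq_top t)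
  -- A functional on `F` of weight `ξ` with value one at `t`: retract onto the module generated by
  -- `t`, then take the highest coordinate. Contracting `m` with it leaves a vector of `A` of weight
  -- `ν - ξ`, nonzero because pairing it with `ω` gives `φ t = 1`.
  let φ : F →ₗ[ℂ] ℂ := ψ ∘ₗ (p : F →ₗ[ℂ] K)
  have hφ : φ t = 1 := by
    change ψ (p t) = 1
    rw [hp tK, hψ1]
  have hφH : ∀ x : H, φ ∘ₗ toEnd ℂ L F x = ξ x • φ := fun x => by
    ext f
    change ψ (p ⁅(x : L), f⁆) = ξ x * ψ (p f)
    rw [LieModuleHom.map_lie, hψH]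
  refine ⟨contractSnd A F φ m, fun e => ?_, fun x => ?_⟩
  · have := apply_contractSnd ω φ m
    rw [e, hω, hφ, map_zero] at this
    exact zero_ne_one this
  · have := contractSnd_lie φ (x : L) m
    rw [h.2 x, map_smul, hφH, contractSnd_smul, ← sub_eq_iff_eq_add] at this
    rw [← this, LinearMap.sub_apply, sub_smul]

variable (b) (A) in
/-- A basis of weight vectors, ordered by descending height. -/
theorem exists_weightBasis [FiniteDimensional ℂ A] :
    ∃ (n : ℕ) (e : Module.Basis (Fin n) ℂ A) (ζ : Fin n → Module.Dual ℂ H),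
      (∀ i, e i ∈ wtSub A (ζ i)) ∧ (Antitone fun i => (height b (ζ i)).re) ∧
      ∀ ξ, {i | ζ i = ξ}.ncard = Module.finrank ℂ (wtSub A ξ) := by
  classical
  have hint := DirectSum.isInternal_submodule_of_iSupIndep_of_iSup_eq_top
    (iSupIndep_wtSub (H := H) (M := A)) (iSup_wtSub_eq_top A b)
  let e₀ := hint.collectedBasis fun ξ => Module.finBasis ℂ (wtSub A ξ)
  have he₀ : ∀ i, e₀ i ∈ wtSub A i.1 := fun i => hint.collectedBasis_mem _ i
  have : Finite (Σ ξ : Module.Dual ℂ H, Fin (Module.finrank ℂ (wtSub A ξ))) :=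
    Module.Finite.finite_basis e₀
  have := Fintype.ofFinite (Σ ξ : Module.Dual ℂ H, Fin (Module.finrank ℂ (wtSub A ξ)))
  let σ₀ := Fintype.equivFin (Σ ξ : Module.Dual ℂ H, Fin (Module.finrank ℂ (wtSub A ξ)))
  -- Sorting the negated heights in ascending order puts the heights in descending order.
  let g : Fin _ → ℝ := fun i => -(height b (σ₀.symm i).1).re
  let σ := (Tuple.sort g).trans σ₀.symm
  refine ⟨_, e₀.reindex σ.symm, fun i => (σ i).1, fun i => ?_, fun i j hij => ?_, fun ξ => ?_⟩
  · rw [Module.Basis.reindex_apply]; exact he₀ _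
  · have := Tuple.monotone_sort g hij
    exact neg_le_neg_iff.1 this
  · have h1 : {i | (σ i).1 = ξ} = σ ⁻¹' {i | i.1 = ξ} := rfl
    have h2 : {i : Σ ξ : Module.Dual ℂ H, Fin (Module.finrank ℂ (wtSub A ξ)) | i.1 = ξ} =
        Set.range (Sigma.mk ξ) := by
      ext ⟨η, i⟩
      constructor
      · rintro rfl; exact ⟨i, rfl⟩
      · rintro ⟨j, hj⟩; exact (congrArg Sigma.fst hj).symm
    rw [h1, Set.ncard_preimage_of_injective_subset_range σ.injective (by simp), h2,
      ← Set.image_univ, Set.ncard_image_of_injective _ sigma_mk_injective, Set.ncard_univ]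
    simp

end TensorWeights

/-! ## The order `≼_Ψ` -/

section Rigid

set_option linter.unusedSectionVars false

variable {L : Type u} [LieRing L] [LieAlgebra ℂ L] {H : LieSubalgebra ℂ L}
  {Ψ : Finset (Module.Dual ℂ H)} {W : Set (Module.Dual ℂ H)}

theorem sum_toMultiset (f : Module.Dual ℂ H →₀ ℕ) :
    (Finsupp.toMultiset f).sum = f.sum fun β c => c • β := by
  rw [Finsupp.toMultiset_apply]
  have := map_finsuppSum (Multiset.sumAddMonoidHom : Multiset (Module.Dual ℂ H) →+ Module.Dual ℂ H) f
    (fun a n => n • ({a} : Multiset (Module.Dual ℂ H)))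
  refine this.trans (Finsupp.sum_congr fun x _ => ?_)
  change (f x • ({x} : Multiset (Module.Dual ℂ H))).sum = _
  rw [Multiset.sum_nsmul, Multiset.sum_singleton]

theorem card_toMultiset' (f : Module.Dual ℂ H →₀ ℕ) :
    (Finsupp.toMultiset f).card = f.sum fun _ c => c := Finsupp.card_toMultiset f

/-- In multiset form, concatenating paths of weights is addition and the number of steps is the
cardinality. -/
theorem IsRigid.multiset (h : IsRigid Ψ W) {m r : Multiset (Module.Dual ℂ H)}
    (hm : ∀ x ∈ m, x ∈ Ψ) (hr : ∀ x ∈ r, x ∈ W) (e : m.sum = r.sum) :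
    m.card ≤ r.card ∧ (m.card = r.card ↔ ∀ x ∈ r, x ∈ Ψ) := by
  classical
  obtain ⟨m, rfl⟩ : ∃ f, Finsupp.toMultiset f = m := ⟨_, Multiset.toFinsupp_toMultiset m⟩
  obtain ⟨r, rfl⟩ : ∃ f, Finsupp.toMultiset f = r := ⟨_, Multiset.toFinsupp_toMultiset r⟩
  simp only [Finsupp.mem_toMultiset] at hm hr ⊢
  rw [sum_toMultiset, sum_toMultiset] at e
  rw [card_toMultiset', card_toMultiset']
  have := h m r hm hr e
  simpa only [Finsupp.mem_support_iff, Nat.pos_iff_ne_zero] using this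

theorem IsRigid.card_eq (h : IsRigid Ψ W) (hsub : (Ψ : Set (Module.Dual ℂ H)) ⊆ W)
    {m r : Multiset (Module.Dual ℂ H)} (hm : ∀ x ∈ m, x ∈ Ψ) (hr : ∀ x ∈ r, x ∈ Ψ)
    (e : m.sum = r.sum) : m.card = r.card :=
  ((h.multiset hm (fun x hx => hsub (hr x hx)) e).2).2 hr

theorem psiLe_iff {μ ν : Module.Dual ℂ H} :
    psiLe Ψ μ ν ↔ ∃ m : Multiset (Module.Dual ℂ H), (∀ x ∈ m, x ∈ Ψ) ∧ m.sum = ν - μ := by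
  constructor
  · intro h
    exact AddSubmonoid.exists_multiset_of_mem_closure h
  · rintro ⟨m, hm, e⟩
    unfold psiLe
    rw [← e]
    exact AddSubmonoid.multiset_sum_mem _ _ fun x hx => AddSubmonoid.subset_closure (hm x hx)

/-- Rigidity makes all expressions of one weight by elements of `Ψ` equally long, so the minimum is
taken over a singleton. The distance is then additive along chains. -/
theorem IsRigid.psiDist_eq (h : IsRigid Ψ W) (hsub : (Ψ : Set (Module.Dual ℂ H)) ⊆ W)
    {μ ν : Module.Dual ℂ H} {m : Multiset (Module.Dual ℂ H)} (hm : ∀ x ∈ m, x ∈ Ψ)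
    (e : m.sum = ν - μ) : psiDist Ψ μ ν = m.card := by
  classical
  have : {n | ∃ m : Module.Dual ℂ H →₀ ℕ, m.support ⊆ Ψ ∧
      ν - μ = m.sum (fun β c => c • β) ∧ n = m.sum (fun _ c => c)} = {m.card} := by
    ext n
    simp only [Set.mem_singleton_iff]
    constructor
    · rintro ⟨r, hr, hs, rfl⟩
      rw [← card_toMultiset']
      refine h.card_eq hsub (fun x hx => hr ((Finsupp.mem_toMultiset _ _).1 hx)) hm ?_
      rw [sum_toMultiset, ← hs, e]
    · rintro rfl
      obtain ⟨m, rfl⟩ : ∃ f, Finsupp.toMultiset f = m := ⟨_, Multiset.toFinsupp_toMultiset m⟩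
      exact ⟨m, fun x hx => hm x ((Finsupp.mem_toMultiset _ _).2 hx), by rw [← e, sum_toMultiset],
        card_toMultiset' m⟩
  unfold psiDist
  rw [this, csInf_singleton]

variable [FiniteDimensional ℂ L] [LieAlgebra.IsSemisimple ℂ L] [H.IsCartanSubalgebra]
  {b : (LieAlgebra.IsKilling.rootSystem H).Base}

theorem IsRigid.preceq_iff (h : IsRigid Ψ W) (hsub : (Ψ : Set (Module.Dual ℂ H)) ⊆ W)
    {p q : Lam b} : preceq Ψ p q ↔ ∃ m : Multiset (Module.Dual ℂ H), (∀ x ∈ m, x ∈ Ψ) ∧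
      m.sum = q.1.1 - p.1.1 ∧ (m.card : ℤ) = q.2 - p.2 := by
  unfold preceq
  rw [psiLe_iff]
  constructor
  · rintro ⟨⟨m, hm, e⟩, hd⟩
    rw [h.psiDist_eq hsub hm e] at hd
    exact ⟨m, hm, e, hd⟩
  · rintro ⟨m, hm, e, hd⟩
    rw [h.psiDist_eq hsub hm e]
    exact ⟨⟨m, hm, e⟩, hd⟩

/-- If `p₀ ≼ p` and `p₀ ≼ q`, then any expression of the difference of weights of `p` and `q` by the
right number of elements of `W` consists of elements of `Ψ`. -/
theorem IsRigid.forall_mem (h : IsRigid Ψ W) (hsub : (Ψ : Set (Module.Dual ℂ H)) ⊆ W)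
    {p₀ p q : Lam b} (hp : preceq Ψ p₀ p) (hq : preceq Ψ p₀ q)
    {r : Multiset (Module.Dual ℂ H)} (hr : ∀ x ∈ r, x ∈ W) (hs : r.sum = q.1.1 - p.1.1)
    (hc : (r.card : ℤ) = q.2 - p.2) : ∀ x ∈ r, x ∈ Ψ := by
  obtain ⟨m, hm, em, cm⟩ := (h.preceq_iff hsub).1 hp
  obtain ⟨n, hn, en, cn⟩ := (h.preceq_iff hsub).1 hq
  -- Prefixing `r` with the path from `p₀` to `p` gives an expression for the path from `p₀` to `q`
  -- with the same number of summands; this is the equality case of rigidity.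
  have := (h.multiset (m := n) (r := m + r) hn
    (fun x hx => (Multiset.mem_add.1 hx).elim (fun hx => hsub (hm x hx)) (hr x))
    (by rw [Multiset.sum_add, em, hs, en]; abel)).2.1
    (by rw [Multiset.card_add]; omega)
  exact fun x hx => this x (Multiset.mem_add.2 (Or.inr hx))

theorem IsRigid.preceq_of_multiset (h : IsRigid Ψ W) (hsub : (Ψ : Set (Module.Dual ℂ H)) ⊆ W)
    {p₀ p q : Lam b} (hp : preceq Ψ p₀ p) (hq : preceq Ψ p₀ q)
    {r : Multiset (Module.Dual ℂ H)} (hr : ∀ x ∈ r, x ∈ W) (hs : r.sum = q.1.1 - p.1.1)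
    (hc : (r.card : ℤ) = q.2 - p.2) : preceq Ψ p q :=
  (h.preceq_iff hsub).2 ⟨r, h.forall_mem hsub hp hq hr hs hc, hs, hc⟩

end Rigid

/-! ## The exterior algebra as a representation -/

section Exterior

set_option linter.unusedSectionVars false

variable {L : Type u} [LieRing L] [LieAlgebra ℂ L]
  {V : Type v} [AddCommGroup V] [Module ℂ V] [LieRingModule L V] [LieModule ℂ L V]
  [FiniteDimensional ℂ V]

variable (V) in
/-- Contraction of the exterior algebra by a functional. -/
abbrev extContract (d : Module.Dual ℂ V) : ExteriorAlgebra ℂ V →ₗ[ℂ] ExteriorAlgebra ℂ V :=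
  CliffordAlgebra.contractLeft (Q := (0 : QuadraticForm ℂ V)) d

theorem extContract_ι_mul (d : Module.Dual ℂ V) (v : V) (ω : ExteriorAlgebra ℂ V) :
    extContract V d (ExteriorAlgebra.ι ℂ v * ω) =
      d v • ω - ExteriorAlgebra.ι ℂ v * extContract V d ω :=
  CliffordAlgebra.contractLeft_ι_mul (Q := (0 : QuadraticForm ℂ V)) d v ω

theorem extContract_algebraMap (d : Module.Dual ℂ V) (c : ℂ) :
    extContract V d (algebraMap ℂ _ c) = 0 :=
  CliffordAlgebra.contractLeft_algebraMap (Q := (0 : QuadraticForm ℂ V)) d c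

theorem ext_ι_mul_ι_mul (v w : V) (ω : ExteriorAlgebra ℂ V) :
    ExteriorAlgebra.ι ℂ v * (ExteriorAlgebra.ι ℂ w * ω) =
      -(ExteriorAlgebra.ι ℂ w * (ExteriorAlgebra.ι ℂ v * ω)) := by
  rw [← mul_assoc, ← mul_assoc, ← neg_mul,
    eq_neg_of_add_eq_zero_left (ExteriorAlgebra.ι_add_mul_swap v w)]

theorem ext_induction {P : ExteriorAlgebra ℂ V → Prop} (hc : ∀ c, P (algebraMap ℂ _ c))
    (ha : ∀ x y, P x → P y → P (x + y)) (hm : ∀ x v, P x → P (ExteriorAlgebra.ι ℂ v * x))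
    (x : ExteriorAlgebra ℂ V) : P x :=
  CliffordAlgebra.left_induction (Q := (0 : QuadraticForm ℂ V)) hc ha hm x

/-- The derivation of the exterior algebra that extends an endomorphism of `V`. -/
def extDer (T : Module.End ℂ V) : ExteriorAlgebra ℂ V →ₗ[ℂ] ExteriorAlgebra ℂ V :=
  ∑ i, LinearMap.mulLeft ℂ (ExteriorAlgebra.ι ℂ (T (Module.finBasis ℂ V i))) ∘ₗ
    extContract V ((Module.finBasis ℂ V).coord i)

theorem extDer_algebraMap (T : Module.End ℂ V) (c : ℂ) : extDer T (algebraMap ℂ _ c) = 0 := by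
  simp only [extDer, LinearMap.sum_apply, LinearMap.comp_apply, extContract_algebraMap, map_zero,
    Finset.sum_const_zero]

theorem extDer_ι_mul (T : Module.End ℂ V) (v : V) (ω : ExteriorAlgebra ℂ V) :
    extDer T (ExteriorAlgebra.ι ℂ v * ω) =
      ExteriorAlgebra.ι ℂ (T v) * ω + ExteriorAlgebra.ι ℂ v * extDer T ω := by
  have h : ∑ i, (Module.finBasis ℂ V).coord i v •
      ExteriorAlgebra.ι ℂ (T (Module.finBasis ℂ V i)) = ExteriorAlgebra.ι ℂ (T v) := by
    conv_rhs => rw [← (Module.finBasis ℂ V).sum_repr v]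
    simp only [map_sum, map_smul, Module.Basis.coord_apply]
  simp only [extDer, LinearMap.sum_apply, LinearMap.comp_apply, extContract_ι_mul,
    LinearMap.mulLeft_apply, mul_sub, Finset.sum_sub_distrib, mul_smul_comm, ← smul_mul_assoc]
  rw [← Finset.sum_mul, h, sub_eq_add_neg, ← Finset.sum_neg_distrib, Finset.mul_sum]
  simp only [← ext_ι_mul_ι_mul]

/-- The exterior counterpart of Euler's identity: it contributes the exterior degree to the
eigenvalue of the Koszul homotopy. -/
theorem extDer_id_of_mem {n : ℕ} {ω : ExteriorAlgebra ℂ V}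
    (h : ω ∈ ⋀[ℂ]^n V) : extDer LinearMap.id ω = (n : ℂ) • ω := by
  induction h using Submodule.pow_induction_on_left' with
  | algebraMap r => simp [extDer_algebraMap]
  | add x y i hx hy h1 h2 => rw [map_add, h1, h2, smul_add]
  | mem_mul m hm i x hx h =>
    obtain ⟨v, rfl⟩ := hm
    rw [extDer_ι_mul, h]
    simp only [LinearMap.id_apply, mul_smul_comm]
    push_cast
    module

/-- `L` acts on the exterior algebra by derivations. -/
instance : LieRingModule L (ExteriorAlgebra ℂ V) where
  bracket x ω := extDer (LieModule.toEnd ℂ L V x) ω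
  add_lie x y ω := by
    simp [extDer, add_mul, Finset.sum_add_distrib]
  lie_add x a b := map_add _ a b
  leibniz_lie x y ω := by
    induction ω using ext_induction with
    | hc c => simp [extDer_algebraMap]
    | ha ω ω' h h' =>
      simp only [map_add, h, h']; abel
    | hm ω v h =>
      simp only [extDer_ι_mul, map_add, h, mul_add, LieModule.toEnd_apply_apply, lie_lie, map_sub,
        sub_mul]
      abel

theorem ext_lie_def (x : L) (ω : ExteriorAlgebra ℂ V) :
    ⁅x, ω⁆ = extDer (LieModule.toEnd ℂ L V x) ω := rfl

instance : LieModule ℂ L (ExteriorAlgebra ℂ V) where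
  smul_lie c x ω := by simp [ext_lie_def, extDer, Finset.smul_sum]
  lie_smul c x ω := map_smul _ c ω

theorem ext_lie_ι_mul (x : L) (v : V) (ω : ExteriorAlgebra ℂ V) :
    ⁅x, ExteriorAlgebra.ι ℂ v * ω⁆ =
      ExteriorAlgebra.ι ℂ ⁅x, v⁆ * ω + ExteriorAlgebra.ι ℂ v * ⁅x, ω⁆ :=
  extDer_ι_mul _ v ω

theorem ext_lie_algebraMap (x : L) (c : ℂ) :
    ⁅x, algebraMap ℂ (ExteriorAlgebra ℂ V) c⁆ = 0 :=
  extDer_algebraMap _ c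

/-- Contraction is equivariant in both arguments jointly, the action on functionals being `d ↦ -d ∘
x`. -/
theorem ext_lie_contract (x : L) (d : Module.Dual ℂ V) (ω : ExteriorAlgebra ℂ V) :
    ⁅x, extContract V d ω⁆ =
      extContract V d ⁅x, ω⁆ - extContract V (d ∘ₗ LieModule.toEnd ℂ L V x) ω := by
  induction ω using ext_induction with
  | hc c => simp [ext_lie_algebraMap]
  | ha a b h h' => simp only [map_add, lie_add, h, h']; abel
  | hm a v h =>
    simp only [extContract_ι_mul, ext_lie_ι_mul, lie_sub, lie_smul, h, map_add, LinearMap.comp_apply,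
      LieModule.toEnd_apply_apply, mul_sub]
    abel

variable (L V) in
/-- The exterior power as a representation. -/
def extPart (n : ℕ) : LieSubmodule ℂ L (ExteriorAlgebra ℂ V) where
  toSubmodule := ⋀[ℂ]^n V
  lie_mem := by
    intro x ω h
    change ω ∈ ⋀[ℂ]^n V at h
    change ⁅x, ω⁆ ∈ ⋀[ℂ]^n V
    induction h using Submodule.pow_induction_on_left' with
    | algebraMap r => rw [ext_lie_algebraMap]; exact Submodule.zero_mem _
    | add a b i ha hb h1 h2 => rw [lie_add]; exact Submodule.add_mem _ h1 h2
    | mem_mul m hm i a ha h =>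
      obtain ⟨v, rfl⟩ := hm
      rw [ext_lie_ι_mul]
      change _ ∈ (LinearMap.range (ExteriorAlgebra.ι ℂ) : Submodule ℂ (ExteriorAlgebra ℂ V)) ^ (i + 1)
      rw [pow_succ']
      exact Submodule.add_mem _ (Submodule.mul_mem_mul ⟨_, rfl⟩ ha)
        (Submodule.mul_mem_mul ⟨v, rfl⟩ h)

theorem mem_extPart {n : ℕ} {ω : ExteriorAlgebra ℂ V} : ω ∈ extPart L V n ↔ ω ∈ ⋀[ℂ]^n V := Iff.rfl

instance (n : ℕ) : FiniteDimensional ℂ (extPart L V n) :=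
  inferInstanceAs (FiniteDimensional ℂ (⋀[ℂ]^n V))

theorem ι_mul_mem_extPart {n : ℕ} (v : V) {ω : ExteriorAlgebra ℂ V} (h : ω ∈ extPart L V n) :
    ExteriorAlgebra.ι ℂ v * ω ∈ extPart L V (n + 1) := by
  change _ ∈ (LinearMap.range (ExteriorAlgebra.ι ℂ) : Submodule ℂ (ExteriorAlgebra ℂ V)) ^ (n + 1)
  rw [pow_succ']
  exact Submodule.mul_mem_mul ⟨v, rfl⟩ h

theorem extContract_eq_zero_of_mem {ω : ExteriorAlgebra ℂ V} (d : Module.Dual ℂ V)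
    (h : ω ∈ extPart L V 0) : extContract V d ω = 0 := by
  change _ ∈ (LinearMap.range (ExteriorAlgebra.ι ℂ) : Submodule ℂ (ExteriorAlgebra ℂ V)) ^ 0 at h
  rw [pow_zero] at h
  obtain ⟨c, rfl⟩ := Submodule.mem_one.1 h
  exact extContract_algebraMap d c

theorem extContract_mem {n : ℕ} (d : Module.Dual ℂ V) {ω : ExteriorAlgebra ℂ V}
    (h : ω ∈ extPart L V (n + 1)) : extContract V d ω ∈ extPart L V n := by
  -- Truncated subtraction in `m - 1` lets the induction start in degree zero, where contraction
  -- vanishes.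
  suffices ∀ (m : ℕ) (ω : ExteriorAlgebra ℂ V), ω ∈ ⋀[ℂ]^m V →
      extContract V d ω ∈ ⋀[ℂ]^(m - 1) V from this _ ω h
  intro m ω h
  induction h using Submodule.pow_induction_on_left' with
  | algebraMap r => rw [extContract_algebraMap]; exact Submodule.zero_mem _
  | add a b i ha hb h1 h2 => rw [map_add]; exact Submodule.add_mem _ h1 h2
  | mem_mul m hm i a ha h =>
    obtain ⟨v, rfl⟩ := hm
    rw [extContract_ι_mul]
    refine Submodule.sub_mem _ (Submodule.smul_mem _ _ ha) ?_
    rcases i with - | i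
    · rw [extContract_eq_zero_of_mem (L := L) d (mem_extPart.2 ha), mul_zero]
      exact Submodule.zero_mem _
    · have := ι_mul_mem_extPart (L := L) v (mem_extPart.2 h)
      exact this

variable (L) in
/-- Exterior multiplication `⋀ⁿ V → ⋀ⁿ⁺¹ V` by a vector. -/
def extMul (n : ℕ) (v : V) : extPart L V n →ₗ[ℂ] extPart L V (n + 1) :=
  (LinearMap.mulLeft ℂ (ExteriorAlgebra.ι ℂ v)).restrict fun _ h => ι_mul_mem_extPart v h

variable (L V) in
/-- Contraction `⋀ⁿ⁺¹ V → ⋀ⁿ V`. -/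
def extCon (n : ℕ) : Module.Dual ℂ V →ₗ[ℂ] extPart L V (n + 1) →ₗ[ℂ] extPart L V n :=
  LinearMap.mk₂ ℂ (fun d ω => ⟨extContract V d ω.1, extContract_mem d ω.2⟩)
    (fun _ _ _ => by ext; simp) (fun _ _ _ => by ext; simp)
    (fun _ _ _ => by ext; simp) (fun _ _ _ => by ext; simp)

@[simp] theorem extMul_coe (n : ℕ) (v : V) (ω : extPart L V n) :
    (extMul L n v ω : ExteriorAlgebra ℂ V) = ExteriorAlgebra.ι ℂ v * ω := rfl

@[simp] theorem extCon_coe (n : ℕ) (d : Module.Dual ℂ V) (ω : extPart L V (n + 1)) :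
    (extCon L V n d ω : ExteriorAlgebra ℂ V) = extContract V d ω := rfl

end Exterior

/-! ## Partial derivatives on the symmetric algebra -/

section Partial

set_option linter.unusedSectionVars false

variable {L : Type u} [LieRing L] [LieAlgebra ℂ L]
  {V : Type v} [AddCommGroup V] [Module ℂ V] [LieRingModule L V] [LieModule ℂ L V]

/-- The derivative of the symmetric algebra along a functional. -/
def symPartial (d : Module.Dual ℂ V) : Derivation ℂ (SymmetricAlgebra ℂ V) (SymmetricAlgebra ℂ V) :=
  let F : SymmetricAlgebra ℂ V →ₐ[ℂ]
      TrivSqZeroExt (SymmetricAlgebra ℂ V) (SymmetricAlgebra ℂ V) :=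
    SymmetricAlgebra.lift
      ((TrivSqZeroExt.inlAlgHom ℂ (SymmetricAlgebra ℂ V) (SymmetricAlgebra ℂ V)).toLinearMap ∘ₗ
          SymmetricAlgebra.ι ℂ V +
        (TrivSqZeroExt.inrHom (SymmetricAlgebra ℂ V) (SymmetricAlgebra ℂ V)).restrictScalars ℂ ∘ₗ
          Algebra.linearMap ℂ _ ∘ₗ d)
  have hF : ∀ a, (F a).fst = a := fun a => by
    have : (TrivSqZeroExt.fstHom ℂ (SymmetricAlgebra ℂ V) (SymmetricAlgebra ℂ V)).comp F =
        AlgHom.id ℂ _ := by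
      apply SymmetricAlgebra.algHom_ext
      ext v
      simp [F]
    exact congrArg (fun f : SymmetricAlgebra ℂ V →ₐ[ℂ] SymmetricAlgebra ℂ V => f a) this
  { toLinearMap :=
      (TrivSqZeroExt.sndHom (SymmetricAlgebra ℂ V) (SymmetricAlgebra ℂ V)).restrictScalars ℂ ∘ₗ
        F.toLinearMap
    map_one_eq_zero' := by simp
    leibniz' := fun a b => by simp [hF, mul_comm] }

@[simp] theorem symPartial_ι (d : Module.Dual ℂ V) (v : V) :
    symPartial d (SymmetricAlgebra.ι ℂ V v) = algebraMap ℂ _ (d v) := by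
  simp [symPartial, Algebra.algebraMap_eq_smul_one]

theorem mem_symPart {k : ℤ} {a : SymmetricAlgebra ℂ V} : a ∈ symPart L V k ↔
    a ∈ (if 0 ≤ k then LinearMap.range (SymmetricAlgebra.ι ℂ V) ^ k.toNat else ⊥ :
      Submodule ℂ (SymmetricAlgebra ℂ V)) := Iff.rfl

theorem mem_symPart_natCast {n : ℕ} {a : SymmetricAlgebra ℂ V} : a ∈ symPart L V n ↔
    a ∈ LinearMap.range (SymmetricAlgebra.ι ℂ V) ^ n := by
  rw [mem_symPart, if_pos (by omega), Int.toNat_natCast]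

theorem eq_zero_of_mem_symPart {k : ℤ} (hk : k < 0) {a : SymmetricAlgebra ℂ V}
    (h : a ∈ symPart L V k) : a = 0 := by
  rwa [mem_symPart, if_neg (by omega), Submodule.mem_bot] at h

/-- Induction over the elements of `Symᵏ V`. -/
theorem symPart_induction {P : ∀ (k : ℤ) (a : SymmetricAlgebra ℂ V), a ∈ symPart L V k → Prop}
    (hz : ∀ k, P k 0 (zero_mem _))
    (hc : ∀ c h, P 0 (algebraMap ℂ _ c) h)
    (ha : ∀ k x y hx hy, P k x hx → P k y hy → P k (x + y) (add_mem hx hy))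
    (hm : ∀ (n : ℕ) x v (hx : x ∈ symPart L V n), P n x hx →
      P (n + 1) (SymmetricAlgebra.ι ℂ V v * x) (mul_mem_symPart rfl v hx))
    {k : ℤ} {a : SymmetricAlgebra ℂ V} (h : a ∈ symPart L V k) : P k a h := by
  rcases lt_or_ge k 0 with hk | hk
  · obtain rfl := eq_zero_of_mem_symPart hk h
    exact hz k
  · obtain ⟨n, rfl⟩ := Int.eq_ofNat_of_zero_le hk
    suffices ∃ h, P n a h from this.2
    clear hk
    replace h := mem_symPart_natCast.1 h
    induction h using Submodule.pow_induction_on_left' with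
    | algebraMap r => exact ⟨mem_symPart_natCast.2 (by simp), hc r _⟩
    | add a b i ha' hb h1 h2 => exact ⟨_, ha _ _ _ _ _ h1.2 h2.2⟩
    | mem_mul m hm' i a ha h =>
      obtain ⟨v, rfl⟩ := hm'
      have := hm i a v _ h.2
      refine ⟨mul_mem_symPart (by push_cast; rfl) v (mem_symPart_natCast.2 ha), ?_⟩
      convert this using 1
      exact Nat.cast_succ i

theorem symPartial_mem (d : Module.Dual ℂ V) {k l : ℤ} (hl : k = l + 1) {a : SymmetricAlgebra ℂ V}
    (h : a ∈ symPart L V k) : symPartial d a ∈ symPart L V l := by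
  obtain rfl : l = k - 1 := by omega
  clear hl
  induction h using symPart_induction with
  | hz k => simp
  | hc c _ => simp
  | ha k x y _ _ h1 h2 => rw [map_add]; exact add_mem h1 h2
  | hm n x v hx h =>
    rw [Derivation.leibniz, symPartial_ι, smul_eq_mul, smul_eq_mul, mul_comm x, ← Algebra.smul_def,
      add_sub_cancel_right]
    refine add_mem (mul_mem_symPart (by omega) v h) (SMulMemClass.smul_mem _ hx)

variable (L) in
/-- The partial derivative `Symᵏ⁺¹ V → Symᵏ V`. -/
def symPar (d : Module.Dual ℂ V) {k l : ℤ} (h : k = l + 1) : symPart L V k →ₗ[ℂ] symPart L V l :=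
  (symPartial d).toLinearMap.restrict fun _ ha => symPartial_mem d h ha

@[simp] theorem symPar_coe (d : Module.Dual ℂ V) {k l : ℤ} (h : k = l + 1) (a : symPart L V k) :
    (symPar L d h a : SymmetricAlgebra ℂ V) = symPartial d a := rfl

@[simp] theorem symMul_coe {k l : ℤ} (h : l = k + 1) (v : V) (a : symPart L V k) :
    (symMul L h v a : SymmetricAlgebra ℂ V) = SymmetricAlgebra.ι ℂ V v * a := rfl

variable [FiniteDimensional ℂ V]

/-- Euler's identity. -/
theorem sum_mul_symPartial {k : ℤ} {a : SymmetricAlgebra ℂ V} (h : a ∈ symPart L V k) :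
    ∑ i, SymmetricAlgebra.ι ℂ V (Module.finBasis ℂ V i) *
      symPartial ((Module.finBasis ℂ V).coord i) a = (k : ℂ) • a := by
  induction h using symPart_induction with
  | hz k => simp
  | hc c _ => simp
  | ha k x y _ _ h1 h2 =>
    simp only [map_add, mul_add, Finset.sum_add_distrib, h1, h2, smul_add]
  | hm n x v hx h =>
    simp only [Derivation.leibniz, symPartial_ι, smul_eq_mul, mul_add, Finset.sum_add_distrib]
    have h1 : ∀ i, SymmetricAlgebra.ι ℂ V (Module.finBasis ℂ V i) *
        (SymmetricAlgebra.ι ℂ V v * symPartial ((Module.finBasis ℂ V).coord i) x) =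
        SymmetricAlgebra.ι ℂ V v * (SymmetricAlgebra.ι ℂ V (Module.finBasis ℂ V i) *
        symPartial ((Module.finBasis ℂ V).coord i) x) := fun i => mul_left_comm _ _ _
    have h2 : ∀ i, SymmetricAlgebra.ι ℂ V (Module.finBasis ℂ V i) *
        (x * algebraMap ℂ _ ((Module.finBasis ℂ V).coord i v)) =
        SymmetricAlgebra.ι ℂ V ((Module.finBasis ℂ V).repr v i • Module.finBasis ℂ V i) * x :=
      fun i => by
        rw [map_smul, smul_mul_assoc, mul_comm x, ← Algebra.smul_def, mul_smul_comm]; rfl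
    simp only [h1, h2, ← Finset.mul_sum, h, ← Finset.sum_mul, ← map_sum, Module.Basis.sum_repr]
    push_cast
    rw [mul_smul_comm]
    module

instance (k : ℤ) : FiniteDimensional ℂ (symPart L V k) := by
  suffices (if 0 ≤ k then LinearMap.range (SymmetricAlgebra.ι ℂ V) ^ k.toNat
      else ⊥ : Submodule ℂ (SymmetricAlgebra ℂ V)).FG from Module.Finite.iff_fg.2 this
  split_ifs
  · exact Submodule.FG.pow (Module.Finite.iff_fg.1 inferInstance) _
  · exact Submodule.fg_bot

end Partial

/-! ## The Koszul complex -/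

section Koszul

set_option linter.unusedSectionVars false

variable {L : Type u} [LieRing L] [LieAlgebra ℂ L]
  {V : Type v} [AddCommGroup V] [Module ℂ V] [LieRingModule L V] [LieModule ℂ L V]
  [FiniteDimensional ℂ V]

/-- The canonical element `∑ eᵢ ⊗ eⁱ` of `V ⊗ V*` does not distinguish an endomorphism on the first
factor from its transpose on the second. This invariance makes the Koszul differential and later
`dualTensor` compatible with `L`. -/
theorem sum_apply_coord {Z : Type*} [AddCommGroup Z] [Module ℂ Z]
    (Θ : V →ₗ[ℂ] Module.Dual ℂ V →ₗ[ℂ] Z) (T : Module.End ℂ V) :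
    ∑ i, Θ (T (Module.finBasis ℂ V i)) ((Module.finBasis ℂ V).coord i) =
      ∑ i, Θ (Module.finBasis ℂ V i) ((Module.finBasis ℂ V).coord i ∘ₗ T) := by
  set e := Module.finBasis ℂ V
  have h1 : ∀ i, T (e i) = ∑ j, e.coord j (T (e i)) • e j := fun i => (e.sum_repr _).symm
  have h2 : ∀ j, e.coord j ∘ₗ T = ∑ i, e.coord j (T (e i)) • e.coord i := fun j =>
    e.ext fun i => by
      simp [Finsupp.single_apply]
  simp_rw [h2]
  conv_lhs => enter [2, i]; rw [h1 i]
  simp only [map_sum, map_smul, LinearMap.sum_apply, LinearMap.smul_apply]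
  rw [Finset.sum_comm]

variable (V)
variable (E : Type v) [AddCommGroup E] [Module ℂ E] [LieRingModule L E] [LieModule ℂ L E]

variable (L) in
/-- The terms of the Koszul resolution of `E`, placed in degree `s`. -/
abbrev koszulObj (s : ℤ) (j : ℕ) : GrMod L V := inducedObj V (extPart L V j ⊗[ℂ] E) (s + j)

variable (L) in
/-- The Koszul differential as a linear map. -/
def koszulLin {k l : ℤ} (h : l = k + 1) (j : ℕ) :
    symPart L V k ⊗[ℂ] (extPart L V (j + 1) ⊗[ℂ] E) →ₗ[ℂ]
      symPart L V l ⊗[ℂ] (extPart L V j ⊗[ℂ] E) :=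
  ∑ i, TensorProduct.map (symMul L h (Module.finBasis ℂ V i))
    ((extCon L V j ((Module.finBasis ℂ V).coord i)).rTensor E)

theorem koszulLin_tmul {k l : ℤ} (h : l = k + 1) (j : ℕ) (a : symPart L V k)
    (ω : extPart L V (j + 1)) (e : E) :
    koszulLin L V E h j (a ⊗ₜ (ω ⊗ₜ e)) = ∑ i, symMul L h (Module.finBasis ℂ V i) a ⊗ₜ
      (extCon L V j ((Module.finBasis ℂ V).coord i) ω ⊗ₜ e) := by
  simp [koszulLin]

variable {V E} in
theorem tensor_induction₃ {A B : Type v} [AddCommGroup A] [Module ℂ A] [AddCommGroup B] [Module ℂ B]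
    {P : A ⊗[ℂ] (B ⊗[ℂ] E) → Prop} (h0 : P 0) (ha : ∀ x y, P x → P y → P (x + y))
    (ht : ∀ a b e, P (a ⊗ₜ (b ⊗ₜ e))) (m : A ⊗[ℂ] (B ⊗[ℂ] E)) : P m := by
  induction m using TensorProduct.induction_on with
  | zero => exact h0
  | add x y hx hy => exact ha x y hx hy
  | tmul a z =>
    induction z using TensorProduct.induction_on with
    | zero => rwa [TensorProduct.tmul_zero]
    | add x y hx hy => rw [TensorProduct.tmul_add]; exact ha _ _ hx hy
    | tmul b e => exact ht a b e

/-- Multiplication and contraction are equivariant, and the differential applies them along the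
canonical element; the two error terms cancel by `sum_apply_coord`. -/
theorem koszulLin_lie {k l : ℤ} (h : l = k + 1) (j : ℕ) (x : L)
    (m : symPart L V k ⊗[ℂ] (extPart L V (j + 1) ⊗[ℂ] E)) :
    koszulLin L V E h j ⁅x, m⁆ = ⁅x, koszulLin L V E h j m⁆ := by
  induction m using tensor_induction₃ with
  | h0 => simp
  | ha y z hy hz => simp only [lie_add, map_add, hy, hz]
  | ht a ω e =>
    simp only [TensorProduct.LieModule.lie_tmul_right, TensorProduct.tmul_add, map_add,
      koszulLin_tmul, lie_sum]
    have h1 : ∀ v, ⁅x, symMul L h v a⁆ = symMul L h ⁅x, v⁆ a + symMul L h v ⁅x, a⁆ := fun v => by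
      refine Subtype.ext ?_
      change ⁅x, SymmetricAlgebra.ι ℂ V v * a.1⁆ =
        SymmetricAlgebra.ι ℂ V ⁅x, v⁆ * a.1 + SymmetricAlgebra.ι ℂ V v * ⁅x, a.1⁆
      rw [lie_mul_sym, lie_ι, mul_comm a.1, add_comm]
    have h2 : ∀ d, ⁅x, extCon L V j d ω⁆ = extCon L V j d ⁅x, ω⁆ -
        extCon L V j (d ∘ₗ LieModule.toEnd ℂ L V x) ω := fun d =>
      Subtype.ext (ext_lie_contract x d ω.1)
    let Θ : V →ₗ[ℂ] Module.Dual ℂ V →ₗ[ℂ] symPart L V l ⊗[ℂ] (extPart L V j ⊗[ℂ] E) :=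
      LinearMap.mk₂ ℂ (fun v d => symMul L h v a ⊗ₜ[ℂ] (extCon L V j d ω ⊗ₜ[ℂ] e))
        (fun _ _ _ => by simp [TensorProduct.add_tmul])
        (fun _ _ _ => by simp [TensorProduct.smul_tmul'])
        (fun _ _ _ => by simp [TensorProduct.add_tmul, TensorProduct.tmul_add])
        (fun _ _ _ => by
          simp only [map_smul, LinearMap.smul_apply, ← TensorProduct.smul_tmul',
            TensorProduct.tmul_smul])
    have h3 : ∑ i, symMul L h ⁅x, Module.finBasis ℂ V i⁆ a ⊗ₜ[ℂ]
        (extCon L V j ((Module.finBasis ℂ V).coord i) ω ⊗ₜ[ℂ] e) =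
        ∑ i, symMul L h (Module.finBasis ℂ V i) a ⊗ₜ[ℂ] (extCon L V j
          ((Module.finBasis ℂ V).coord i ∘ₗ LieModule.toEnd ℂ L V x) ω ⊗ₜ[ℂ] e) :=
      sum_apply_coord Θ (LieModule.toEnd ℂ L V x)
    simp only [h1, h2, TensorProduct.add_tmul, TensorProduct.sub_tmul, TensorProduct.tmul_sub,
      Finset.sum_add_distrib, Finset.sum_sub_distrib]
    rw [h3]
    abel

/-- The Koszul differential. -/
def koszulD (s : ℤ) (j : ℕ) : koszulObj L V E s (j + 1) ⟶ koszulObj L V E s j where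
  f k :=
    { koszulLin L V E (k := k - (s + (j + 1 : ℕ))) (l := k - (s + j)) (by push_cast; ring) j with
      map_lie' := fun {x m} => koszulLin_lie V E _ j x m }
  f_act k v m := by
    change koszulLin L V E (k := k + 1 - (s + (j + 1 : ℕ))) (l := k + 1 - (s + j)) _ j
      ((symMul L _ v).rTensor _ m) = (symMul L _ v).rTensor _
        (koszulLin L V E (k := k - (s + (j + 1 : ℕ))) (l := k - (s + j)) _ j m)
    induction m using tensor_induction₃ with
    | h0 => simp
    | ha y z hy hz => simp only [map_add, hy, hz]
    | ht a ω e =>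
      simp only [LinearMap.rTensor_tmul, koszulLin_tmul, map_sum]
      refine Finset.sum_congr rfl fun i _ => ?_
      congr 1
      exact Subtype.ext (mul_left_comm _ _ _)

variable (L) in
/-- The homotopy for the Koszul differential. -/
def koszulH {k l : ℤ} (h : k = l + 1) (j : ℕ) :
    symPart L V k ⊗[ℂ] (extPart L V j ⊗[ℂ] E) →ₗ[ℂ]
      symPart L V l ⊗[ℂ] (extPart L V (j + 1) ⊗[ℂ] E) :=
  ∑ i, TensorProduct.map (symPar L ((Module.finBasis ℂ V).coord i) h)
    ((extMul L j (Module.finBasis ℂ V i)).rTensor E)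

theorem koszulH_tmul {k l : ℤ} (h : k = l + 1) (j : ℕ) (a : symPart L V k)
    (ω : extPart L V j) (e : E) :
    koszulH L V E h j (a ⊗ₜ (ω ⊗ₜ e)) = ∑ i, symPar L ((Module.finBasis ℂ V).coord i) h a ⊗ₜ
      (extMul L j (Module.finBasis ℂ V i) ω ⊗ₜ e) := by
  simp [koszulH]

variable {V} in
theorem extCon_extMul (j : ℕ) (v : V) (d : Module.Dual ℂ V) (ω : extPart L V (j + 1)) :
    extCon L V (j + 1) d (extMul L (j + 1) v ω) = d v • ω - extMul L j v (extCon L V j d ω) :=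
  Subtype.ext (extContract_ι_mul d v ω.1)

variable {V} in
theorem extCon_extMul_zero (v : V) (d : Module.Dual ℂ V) (ω : extPart L V 0) :
    extCon L V 0 d (extMul L 0 v ω) = d v • ω := by
  refine Subtype.ext ((extContract_ι_mul d v ω.1).trans ?_)
  rw [extContract_eq_zero_of_mem d ω.2, mul_zero, sub_zero]
  rfl

/-- In exterior degree zero there is no outgoing differential, and Euler's identity alone gives the
eigenvalue. -/
theorem koszulLin_koszulH_zero {k l : ℤ} (h : k = l + 1) (m : symPart L V k ⊗[ℂ]
    (extPart L V 0 ⊗[ℂ] E)) :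
    koszulLin L V E h 0 (koszulH L V E h 0 m) = (k : ℂ) • m := by
  induction m using tensor_induction₃ with
  | h0 => simp
  | ha y z hy hz => simp only [map_add, hy, hz, smul_add]
  | ht a ω e =>
    simp only [koszulH_tmul, koszulLin_tmul, map_sum, extCon_extMul_zero]
    have h1 : ∑ i, symMul L h (Module.finBasis ℂ V i)
        (symPar L ((Module.finBasis ℂ V).coord i) h a) = (k : ℂ) • a :=
      Subtype.ext (by simpa using sum_mul_symPartial a.2)
    simp [Finsupp.single_apply, ite_smul, TensorProduct.ite_tmul, TensorProduct.tmul_ite, ← TensorProduct.sum_tmul, h1,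
      TensorProduct.smul_tmul']

/-- The cross terms, one multiplication with one derivative and one wedge with one contraction,
cancel. What remains is the Euler operator on the symmetric factor plus the degree operator on the
exterior factor. -/
theorem koszulLin_koszulH {k l q : ℤ} (h : k = l + 1) (h' : q = k + 1) (j : ℕ)
    (m : symPart L V k ⊗[ℂ] (extPart L V (j + 1) ⊗[ℂ] E)) :
    koszulLin L V E h (j + 1) (koszulH L V E h (j + 1) m) +
      koszulH L V E h' j (koszulLin L V E h' j m) = ((k : ℂ) + (j + 1 : ℕ)) • m := by
  induction m using tensor_induction₃ with
  | h0 => simp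
  | ha y z hy hz => rw [smul_add, ← hy, ← hz]; simp only [map_add]; abel
  | ht a ω e =>
    have h1 : ∑ i, symMul L h (Module.finBasis ℂ V i)
        (symPar L ((Module.finBasis ℂ V).coord i) h a) = (k : ℂ) • a :=
      Subtype.ext (by simpa using sum_mul_symPartial a.2)
    have h2 : ∑ i, extMul L j (Module.finBasis ℂ V i)
        (extCon L V j ((Module.finBasis ℂ V).coord i) ω) = ((j + 1 : ℕ) : ℂ) • ω :=
      Subtype.ext (by simpa [extDer] using extDer_id_of_mem ω.2)
    have h3 : ∀ i i', symPar L ((Module.finBasis ℂ V).coord i') h'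
        (symMul L h' (Module.finBasis ℂ V i) a) =
        (Module.finBasis ℂ V).coord i' (Module.finBasis ℂ V i) • a +
        symMul L h (Module.finBasis ℂ V i) (symPar L ((Module.finBasis ℂ V).coord i') h a) :=
      fun i i' => Subtype.ext (by
        simp [Derivation.leibniz, Algebra.smul_def, mul_comm])
    simp only [koszulH_tmul, koszulLin_tmul, map_sum, extCon_extMul, h3, TensorProduct.add_tmul,
      TensorProduct.sub_tmul, TensorProduct.tmul_sub, Finset.sum_add_distrib,
      Finset.sum_sub_distrib]
    have h4 : ∀ c c' x : symPart L V k ⊗[ℂ] (extPart L V (j + 1) ⊗[ℂ] E),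
      c - x + (c' + x) = c + c' := fun _ _ _ => by abel
    refine (congrArg₂ (· + ·) rfl (congrArg₂ (· + ·) rfl Finset.sum_comm)).trans ?_
    refine (h4 _ _ _).trans ?_
    generalize ((j + 1 : ℕ) : ℂ) = c at h2 ⊢
    simp [Finsupp.single_apply, ite_smul, TensorProduct.ite_tmul, TensorProduct.tmul_ite,
      ← TensorProduct.sum_tmul, ← TensorProduct.tmul_sum, h1, h2, ← TensorProduct.smul_tmul', add_smul]

end Koszul

/-! ## The universal property of the induced modules -/

section Adjunction

set_option linter.unusedSectionVars false

variable {L : Type u} [LieRing L] [LieAlgebra ℂ L]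
  {V : Type v} [AddCommGroup V] [Module ℂ V] [LieRingModule L V] [LieModule ℂ L V]

namespace GrMod

variable (M : GrMod L V)

/-- The action of `V` on the direct sum of the components of a graded module. -/
def sumAct (v : V) : Module.End ℂ (DirectSum ℤ M.X) :=
  DirectSum.toModule ℂ ℤ _ fun r => DirectSum.lof ℂ ℤ M.X (r + 1) ∘ₗ M.act r v

theorem sumAct_lof (v : V) (r : ℤ) (m : M.X r) :
    M.sumAct v (DirectSum.lof ℂ ℤ M.X r m) = DirectSum.lof ℂ ℤ M.X (r + 1) (M.act r v m) := by
  simp [sumAct]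

theorem sum_ext {T : Type*} [AddCommGroup T] [Module ℂ T] {f g : DirectSum ℤ M.X →ₗ[ℂ] T}
    (h : ∀ r m, f (DirectSum.lof ℂ ℤ M.X r m) = g (DirectSum.lof ℂ ℤ M.X r m)) : f = g :=
  DirectSum.linearMap_ext ℂ fun r => LinearMap.ext (h r)

theorem sumAct_comm (v w : V) : M.sumAct v * M.sumAct w = M.sumAct w * M.sumAct v :=
  M.sum_ext fun r m => by simp only [Module.End.mul_apply, sumAct_lof, M.act_comm]

theorem sumAct_apply_succ (v : V) (t : DirectSum ℤ M.X) (k : ℤ) :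
    M.sumAct v t (k + 1) = M.act k v (t k) := by
  refine LinearMap.congr_fun (M.sum_ext (f := DirectSum.component ℂ ℤ M.X (k + 1) ∘ₗ M.sumAct v)
    (g := M.act k v ∘ₗ DirectSum.component ℂ ℤ M.X k) fun r m => ?_) t
  rw [LinearMap.comp_apply, LinearMap.comp_apply, sumAct_lof]
  by_cases hr : r = k
  · subst hr
    rw [DirectSum.component.lof_self, DirectSum.component.lof_self]
  · rw [DirectSum.component.of, DirectSum.component.of, dif_neg (by omega), dif_neg hr, map_zero]

theorem lie_lof (x : L) (r : ℤ) (m : M.X r) :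
    ⁅x, DirectSum.lof ℂ ℤ M.X r m⁆ = DirectSum.lof ℂ ℤ M.X r ⁅x, m⁆ :=
  ((DirectSum.lieModuleOf ℂ ℤ L M.X r).map_lie x m).symm

theorem lie_sumAct (x : L) (v : V) (t : DirectSum ℤ M.X) :
    ⁅x, M.sumAct v t⁆ = M.sumAct ⁅x, v⁆ t + M.sumAct v ⁅x, t⁆ := by
  refine LinearMap.congr_fun (M.sum_ext
    (f := LieModule.toEnd ℂ L (DirectSum ℤ M.X) x * M.sumAct v)
    (g := M.sumAct ⁅x, v⁆ + M.sumAct v * LieModule.toEnd ℂ L (DirectSum ℤ M.X) x) fun r m => ?_) t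
  simp only [Module.End.mul_apply, LinearMap.add_apply, LieModule.toEnd_apply_apply, sumAct_lof,
    lie_lof, M.lie_act, map_add]

/-- The universal property of the symmetric algebra needs a commutative target, and the operators of
`V` commute only among themselves; their generated subalgebra serves as the target. -/
theorem isMulCommutative_adjoin_sumAct :
    IsMulCommutative (Algebra.adjoin ℂ (Set.range M.sumAct)) :=
  Algebra.isMulCommutative_adjoin ℂ (by
    rintro _ ⟨v, rfl⟩ _ ⟨w, rfl⟩
    exact M.sumAct_comm v w)

open scoped IsMulCommutative in
/-- The action of the symmetric algebra on the direct sum of the components. -/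
def symAct : SymmetricAlgebra ℂ V →ₐ[ℂ] Module.End ℂ (DirectSum ℤ M.X) :=
  haveI := M.isMulCommutative_adjoin_sumAct
  (Algebra.adjoin ℂ (Set.range M.sumAct)).val.comp
    (SymmetricAlgebra.lift
      ({toFun := fun v => ⟨M.sumAct v, Algebra.subset_adjoin ⟨v, rfl⟩⟩
        map_add' := fun v w => Subtype.ext (M.sum_ext fun r m => by
          change M.sumAct (v + w) (DirectSum.lof ℂ ℤ M.X r m) =
            M.sumAct v (DirectSum.lof ℂ ℤ M.X r m) + M.sumAct w (DirectSum.lof ℂ ℤ M.X r m)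
          simp only [sumAct_lof, map_add, LinearMap.add_apply])
        map_smul' := fun c v => Subtype.ext (M.sum_ext fun r m => by
          change M.sumAct (c • v) (DirectSum.lof ℂ ℤ M.X r m) =
            c • M.sumAct v (DirectSum.lof ℂ ℤ M.X r m)
          simp only [sumAct_lof, map_smul, LinearMap.smul_apply]) } :
        V →ₗ[ℂ] Algebra.adjoin ℂ (Set.range M.sumAct)))

open scoped IsMulCommutative in
theorem symAct_ι (v : V) : M.symAct (SymmetricAlgebra.ι ℂ V v) = M.sumAct v := by
  have := M.isMulCommutative_adjoin_sumAct
  rw [symAct, AlgHom.comp_apply, SymmetricAlgebra.lift_ι_apply]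
  rfl

theorem lie_symAct (x : L) (a : SymmetricAlgebra ℂ V) (t : DirectSum ℤ M.X) :
    ⁅x, M.symAct a t⁆ = M.symAct ⁅x, a⁆ t + M.symAct a ⁅x, t⁆ := by
  induction a using SymmetricAlgebra.induction generalizing t with
  | algebraMap c =>
    have : ⁅x, algebraMap ℂ (SymmetricAlgebra ℂ V) c⁆ = 0 := (symDer x).map_algebraMap c
    simp [this]
  | ι v => rw [lie_ι, symAct_ι, symAct_ι, lie_sumAct]
  | mul a b ha hb =>
    have hab : ∀ c d t, M.symAct (c * d) t = M.symAct c (M.symAct d t) := fun c d t => by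
      rw [map_mul]; rfl
    rw [lie_mul_sym, hab, ha, hb, map_add, hab, map_add, LinearMap.add_apply, hab, mul_comm b, hab]
    abel
  | add a b ha hb => simp only [map_add, lie_add, LinearMap.add_apply, ha, hb]; abel

end GrMod

variable {F : Type v} [AddCommGroup F] [Module ℂ F] [LieRingModule L F] [LieModule ℂ L F]
  {r : ℤ} {M : GrMod L V}

theorem one_mem_symPart (r : ℤ) : (1 : SymmetricAlgebra ℂ V) ∈ symPart L V (r - r) := by
  rw [sub_self]
  exact (mem_symPart_natCast (n := 0)).2 (by simp)

variable (V) in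
/-- The generators of the induced module. -/
def inducedGen (r : ℤ) : F →ₗ⁅ℂ, L⁆ (inducedObj V F r : GrMod L V).X r where
  toLinearMap := TensorProduct.mk ℂ (symPart L V (r - r)) F ⟨1, one_mem_symPart r⟩
  map_lie' := fun {x m} => by
    have : ⁅x, (⟨1, one_mem_symPart r⟩ : symPart L V (r - r))⁆ = 0 :=
      Subtype.ext ((symDer x).map_one_eq_zero)
    change _ ⊗ₜ _ = ⁅x, (⟨1, one_mem_symPart r⟩ : symPart L V (r - r)) ⊗ₜ[ℂ] m⁆
    rw [TensorProduct.LieModule.lie_tmul_right, this, TensorProduct.zero_tmul, zero_add]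

/-- The morphism out of an induced module determined by a homomorphism of `L`-modules. -/
def inducedDesc (φ : F →ₗ⁅ℂ, L⁆ M.X r) : inducedObj V F r ⟶ M where
  f k :=
    { TensorProduct.lift (LinearMap.mk₂ ℂ
        (fun (a : symPart L V (k - r)) f => M.symAct a.1 (DirectSum.lof ℂ ℤ M.X r (φ f)) k)
        (fun _ _ _ => by simp) (fun _ _ _ => by simp [DirectSum.smul_apply])
        (fun _ _ _ => by simp) (fun _ _ _ => by simp [DirectSum.smul_apply])) with
      map_lie' := fun {x m} => by
        change TensorProduct.lift _ ⁅x, m⁆ = ⁅x, TensorProduct.lift _ m⁆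
        induction m using TensorProduct.induction_on with
        | zero => simp
        | add y z hy hz => simp only [lie_add, map_add, hy, hz]
        | tmul a f =>
          rw [TensorProduct.LieModule.lie_tmul_right, map_add]
          simp only [TensorProduct.lift.tmul, LinearMap.mk₂_apply]
          rw [← DirectSum.lie_module_bracket_apply, GrMod.lie_symAct, LieModuleHom.map_lie,
            GrMod.lie_lof]
          rfl }
  f_act k v m := by
    change TensorProduct.lift _ ((symMul L _ v).rTensor _ m) =
      M.act k v (TensorProduct.lift _ m)
    induction m using TensorProduct.induction_on with
    | zero => simp
    | add y z hy hz => simp only [map_add, hy, hz]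
    | tmul a f =>
      simp only [LinearMap.rTensor_tmul, TensorProduct.lift.tmul, LinearMap.mk₂_apply, symMul_coe,
        map_mul, Module.End.mul_apply, GrMod.symAct_ι, GrMod.sumAct_apply_succ]

theorem inducedDesc_gen (φ : F →ₗ⁅ℂ, L⁆ M.X r) (f : F) :
    (inducedDesc φ).f r (inducedGen V r f) = φ f := by
  change M.symAct 1 (DirectSum.lof ℂ ℤ M.X r (φ f)) r = φ f
  rw [map_one]
  exact DirectSum.component.lof_self ℂ r (φ f)

/-- The copy of `F` in degree `r` generates the induced module under `V`, so agreement spreads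
upwards one degree at a time. -/
theorem inducedObj_hom_ext {g h : inducedObj V F r ⟶ M}
    (e : ∀ f, g.f r (inducedGen V r f) = h.f r (inducedGen V r f)) : g = h := by
  obtain ⟨G, hG⟩ : ∃ G : ∀ k, symPart L V (k - r) ⊗[ℂ] F →ₗ[ℂ] M.X k, ∀ k m, G k m = g.f k m :=
    ⟨fun k => (g.f k : (inducedObj V F r).X k →ₗ[ℂ] M.X k), fun _ _ => rfl⟩
  obtain ⟨K, hK⟩ : ∃ G : ∀ k, symPart L V (k - r) ⊗[ℂ] F →ₗ[ℂ] M.X k, ∀ k m, G k m = h.f k m :=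
    ⟨fun k => (h.f k : (inducedObj V F r).X k →ₗ[ℂ] M.X k), fun _ _ => rfl⟩
  -- The symmetric degree `l` is separated from `k - r` so that induction over homogeneous elements
  -- applies.
  suffices ∀ (l : ℤ) (a : SymmetricAlgebra ℂ V) (ha : a ∈ symPart L V l) (k : ℤ) (hk : k - r = l)
      (f : F), G k ((⟨a, hk ▸ ha⟩ : symPart L V (k - r)) ⊗ₜ f) =
        K k ((⟨a, hk ▸ ha⟩ : symPart L V (k - r)) ⊗ₜ f) by
    ext k m
    refine (hG k m).symm.trans (Eq.trans ?_ (hK k m))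
    refine LinearMap.congr_fun (TensorProduct.ext' fun a f => ?_) m
    exact this _ a.1 a.2 k rfl f
  intro l a ha
  induction ha using symPart_induction with
  | hz l =>
    intro k hk f
    have : (⟨0, hk ▸ zero_mem _⟩ : symPart L V (k - r)) = 0 := rfl
    rw [this, TensorProduct.zero_tmul, map_zero, map_zero]
  | hc c hc =>
    intro k hk f
    obtain rfl : k = r := by omega
    have : ∀ hm, ((⟨algebraMap ℂ _ c, hm⟩ : symPart L V (k - k)) ⊗ₜ f) =
        c • ((⟨1, one_mem_symPart k⟩ : symPart L V (k - k)) ⊗ₜ[ℂ] f) :=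
      fun hm => by
        rw [TensorProduct.smul_tmul']
        congr 1
        exact Subtype.ext (Algebra.algebraMap_eq_smul_one c)
    rw [this, map_smul, map_smul, hG, hK]
    exact congrArg (c • ·) (e f)
  | ha l x y hx hy h1 h2 =>
    intro k hk f
    have : ∀ hm, (⟨x + y, hm⟩ : symPart L V (k - r)) = ⟨x, hk ▸ hx⟩ + ⟨y, hk ▸ hy⟩ := fun hm => rfl
    rw [this, TensorProduct.add_tmul, map_add, map_add, h1 k hk f, h2 k hk f]
  | hm n x v hx hh =>
    intro k hk f
    obtain ⟨k, rfl⟩ : ∃ q, k = q + 1 := ⟨k - 1, by omega⟩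
    have hk' : k - r = n := by omega
    have := hh k hk' f
    have h1 := g.f_act k v ((⟨x, hk' ▸ hx⟩ : symPart L V (k - r)) ⊗ₜ f)
    have h2 := h.f_act k v ((⟨x, hk' ▸ hx⟩ : symPart L V (k - r)) ⊗ₜ f)
    rw [← hG, this, hK, ← h2] at h1
    rw [hG, hK]
    exact h1

/-- Homomorphisms out of an induced module correspond to homomorphisms of `L`-modules. -/
theorem inducedObj_hom_eq_zero {g : inducedObj V F r ⟶ M}
    (h : (g.f r).comp (inducedGen V r) = (0 : F →ₗ⁅ℂ, L⁆ M.X r)) : g = 0 :=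
  inducedObj_hom_ext fun f => LieModuleHom.congr_fun h f

end Adjunction

/-! ## Extensions and projective resolutions -/

section Resolution

universe w' v' u'

variable {C : Type u'} [Category.{v'} C] [Abelian C]

/-- `⋯ → K 1 → K 0 → X → 0` is a projective resolution. -/
structure IsResolution (X : C) (K : ℕ → C) (d : ∀ j, K (j + 1) ⟶ K j) (ε : K 0 ⟶ X) : Prop where
  epi : Epi ε
  projective : ∀ j, Projective (K j)
  d_comp_ε : d 0 ≫ ε = 0
  exact_zero : (ShortComplex.mk _ _ d_comp_ε).Exact
  comp : ∀ j, d (j + 1) ≫ d j = 0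
  exact : ∀ j, (ShortComplex.mk _ _ (comp j)).Exact

namespace IsResolution

variable {X : C} {K : ℕ → C} {d : ∀ j, K (j + 1) ⟶ K j} {ε : K 0 ⟶ X}

/-- The syzygy of a resolution. -/
theorem exists_shift (h : IsResolution X K d ε) :
    ∃ (Z : C) (i : Z ⟶ K 0) (ε' : K 1 ⟶ Z) (w : i ≫ ε = 0), (ShortComplex.mk i ε w).ShortExact ∧
      ε' ≫ i = d 0 ∧ IsResolution Z (fun j => K (j + 1)) (fun j => d (j + 1)) ε' := by
  have := h.epi
  let ε' : K 1 ⟶ kernel ε := kernel.lift ε (d 0) h.d_comp_ε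
  have hε' : ε' ≫ kernel.ι ε = d 0 := kernel.lift_ι _ _ _
  have w : d 1 ≫ ε' = 0 := by
    rw [← cancel_mono (kernel.ι ε), Category.assoc, hε', h.comp, zero_comp]
  refine ⟨kernel ε, kernel.ι ε, ε', kernel.condition ε,
    { exact := ShortComplex.exact_kernel ε }, hε', ?_, fun j => h.projective _, w, ?_,
    fun j => h.comp _, fun j => h.exact _⟩
  · exact h.exact_zero.epi_kernelLift
  · let φ : ShortComplex.mk (d 1) ε' w ⟶ ShortComplex.mk (d 1) (d 0) (h.comp 0) :=
      { τ₁ := 𝟙 _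
        τ₂ := 𝟙 _
        τ₃ := kernel.ι ε
        comm₂₃ := by simp [hε'] }
    have : Epi φ.τ₁ := inferInstanceAs (Epi (𝟙 _))
    have : IsIso φ.τ₂ := inferInstanceAs (IsIso (𝟙 _))
    have : Mono φ.τ₃ := inferInstanceAs (Mono (kernel.ι ε))
    exact (ShortComplex.exact_iff_of_epi_of_isIso_of_mono φ).2 (h.exact 0)

/-- Dimension shifting: every class in degree `n + 1` comes from the syzygy in degree `n`, and in
degree zero a map out of the resolved object is determined on the cover. -/
theorem ext_eq_zero [HasExt.{w'} C] {n : ℕ} (h : IsResolution X K d ε) {Y : C} (hY : ∀ f : K n ⟶ Y, f = 0)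
    (e : Ext X Y n) : e = 0 := by
  induction n generalizing X K with
  | zero =>
    have := h.epi
    obtain ⟨f, rfl⟩ := Ext.homEquiv₀.symm.surjective e
    have hf : f = 0 := (cancel_epi ε).1 ((hY (ε ≫ f)).trans Limits.comp_zero.symm)
    rw [Ext.homEquiv₀_symm_apply, hf, Ext.mk₀_zero]
  | succ n ih =>
    obtain ⟨Z, i, ε', w, hS, -, hZ⟩ := h.exists_shift
    have := h.projective 0
    obtain ⟨x, rfl⟩ := Ext.contravariant_sequence_exact₃ hS Y e (Ext.eq_zero_of_projective _)
      (add_comm 1 n)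
    rw [ih hZ hY x, Ext.comp_zero]

theorem hasProjectiveDimensionLT {n : ℕ} (h : IsResolution X K d ε)
    (hK : ∀ j, n ≤ j → IsZero (K j)) : HasProjectiveDimensionLT X n := by
  have := HasExt.standard C
  exact HasProjectiveDimensionLT.mk fun i hi Y e =>
    h.ext_eq_zero (fun f => (hK i hi).eq_of_src f 0) e

/-- A nonzero cocycle is not a coboundary when no earlier term maps to `Y`. In the shift, the
connecting map from the syzygy is injective: its kernel comes from `Ext (K 0) Y`, which vanishes by
projectivity in positive degree and by `hY` in degree zero. -/
theorem exists_ext_ne_zero [HasExt.{w'} C] {n : ℕ} (h : IsResolution X K d ε) {Y : C} {f : K n ⟶ Y} (hf : f ≠ 0)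
    (hd : d n ≫ f = 0) (hY : ∀ j < n, ∀ f : K j ⟶ Y, f = 0) : ∃ e : Ext X Y n, e ≠ 0 := by
  induction n generalizing X K with
  | zero =>
    have := h.epi
    let g : X ⟶ Y := h.exact_zero.desc f hd
    refine ⟨Ext.homEquiv₀.symm g, fun h0 => hf ?_⟩
    have hg : g = 0 := Ext.homEquiv₀.symm.injective (h0.trans (by simp))
    have : ε ≫ g = f := h.exact_zero.g_desc f hd
    rw [← this, hg, Limits.comp_zero]
  | succ n ih =>
    obtain ⟨Z, i, ε', w, hS, hi, hZ⟩ := h.exists_shift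
    obtain ⟨e, he⟩ := ih hZ hf hd fun j hj => hY (j + 1) (by omega)
    refine ⟨hS.extClass.comp e (add_comm 1 n), fun h0 => he ?_⟩
    obtain ⟨x, rfl⟩ := Ext.contravariant_sequence_exact₁ hS Y e (add_comm 1 n) h0
    have := h.projective 0
    rcases n with - | n
    · obtain ⟨g, rfl⟩ := Ext.homEquiv₀.symm.surjective x
      rw [hY 0 (by omega) g]
      simp
    · rw [Ext.eq_zero_of_projective x, Ext.comp_zero]

end IsResolution

end Resolution

/-! ## Truncations -/

section Truncations

set_option linter.unusedSectionVars false

open LieModule LieAlgebra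

variable {L : Type u} [LieRing L] [LieAlgebra ℂ L] [FiniteDimensional ℂ L]
  [LieAlgebra.IsSemisimple ℂ L] {H : LieSubalgebra ℂ L} [H.IsCartanSubalgebra]
  {b : (LieAlgebra.IsKilling.rootSystem H).Base}
  {V : Type v} [AddCommGroup V] [Module ℂ V] [LieRingModule L V] [LieModule ℂ L V]

namespace GrMod

variable {M N Q : GrMod L V}

/-- Factor a morphism through the quotient by a graded submodule it kills. -/
def Sub.quotDesc (W : Sub M) (g : M ⟶ N) (h : ∀ r, ∀ m ∈ W.N r, g.f r m = 0) : W.quot ⟶ N where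
  f r := descHom (W.proj.f r) (W.proj_surjective r) (g.f r)
    fun m hm => h r m ((W.proj_eq_zero_iff r m).1 hm)
  f_act r v m := by
    obtain ⟨m, rfl⟩ := W.proj_surjective r m
    rw [← W.proj.f_act, descHom_apply, descHom_apply, g.f_act]

@[simp] theorem Sub.quotDesc_proj (W : Sub M) (g : M ⟶ N) (h : ∀ r, ∀ m ∈ W.N r, g.f r m = 0)
    (r : ℤ) (m : M.X r) : (W.quotDesc g h).f r (W.proj.f r m) = g.f r m :=
  descHom_apply _ _ _ (fun m hm => h r m ((W.proj_eq_zero_iff r m).1 hm)) m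

theorem Sub.quot_hom_ext (W : Sub M) {g h : W.quot ⟶ N} (e : W.proj ≫ g = W.proj ≫ h) : g = h := by
  ext r m
  obtain ⟨m, rfl⟩ := W.proj_surjective r m
  exact congrArg (fun k : M ⟶ N => k.f r m) e

/-- The preimage of a graded submodule. -/
def Sub.comap (W : Sub N) (g : M ⟶ N) : Sub M where
  N r := (W.N r).comap (g.f r)
  act_mem r v m hm := by
    change g.f (r + 1) (M.act r v m) ∈ W.N (r + 1)
    rw [g.f_act]
    exact W.act_mem r v _ hm

end GrMod

variable (Γ : Set (Lam b))

theorem genSub_mono {M N : GrMod L V} (g : M ⟶ N) (r : ℤ)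
    {m : M.X r} (hm : m ∈ (genSub Γ M).N r) :
    g.f r m ∈ (genSub Γ N).N r := fun W hW =>
  hm (W.comap g) fun s lam _ hl h => hW s lam _ hl (h.map (g.f s))

theorem mem_genSub {M : GrMod L V} {s : ℤ} {lam : DomWeight b} {m : M.X s} (hl : (lam, s) ∉ Γ)
    (hm : IsMaximalVector b lam.1 m) : m ∈ (genSub Γ M).N s := fun _ hW => hW s lam m hl hm

/-- The projection of a module to its truncation. -/
abbrev truncPr (M : GrMod L V) : M ⟶ truncObj Γ M := (genSub Γ M).proj

/-- Truncation is functorial. -/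
def truncMap {M N : GrMod L V} (g : M ⟶ N) : truncObj Γ M ⟶ truncObj Γ N :=
  (genSub Γ M).quotDesc (g ≫ truncPr Γ N) fun r _ hm =>
    ((genSub Γ N).proj_eq_zero_iff r _).2 (genSub_mono Γ g r hm)

@[simp] theorem truncMap_proj {M N : GrMod L V} (g : M ⟶ N) (r : ℤ) (m : M.X r) :
    (truncMap Γ g).f r ((truncPr Γ M).f r m) = (truncPr Γ N).f r (g.f r m) :=
  GrMod.Sub.quotDesc_proj ..

variable {Γ}

theorem inTrunc.eq_zero {N : GrMod L V} (hN : inTrunc b V Γ N) {s : ℤ} {lam : DomWeight b} {n : N.X s}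
    (hn : IsMaximalVector b lam.1 n) (hl : (lam, s) ∉ Γ) : n = 0 := by
  have := hN.1 s
  by_contra h0
  exact hl (hN.2.2 lam s (hasConstituent_of_isMaximalVector hn h0))

/-- The kernel of `g` is a graded submodule containing all bad maximal vectors, since their images
would be bad maximal vectors of `N`. Hence truncation is universal among maps into the truncated
category. -/
theorem inTrunc.genSub_le {M N : GrMod L V} (hN : inTrunc b V Γ N) (g : M ⟶ N) (r : ℤ)
    (m : M.X r) (hm : m ∈ (genSub Γ M).N r) : g.f r m = 0 :=
  LieModuleHom.mem_ker.1 (hm (GrMod.kerSub g) fun s _ _ hl h =>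
    LieModuleHom.mem_ker.2 (hN.eq_zero (h.map (g.f s)) hl))

/-- Factor a morphism to an object of the truncated category through the truncation. -/
def truncDesc {M N : GrMod L V} (hN : inTrunc b V Γ N) (g : M ⟶ N) : truncObj Γ M ⟶ N :=
  (genSub Γ M).quotDesc g (hN.genSub_le g)

@[simp] theorem truncDesc_proj {M N : GrMod L V} (hN : inTrunc b V Γ N) (g : M ⟶ N) (r : ℤ)
    (m : M.X r) : (truncDesc hN g).f r ((truncPr Γ M).f r m) = g.f r m :=
  GrMod.Sub.quotDesc_proj ..

variable (M : GrMod L V)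

/-- The truncation of a degreewise finite-dimensional module lies in the truncated category. -/
theorem inTrunc_truncObj (hΓ : Γ.Finite) (hM : ∀ r, FiniteDimensional ℂ (M.X r)) :
    inTrunc b V Γ (truncObj Γ M) := by
  have hfd : ∀ r, FiniteDimensional ℂ ((truncObj Γ M).X r) := fun r =>
    Module.Finite.of_surjective ((truncPr Γ M).f r : M.X r →ₗ[ℂ] (truncObj Γ M).X r)
      ((genSub Γ M).proj_surjective r)
  -- A maximal vector of the quotient lifts to a maximal vector; if its weight were outside `Γ`, the
  -- lift would already have been divided out. Finiteness of `Γ` then bounds the degrees.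
  have hc : ∀ (lam : DomWeight b) (r : ℤ), HasConstituent b lam ((truncObj Γ M).X r) →
      (lam, r) ∈ Γ := by
    intro lam r h
    obtain ⟨n, hn0, hn⟩ := h.exists_isMaximalVector
    obtain ⟨m, rfl, hm⟩ := hn.exists_lift ((truncPr Γ M).f r) ((genSub Γ M).proj_surjective r)
    by_contra hl
    exact hn0 (((genSub Γ M).proj_eq_zero_iff r m).2 (mem_genSub Γ hl hm))
  refine ⟨hfd, (hΓ.image Prod.snd).subset fun r hr => ?_, hc⟩
  have : Nontrivial ((truncObj Γ M).X r) := hr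
  obtain ⟨lam, hl⟩ := exists_hasConstituent b ((truncObj Γ M).X r)
  exact ⟨(lam, r), hc lam r hl, rfl⟩

variable {M}

/-- The truncated category is closed under quotients, so the cokernel formed among all graded
modules is available as a test object. -/
theorem TruncCat.surjective_of_epi {X Y : TruncCat b V Γ} (e : X ⟶ Y) [Epi e] (r : ℤ) :
    Function.Surjective (e.hom.f r) := by
  let Q : TruncCat b V Γ := ⟨(GrMod.rangeSub e.hom).quot,
    inTrunc.of_surjective _ (GrMod.rangeSub e.hom).proj_surjective Y.property⟩
  let q : Y ⟶ Q := ObjectProperty.homMk (GrMod.rangeSub e.hom).proj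
  have h : q = 0 := by
    rw [← cancel_epi e, comp_zero]
    apply ObjectProperty.hom_ext
    ext r m
    exact ((GrMod.rangeSub e.hom).proj_eq_zero_iff _ _).2 ((LieModuleHom.mem_range _ _).2 ⟨m, rfl⟩)
  intro y
  have h1 : q.hom.f r y = 0 := by rw [h]; rfl
  exact (LieModuleHom.mem_range _ _).1 (((GrMod.rangeSub e.hom).proj_eq_zero_iff r y).1 h1)

theorem TruncCat.epi_of_surjective {X Y : TruncCat b V Γ} (e : X ⟶ Y)
    (h : ∀ r, Function.Surjective (e.hom.f r)) : Epi e := ⟨fun g k hgk => by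
  apply ObjectProperty.hom_ext
  ext r y
  obtain ⟨x, rfl⟩ := h r y
  exact congrArg (fun l : X ⟶ _ => l.hom.f r x) hgk⟩

theorem TruncCat.mono_of_injective {X Y : TruncCat b V Γ} (e : X ⟶ Y)
    (h : ∀ r, Function.Injective (e.hom.f r)) : Mono e := ⟨fun g k hgk => by
  apply ObjectProperty.hom_ext
  ext r y
  exact h r (congrArg (fun l : _ ⟶ Y => l.hom.f r y) hgk)⟩

theorem TruncCat.exact_of_exact {X Y Z : TruncCat b V Γ} (f : X ⟶ Y) (g : Y ⟶ Z) (w : f ≫ g = 0)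
    (h : ∀ r y, g.hom.f r y = 0 → ∃ x, f.hom.f r x = y) : (ShortComplex.mk f g w).Exact := by
  rw [ShortComplex.exact_iff_kernel_ι_comp_cokernel_π_zero]
  apply ObjectProperty.hom_ext
  ext r k
  have h1 : g.hom.f r ((kernel.ι g).hom.f r k) = 0 :=
    congrArg (fun l : kernel g ⟶ Z => l.hom.f r k) (kernel.condition g)
  obtain ⟨x, hx⟩ := h r _ h1
  have h2 : (cokernel.π f).hom.f r (f.hom.f r x) = 0 :=
    congrArg (fun l : X ⟶ cokernel f => l.hom.f r x) (cokernel.condition f)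
  rw [hx] at h2
  exact h2

theorem TruncCat.isZero_of_subsingleton {X : TruncCat b V Γ} (h : ∀ r, Subsingleton (X.obj.X r)) :
    IsZero X := by
  rw [IsZero.iff_id_eq_zero]
  apply ObjectProperty.hom_ext
  ext r m
  exact (h r).elim _ _

variable {F : Type v} [AddCommGroup F] [Module ℂ F] [LieRingModule L F] [LieModule ℂ L F]

/-- Truncations of induced modules are projective. -/
theorem projective_truncObj (r : ℤ) (h : inTrunc b V Γ (truncObj Γ (inducedObj V F r))) :
    Projective (⟨truncObj Γ (inducedObj V F r), h⟩ : TruncCat b V Γ) where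
  factors {E X} f e he := by
    have := E.property.1 r
    obtain ⟨s, hs⟩ := exists_section (e.hom.f r) (TruncCat.surjective_of_epi e r)
    -- Only the generators have to be lifted, and an `L`-linear section in degree `r` exists by
    -- complete reducibility; induction and truncation extend the lift.
    let φ : F →ₗ⁅ℂ, L⁆ E.obj.X r :=
      s.comp ((f.hom.f r).comp (((truncPr Γ (inducedObj V F r)).f r).comp (inducedGen V r)))
    refine ⟨ObjectProperty.homMk (truncDesc E.property (inducedDesc φ)), ?_⟩
    apply ObjectProperty.hom_ext
    apply GrMod.Sub.quot_hom_ext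
    apply inducedObj_hom_ext
    intro x
    change e.hom.f r ((truncDesc E.property (inducedDesc φ)).f r ((truncPr Γ _).f r _)) = _
    rw [truncDesc_proj, inducedDesc_gen]
    exact hs _

end Truncations

/-! ## Weights of symmetric and exterior powers -/

section PowerWeights

set_option linter.unusedSectionVars false

open LieModule LieAlgebra

variable {L : Type u} [LieRing L] [LieAlgebra ℂ L] [FiniteDimensional ℂ L]
  [LieAlgebra.IsSemisimple ℂ L] {H : LieSubalgebra ℂ L} [H.IsCartanSubalgebra]
  {b : (LieAlgebra.IsKilling.rootSystem H).Base}
  {V : Type v} [AddCommGroup V] [Module ℂ V] [LieRingModule L V] [LieModule ℂ L V]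

variable (H V) in
/-- The sums of `k` weights of `V`. -/
def stepSet (k : ℤ) : Set (Module.Dual ℂ H) :=
  {ξ | ∃ r : Multiset (Module.Dual ℂ H), (∀ x ∈ r, x ∈ weights H V) ∧ (r.card : ℤ) = k ∧ r.sum = ξ}

theorem zero_mem_stepSet : (0 : Module.Dual ℂ H) ∈ stepSet H V 0 := ⟨0, by simp, by simp, by simp⟩

theorem add_mem_stepSet {k l : ℤ} {ξ η : Module.Dual ℂ H} (hξ : ξ ∈ stepSet H V k)
    (hη : η ∈ stepSet H V l) : ξ + η ∈ stepSet H V (k + l) := by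
  obtain ⟨r, h1, h2, h3⟩ := hξ
  obtain ⟨t, h4, h5, h6⟩ := hη
  exact ⟨r + t, fun x hx => (Multiset.mem_add.1 hx).elim (h1 x) (h4 x),
    by rw [Multiset.card_add]; push_cast; rw [h2, h5], by rw [Multiset.sum_add, h3, h6]⟩

theorem mem_stepSet_one {ξ : Module.Dual ℂ H} (hξ : ξ ∈ weights H V) : ξ ∈ stepSet H V 1 :=
  ⟨{ξ}, by simpa using hξ, by simp, by simp⟩

theorem mem_weights_of_mem_wtSub {ξ : Module.Dual ℂ H} {v : V} (h : v ∈ wtSub V ξ) (h0 : v ≠ 0) :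
    ξ ∈ weights H V := by
  rw [wtSub_eq_weightSpace] at h
  intro hb
  rw [hb] at h
  exact h0 (by simpa using h)

theorem mem_iSup_weights [FiniteDimensional ℂ V] (b : (LieAlgebra.IsKilling.rootSystem H).Base)
    (v : V) : v ∈ ⨆ ξ ∈ weights H V, wtSub V ξ := by
  have h : v ∈ ⨆ ξ : Module.Dual ℂ H, wtSub V ξ := by rw [iSup_wtSub_eq_top V b]; trivial
  refine (iSup_le fun ξ x hx => ?_ : ⨆ ξ : Module.Dual ℂ H, wtSub V ξ ≤ _) h
  by_cases h0 : x = 0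
  · rw [h0]; exact zero_mem _
  · exact mem_biSup_wtSub (mem_weights_of_mem_wtSub hx h0) hx

theorem iSup_wtSub_induction {M : Type*} [AddCommGroup M] [Module ℂ M] [LieRingModule L M]
    [LieModule ℂ L M] {A : Set (Module.Dual ℂ H)} {T : Submodule ℂ M}
    (h : ∀ ξ ∈ A, ∀ m ∈ wtSub M ξ, m ∈ T) {m : M} (hm : m ∈ ⨆ ξ ∈ A, wtSub M ξ) : m ∈ T :=
  (iSup₂_le h : ⨆ ξ ∈ A, wtSub M ξ ≤ T) hm

theorem symPart_le [FiniteDimensional ℂ V] (b : (LieAlgebra.IsKilling.rootSystem H).Base)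
    {k : ℤ} {a : SymmetricAlgebra ℂ V} (h : a ∈ symPart L V k) :
    a ∈ ⨆ ξ ∈ stepSet H V k, wtSub (SymmetricAlgebra ℂ V) ξ := by
  induction h using symPart_induction with
  | hz k => exact zero_mem _
  | hc c _ =>
    refine mem_biSup_wtSub zero_mem_stepSet fun h => ?_
    rw [LinearMap.zero_apply, zero_smul]
    exact (symDer (V := V) (h : L)).map_algebraMap c
  | ha k x y _ _ h1 h2 => exact add_mem h1 h2
  | hm n x v _ h =>
    refine iSup_wtSub_induction (T := (⨆ ξ ∈ stepSet H V (n + 1), wtSub (SymmetricAlgebra ℂ V) ξ).comap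
      (LinearMap.mulRight ℂ x ∘ₗ SymmetricAlgebra.ι ℂ V)) (fun η hη v hv => ?_) (mem_iSup_weights b v)
    refine iSup_wtSub_induction (T := (⨆ ξ ∈ stepSet H V (n + 1), wtSub (SymmetricAlgebra ℂ V) ξ).comap
      (LinearMap.mulLeft ℂ (SymmetricAlgebra.ι ℂ V v))) (fun ξ hξ x hx => ?_) h
    refine mem_biSup_wtSub (add_mem_stepSet hξ (mem_stepSet_one hη)) fun t => ?_
    change ⁅(t : L), SymmetricAlgebra.ι ℂ V v * x⁆ = _ • (SymmetricAlgebra.ι ℂ V v * x)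
    rw [lie_mul_sym, lie_ι, hv t, hx t, map_smul, mul_smul_comm, mul_smul_comm, mul_comm x,
      LinearMap.add_apply, add_smul]

theorem mem_stepSet_of_symPart [FiniteDimensional ℂ V]
    (b : (LieAlgebra.IsKilling.rootSystem H).Base) {k : ℤ} {a : symPart L V k} (h0 : a ≠ 0)
    {ξ : Module.Dual ℂ H} (h : a ∈ wtSub (symPart L V k) ξ) : ξ ∈ stepSet H V k :=
  weight_mem_of_mem_iSup (map_mem_wtSub (symPart L V k).incl h)
    (fun e => h0 (Subtype.ext e)) (symPart_le b a.2)

variable [FiniteDimensional ℂ V]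

theorem ιMulti_mem_wtSub {n : ℕ} {f : Fin n → V} {ζ : Fin n → Module.Dual ℂ H}
    (h : ∀ i, f i ∈ wtSub V (ζ i)) :
    ExteriorAlgebra.ιMulti ℂ n f ∈ wtSub (ExteriorAlgebra ℂ V) (∑ i, ζ i) := by
  induction n with
  | zero =>
    intro t
    rw [ExteriorAlgebra.ιMulti_zero_apply]
    simpa using ext_lie_algebraMap (V := V) (t : L) 1
  | succ n ih =>
    intro t
    have h1 := ih (f := Matrix.vecTail f) (ζ := Matrix.vecTail ζ) (fun i => h i.succ) t
    rw [ExteriorAlgebra.ιMulti_succ_apply, ext_lie_ι_mul, h 0 t, h1, Fin.sum_univ_succ,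
      LinearMap.add_apply, add_smul, map_smul, smul_mul_assoc, mul_smul_comm]
    rfl

variable {d : ℕ} {e : Module.Basis (Fin d) ℂ V} {ζ : Fin d → Module.Dual ℂ H}

theorem ιMulti_family_mem_wtSub (h : ∀ i, e i ∈ wtSub V (ζ i)) (n : ℕ)
    (s : Set.powersetCard (Fin d) n) :
    (exteriorPower.ιMulti_family ℂ n e s : ExteriorAlgebra ℂ V) ∈
      wtSub (ExteriorAlgebra ℂ V) (∑ i ∈ (s : Finset (Fin d)), ζ i) := by
  have := ιMulti_mem_wtSub (f := e ∘ Set.powersetCard.ofFinEmbEquiv.symm s)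
    (ζ := ζ ∘ Set.powersetCard.ofFinEmbEquiv.symm s) (fun i => h _)
  have hs : ∑ i ∈ (s : Finset (Fin d)), ζ i =
      ∑ i, (ζ ∘ Set.powersetCard.ofFinEmbEquiv.symm s) i := by
    rw [← Finset.sum_coe_sort]
    exact (Fintype.sum_equiv ((s : Finset (Fin d)).orderIsoOfFin s.2).toEquiv _ _
      fun i => rfl).symm
  rw [hs]
  exact this

theorem extPart_le (h : ∀ i, e i ∈ wtSub V (ζ i)) {n : ℕ} {ω : ExteriorAlgebra ℂ V}
    (hω : ω ∈ extPart L V n) :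
    ω ∈ ⨆ ξ ∈ {ξ | ∃ s : Finset (Fin d), s.card = n ∧ ∑ i ∈ s, ζ i = ξ},
      wtSub (ExteriorAlgebra ℂ V) ξ := by
  rw [mem_extPart, ← exteriorPower.ιMulti_family_span_fixedDegree_of_span ℂ e.span_eq] at hω
  refine Submodule.span_le.2 ?_ hω
  rintro _ ⟨s, rfl⟩
  exact mem_biSup_wtSub (A := {ξ | ∃ s : Finset (Fin d), s.card = n ∧ ∑ i ∈ s, ζ i = ξ})
    ⟨s.1, s.2, rfl⟩ (ιMulti_family_mem_wtSub h n s)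

/-- Wedge monomials use each basis vector at most once. That the indices form a set, and not merely
a multiset as for symmetric powers, is what bounds the length of the truncated resolutions. -/
theorem exists_finset_of_extPart (h : ∀ i, e i ∈ wtSub V (ζ i)) {n : ℕ} {ω : extPart L V n}
    (h0 : ω ≠ 0) {ξ : Module.Dual ℂ H} (hω : ω ∈ wtSub (extPart L V n) ξ) :
    ∃ s : Finset (Fin d), s.card = n ∧ ∑ i ∈ s, ζ i = ξ :=
  weight_mem_of_mem_iSup (map_mem_wtSub (extPart L V n).incl hω)
    (fun e => h0 (Subtype.ext e)) (extPart_le h ω.2)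

theorem mem_stepSet_of_extPart (b : (LieAlgebra.IsKilling.rootSystem H).Base) {n : ℕ}
    {ω : extPart L V n} (h0 : ω ≠ 0) {ξ : Module.Dual ℂ H} (hω : ω ∈ wtSub (extPart L V n) ξ) :
    ξ ∈ stepSet H V n := by
  obtain ⟨d, e, ζ, he, -, -⟩ := exists_weightBasis b V
  obtain ⟨s, hs, rfl⟩ := exists_finset_of_extPart he h0 hω
  refine ⟨s.val.map ζ, fun x hx => ?_, by simp [hs], rfl⟩
  obtain ⟨i, -, rfl⟩ := Multiset.mem_map.1 hx
  exact mem_weights_of_mem_wtSub (he i) (e.ne_zero i)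

theorem exists_extPart_mem_wtSub (h : ∀ i, e i ∈ wtSub V (ζ i)) (s : Finset (Fin d)) :
    ∃ ω : extPart L V s.card, ω ≠ 0 ∧ ω ∈ wtSub (extPart L V s.card) (∑ i ∈ s, ζ i) := by
  let s' : Set.powersetCard (Fin d) s.card := ⟨s, rfl⟩
  refine ⟨exteriorPower.ιMulti_family ℂ s.card e s', ?_, fun t => Subtype.ext ?_⟩
  · have := (e.exteriorPower s.card).ne_zero s'
    rw [exteriorPower.basis_apply] at this
    exact this
  · exact ιMulti_family_mem_wtSub h s.card s' t

end PowerWeights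

/-! ## Exactness of the Koszul complex -/

section KoszulExact

set_option linter.unusedSectionVars false

variable {L : Type u} [LieRing L] [LieAlgebra ℂ L]
  {V : Type v} [AddCommGroup V] [Module ℂ V] [LieRingModule L V] [LieModule ℂ L V]
  [FiniteDimensional ℂ V]
  (E : Type v) [AddCommGroup E] [Module ℂ E] [LieRingModule L E] [LieModule ℂ L E]

/-- Multiplications commute while contractions anticommute, so the double sum equals its own
negative. -/
theorem koszulLin_comp {k l q : ℤ} (h : l = k + 1) (h' : q = l + 1) (j : ℕ)
    (m : symPart L V k ⊗[ℂ] (extPart L V (j + 1 + 1) ⊗[ℂ] E)) :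
    koszulLin L V E h' j (koszulLin L V E h (j + 1) m) = 0 := by
  induction m using tensor_induction₃ with
  | h0 => simp
  | ha y z hy hz => simp only [map_add, hy, hz, add_zero]
  | ht a ω e =>
    simp only [koszulLin_tmul, map_sum]
    set S := ∑ i, ∑ i', symMul L h' (Module.finBasis ℂ V i')
      (symMul L h (Module.finBasis ℂ V i) a) ⊗ₜ[ℂ]
      (extCon L V j ((Module.finBasis ℂ V).coord i')
        (extCon L V (j + 1) ((Module.finBasis ℂ V).coord i) ω) ⊗ₜ[ℂ] e) with hS
    have h1 : S = -S := by
      conv_lhs => rw [hS, Finset.sum_comm]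
      rw [hS, ← Finset.sum_neg_distrib]
      refine Finset.sum_congr rfl fun i _ => ?_
      rw [← Finset.sum_neg_distrib]
      refine Finset.sum_congr rfl fun i' _ => ?_
      have h2 : symMul L h' (Module.finBasis ℂ V i) (symMul L h (Module.finBasis ℂ V i') a) =
          symMul L h' (Module.finBasis ℂ V i') (symMul L h (Module.finBasis ℂ V i) a) :=
        Subtype.ext (mul_left_comm _ _ _)
      have h3 : extCon L V j ((Module.finBasis ℂ V).coord i)
          (extCon L V (j + 1) ((Module.finBasis ℂ V).coord i') ω) =
          -extCon L V j ((Module.finBasis ℂ V).coord i')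
          (extCon L V (j + 1) ((Module.finBasis ℂ V).coord i) ω) :=
        Subtype.ext (CliffordAlgebra.contractLeft_comm (Q := (0 : QuadraticForm ℂ V)) _ _ _)
      rw [h2, h3, TensorProduct.neg_tmul, TensorProduct.tmul_neg]
    have h2 : (2 : ℂ) • S = 0 := by
      rw [two_smul]
      exact eq_neg_iff_add_eq_zero.1 h1
    exact (smul_eq_zero.1 h2).resolve_left two_ne_zero

variable (V)

theorem koszulD_comp (s : ℤ) (j : ℕ) : koszulD V E s (j + 1) ≫ koszulD V E s j =
    (0 : koszulObj L V E s (j + 1 + 1) ⟶ koszulObj L V E s j) := by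
  ext k m
  exact koszulLin_comp E (k := k - (s + (j + 1 + 1 : ℕ))) (l := k - (s + (j + 1 : ℕ)))
    (q := k - (s + j)) (by push_cast; ring) (by push_cast; ring) j m

/-- In module degree `k` the homotopy identity has eigenvalue `k - s`, which is invertible unless `k
= s`; in degree `s` the term itself is zero, its symmetric degree being `-(j + 1)`. -/
theorem koszulD_exact (s : ℤ) (j : ℕ) (k : ℤ) (m : (koszulObj L V E s (j + 1)).X k)
    (hm : (koszulD V E s j).f k m = 0) : ∃ m', (koszulD V E s (j + 1)).f k m' = m := by
  have h := koszulLin_koszulH V E (k := k - (s + (j + 1 : ℕ))) (l := k - (s + (j + 1 + 1 : ℕ)))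
    (q := k - (s + j)) (by push_cast; ring) (by push_cast; ring) j m
  change koszulLin L V E (k := k - (s + (j + 1 : ℕ))) (l := k - (s + j)) _ j m = 0 at hm
  rw [hm, map_zero, add_zero] at h
  by_cases hk : k = s
  · have h0 : ∀ a : symPart L V (k - (s + (j + 1 : ℕ))), a = 0 := fun a =>
      Subtype.ext (eq_zero_of_mem_symPart (by push_cast; omega) a.2)
    have : ∀ m : symPart L V (k - (s + (j + 1 : ℕ))) ⊗[ℂ] (extPart L V (j + 1) ⊗[ℂ] E), m = 0 := by
      intro m
      induction m using TensorProduct.induction_on with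
      | zero => rfl
      | add x y hx hy => rw [hx, hy, add_zero]
      | tmul a e => rw [h0 a, TensorProduct.zero_tmul]
    exact ⟨0, (map_zero _).trans (this m).symm⟩
  · have hc : ((k - s : ℤ) : ℂ) ≠ 0 := Int.cast_ne_zero.2 (sub_ne_zero.2 hk)
    have hc' : (((k - (s + (j + 1 : ℕ)) : ℤ) : ℂ) + (j + 1 : ℕ)) = ((k - s : ℤ) : ℂ) := by
      push_cast; ring
    rw [hc'] at h
    refine ⟨((k - s : ℤ) : ℂ)⁻¹ • koszulH L V E (k := k - (s + (j + 1 : ℕ)))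
      (l := k - (s + (j + 1 + 1 : ℕ))) (by push_cast; ring) (j + 1) m, ?_⟩
    refine (map_smul ((koszulD V E s (j + 1)).f k) _ _).trans ?_
    refine (congrArg (fun z => ((k - s : ℤ) : ℂ)⁻¹ • z) h).trans ?_
    exact inv_smul_smul₀ hc m

variable {V}

theorem mem_conc {k r : ℤ} (h : k = r) (e : E) : e ∈ (if k = r then ⊤ else ⊥ : LieSubmodule ℂ L E) := by
  rw [if_pos h]; trivial

theorem conc_subsingleton {k r : ℤ} (h : k ≠ r) : Subsingleton ((concObj V E r : GrMod L V).X k) := by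
  change Subsingleton (if k = r then ⊤ else ⊥ : LieSubmodule ℂ L E)
  rw [if_neg h]
  infer_instance

/-- An element of a module, as an element of the concentrated module. -/
def concMk {k r : ℤ} (h : k = r) : E →ₗ⁅ℂ, L⁆ (concObj V E r : GrMod L V).X k where
  toFun e := ⟨e, mem_conc E h e⟩
  map_add' _ _ := rfl
  map_smul' _ _ := rfl
  map_lie' := rfl

/-- `⋀⁰ V ⊗ E → E`. -/
def extZero : extPart L V 0 ⊗[ℂ] E →ₗ⁅ℂ, L⁆ E where
  toLinearMap := TensorProduct.lift (LinearMap.mk₂ ℂ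
    (fun (ω : extPart L V 0) (e : E) => ExteriorAlgebra.algebraMapInv (ω : ExteriorAlgebra ℂ V) • e)
    (fun _ _ _ => by simp [add_smul]) (fun _ _ _ => by simp [smul_smul])
    (fun _ _ _ => by simp) (fun c ω e => smul_comm _ c e))
  map_lie' := fun {x m} => by
    change TensorProduct.lift _ _ = ⁅x, TensorProduct.lift _ _⁆
    induction m using TensorProduct.induction_on with
    | zero => simp
    | add y z hy hz => simp only [lie_add, map_add, hy, hz]
    | tmul ω e =>
      have h : ⁅x, ω⁆ = 0 := by
        have hω : (ω : ExteriorAlgebra ℂ V) ∈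
          (LinearMap.range (ExteriorAlgebra.ι ℂ) : Submodule ℂ (ExteriorAlgebra ℂ V)) ^ 0 := ω.2
        rw [pow_zero] at hω
        obtain ⟨c, hc⟩ := Submodule.mem_one.1 hω
        refine Subtype.ext ?_
        change ⁅x, (ω : ExteriorAlgebra ℂ V)⁆ = 0
        rw [← hc, ext_lie_algebraMap]
      rw [TensorProduct.LieModule.lie_tmul_right, h, TensorProduct.zero_tmul, zero_add]
      simp

theorem extPart_zero_eq (ω : extPart L V 0) : ω = ExteriorAlgebra.algebraMapInv
    (ω : ExteriorAlgebra ℂ V) • (⟨1, by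
      change _ ∈ (LinearMap.range (ExteriorAlgebra.ι ℂ) : Submodule ℂ (ExteriorAlgebra ℂ V)) ^ 0
      simp⟩ : extPart L V 0) := by
  have hω : (ω : ExteriorAlgebra ℂ V) ∈
    (LinearMap.range (ExteriorAlgebra.ι ℂ) : Submodule ℂ (ExteriorAlgebra ℂ V)) ^ 0 := ω.2
  rw [pow_zero] at hω
  obtain ⟨c, hc⟩ := Submodule.mem_one.1 hω
  refine Subtype.ext ?_
  change (ω : ExteriorAlgebra ℂ V) = ExteriorAlgebra.algebraMapInv (ω : ExteriorAlgebra ℂ V) • 1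
  rw [← hc, ExteriorAlgebra.algebraMap_leftInverse V c, Algebra.algebraMap_eq_smul_one]

theorem extZero_tmul (ω : extPart L V 0) (e : E) : extZero E (ω ⊗ₜ[ℂ] e) =
    ExteriorAlgebra.algebraMapInv (ω : ExteriorAlgebra ℂ V) • e := rfl

theorem extZero_surjective : Function.Surjective (extZero (L := L) (V := V) E) := fun e =>
  ⟨(⟨1, by
      change _ ∈ (LinearMap.range (ExteriorAlgebra.ι ℂ) : Submodule ℂ (ExteriorAlgebra ℂ V)) ^ 0
      simp⟩ : extPart L V 0) ⊗ₜ e, by rw [extZero_tmul]; simp⟩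

theorem extZero_eq (m : extPart L V 0 ⊗[ℂ] E) : m = (⟨1, by
      change _ ∈ (LinearMap.range (ExteriorAlgebra.ι ℂ) : Submodule ℂ (ExteriorAlgebra ℂ V)) ^ 0
      simp⟩ : extPart L V 0) ⊗ₜ extZero E m := by
  induction m using TensorProduct.induction_on with
  | zero => simp
  | add x y hx hy => rw [map_add, TensorProduct.tmul_add, ← hx, ← hy]
  | tmul ω e =>
    rw [extZero_tmul, ← TensorProduct.smul_tmul, ← extPart_zero_eq]

variable (V)

/-- The augmentation of the Koszul complex. -/
def koszulAug (s : ℤ) : koszulObj L V E s 0 ⟶ concObj V E s :=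
  inducedDesc ((concMk E (by simp)).comp (extZero E))

theorem koszulAug_gen (s : ℤ) (m : extPart L V 0 ⊗[ℂ] E) :
    (koszulAug V E s).f (s + (0 : ℕ)) (inducedGen V (s + (0 : ℕ)) m) =
      concMk E (by simp) (extZero E m) :=
  inducedDesc_gen _ m

theorem koszulAug_surjective (s k : ℤ) : Function.Surjective ((koszulAug (L := L) V E s).f k) := by
  by_cases hk : k = s
  · obtain rfl : k = s + (0 : ℕ) := by simp [hk]
    rintro ⟨e, he⟩
    obtain ⟨m, rfl⟩ := extZero_surjective (L := L) (V := V) E e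
    exact ⟨inducedGen V _ m, koszulAug_gen V E s m⟩
  · have := conc_subsingleton (L := L) (V := V) E hk
    exact fun y => ⟨0, this.elim _ _⟩

/-- The source is generated in degree `s + 1`, where the target vanishes. -/
theorem koszulD_aug (s : ℤ) : koszulD V E s 0 ≫ koszulAug V E s =
    (0 : koszulObj L V E s (0 + 1) ⟶ concObj V E s) := by
  have := conc_subsingleton (L := L) (V := V) E (k := s + (0 + 1 : ℕ)) (r := s) (by simp)
  exact inducedObj_hom_eq_zero (LieModuleHom.ext fun m => this.elim _ _)

theorem symPart_zero_eq {k : ℤ} (hk : k = 0) (a : symPart L V k) :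
    ∃ c : ℂ, (a : SymmetricAlgebra ℂ V) = c • 1 := by
  subst hk
  have : (a : SymmetricAlgebra ℂ V) ∈ LinearMap.range (SymmetricAlgebra.ι ℂ V) ^ 0 :=
    mem_symPart_natCast.1 a.2
  rw [pow_zero] at this
  obtain ⟨c, hc⟩ := Submodule.mem_one.1 this
  exact ⟨c, by rw [← hc, Algebra.algebraMap_eq_smul_one]⟩

theorem exists_inducedGen {F : Type v} [AddCommGroup F] [Module ℂ F] [LieRingModule L F]
    [LieModule ℂ L F] (r : ℤ) (m : symPart L V (r - r) ⊗[ℂ] F) :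
    ∃ f : F, m = (⟨1, one_mem_symPart r⟩ : symPart L V (r - r)) ⊗ₜ[ℂ] f := by
  induction m using TensorProduct.induction_on with
  | zero => exact ⟨0, by simp⟩
  | add x y hx hy =>
    obtain ⟨f, rfl⟩ := hx
    obtain ⟨g, rfl⟩ := hy
    exact ⟨f + g, by rw [TensorProduct.tmul_add]⟩
  | tmul a f =>
    obtain ⟨c, hc⟩ := symPart_zero_eq V (sub_self r) a
    refine ⟨c • f, ?_⟩
    rw [← TensorProduct.smul_tmul]
    congr 1
    exact Subtype.ext hc

/-- Away from degree `s` the homotopy applies; in degree `s` the source is `Sym⁰ V ⊗ ⋀⁰ V ⊗ E` and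
the augmentation is injective. -/
theorem koszulAug_exact (s k : ℤ) (m : (koszulObj L V E s 0).X k)
    (hm : (koszulAug V E s).f k m = 0) : ∃ m', (koszulD V E s 0).f k m' = m := by
  by_cases hk : k = s
  · obtain rfl : k = s + (0 : ℕ) := by simp [hk]
    obtain ⟨f, hf⟩ := exists_inducedGen V (s + (0 : ℕ)) m
    have hf : m = inducedGen V _ f := hf
    rw [hf, koszulAug_gen] at hm
    have h0 : extZero E f = 0 := congrArg Subtype.val hm
    refine ⟨0, ?_⟩
    rw [map_zero, hf, extZero_eq E f, h0, TensorProduct.tmul_zero, map_zero]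
  · have h := koszulLin_koszulH_zero V E (k := k - (s + (0 : ℕ))) (l := k - (s + (0 + 1 : ℕ)))
      (by push_cast; ring) m
    have hc : ((k - (s + (0 : ℕ)) : ℤ) : ℂ) ≠ 0 := Int.cast_ne_zero.2 (by simpa using sub_ne_zero.2 hk)
    refine ⟨((k - (s + (0 : ℕ)) : ℤ) : ℂ)⁻¹ • koszulH L V E (k := k - (s + (0 : ℕ)))
      (l := k - (s + (0 + 1 : ℕ))) (by push_cast; ring) 0 m, ?_⟩
    refine (map_smul ((koszulD V E s 0).f k) _ _).trans ?_
    refine (congrArg (fun z => ((k - (s + (0 : ℕ)) : ℤ) : ℂ)⁻¹ • z) h).trans ?_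
    exact inv_smul_smul₀ hc m

end KoszulExact

/-! ## Truncations of Koszul complexes -/

section TruncKoszul

set_option linter.unusedSectionVars false

open LieModule LieAlgebra

variable {L : Type u} [LieRing L] [LieAlgebra ℂ L] [FiniteDimensional ℂ L]
  [LieAlgebra.IsSemisimple ℂ L] {H : LieSubalgebra ℂ L} [H.IsCartanSubalgebra]
  {b : (LieAlgebra.IsKilling.rootSystem H).Base}
  {V : Type v} [AddCommGroup V] [Module ℂ V] [LieRingModule L V] [LieModule ℂ L V]
  [FiniteDimensional ℂ V]

instance {lam : DomWeight b} (S : SimpleModel.{u, v} b lam) : FiniteDimensional ℂ S.carrier :=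
  S.isSimpleHW.1

/-- Every weight `(ν, k)` of a maximal vector of `M` is obtained from `p` by adding `k - p.2`
weights of `V`. -/
def IsStep (p : Lam b) (M : GrMod L V) : Prop :=
  ∀ (k : ℤ) (ν : Module.Dual ℂ H) (m : M.X k), m ≠ 0 → IsMaximalVector b ν m →
    ν - p.1.1 ∈ stepSet H V (k - p.2)

/-- A maximal vector of `Symˡ V ⊗ F` has a weight that differs from some highest weight of `F` by a
weight of `Symˡ V`, that is, by a sum of `l` weights of `V`. -/
theorem isStep_inducedObj {p : Lam b} {F : Type v} [AddCommGroup F] [Module ℂ F]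
    [LieRingModule L F] [LieModule ℂ L F] [FiniteDimensional ℂ F] (r : ℤ)
    (h : ∀ (ξ : Module.Dual ℂ H) (t : F), t ≠ 0 → IsMaximalVector b ξ t →
      ξ - p.1.1 ∈ stepSet H V (r - p.2)) : IsStep p (inducedObj V F r) := by
  intro k ν m h0 hm
  obtain ⟨ξ, t, ht0, ht, a, ha0, ha⟩ :=
    IsMaximalVector.exists_of_tensor (A := symPart L V (k - r)) (F := F) hm h0
  have := add_mem_stepSet (mem_stepSet_of_symPart b ha0 ha) (h ξ t ht0 ht)
  rwa [sub_add_sub_cancel, sub_add_sub_cancel] at this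

variable {p : Lam b}

theorem isStep_induced_simple (S : SimpleModel.{u, v} b p.1) :
    IsStep p (inducedObj V S.carrier p.2) :=
  isStep_inducedObj p.2 fun ξ t h0 ht => by
    rw [S.isSimpleHW.eq_of_isMaximalVector h0 ht, sub_self, sub_self]
    exact zero_mem_stepSet

theorem sub_mem_stepSet_of_extPart_tensor (S : SimpleModel.{u, v} b p.1) {j : ℕ}
    {ξ : Module.Dual ℂ H} {t : extPart L V j ⊗[ℂ] S.carrier} (h0 : t ≠ 0)
    (ht : IsMaximalVector b ξ t) : ξ - p.1.1 ∈ stepSet H V j := by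
  obtain ⟨η, x, hx0, hx, a, ha0, ha⟩ := ht.exists_of_tensor h0
  rw [S.isSimpleHW.eq_of_isMaximalVector hx0 hx] at ha
  exact mem_stepSet_of_extPart b ha0 ha

theorem isStep_koszulObj (S : SimpleModel.{u, v} b p.1) (j : ℕ) :
    IsStep p (koszulObj L V S.carrier p.2 j) :=
  isStep_inducedObj (p.2 + j) fun ξ t h0 ht => by
    rw [add_sub_cancel_left]
    exact sub_mem_stepSet_of_extPart_tensor S h0 ht

variable (Ψ : Finset (Module.Dual ℂ H)) in
/-- The conditions on `Γ`: it is finite, interval-closed, and lies above `p₀`. -/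
structure IsTruncSet (p₀ : Lam b) (Γ : Set (Lam b)) : Prop where
  finite : Γ.Finite
  closed : IsIntervalClosed Ψ Γ
  above : ∀ q ∈ Γ, preceq Ψ p₀ q

variable {Ψ : Finset (Module.Dual ℂ H)} {p₀ : Lam b} {Γ : Set (Lam b)}

theorem IsTruncSet.preceq_of_stepSet (hΓ : IsTruncSet Ψ p₀ Γ)
    (hsub : (Ψ : Set (Module.Dual ℂ H)) ⊆ weights H V) (hrigid : IsRigid Ψ (weights H V))
    {q : Lam b} (hp : p ∈ Γ) (hq : q ∈ Γ) (h : q.1.1 - p.1.1 ∈ stepSet H V (q.2 - p.2)) :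
    preceq Ψ p q := by
  obtain ⟨r, hr, hc, hs⟩ := h
  exact hrigid.preceq_of_multiset hsub (hΓ.above p hp) (hΓ.above q hq) hr hs hc

/-- The action of `V` on a graded submodule followed by a homomorphism of `L`-modules. -/
def actHom {M : GrMod L V} {k : ℤ} (N : LieSubmodule ℂ L (M.X k)) {Q : Type v} [AddCommGroup Q]
    [Module ℂ Q] [LieRingModule L Q] [LieModule ℂ L Q] (g : M.X (k + 1) →ₗ⁅ℂ, L⁆ Q) :
    V ⊗[ℂ] N →ₗ⁅ℂ, L⁆ Q where
  toLinearMap := TensorProduct.lift (LinearMap.mk₂ ℂ (fun v (n : N) => g (M.act k v n.1))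
    (fun _ _ _ => by simp) (fun _ _ _ => by simp) (fun _ _ _ => by simp) (fun _ _ _ => by simp))
  map_lie' := fun {x m} => by
    change TensorProduct.lift _ _ = ⁅x, TensorProduct.lift _ _⁆
    induction m using TensorProduct.induction_on with
    | zero => simp
    | add y z hy hz => simp only [lie_add, map_add, hy, hz]
    | tmul v n =>
      rw [TensorProduct.LieModule.lie_tmul_right, map_add]
      simp [← LieModuleHom.map_lie, M.lie_act]

theorem actHom_tmul {M : GrMod L V} {k : ℤ} (N : LieSubmodule ℂ L (M.X k)) {Q : Type v}
    [AddCommGroup Q] [Module ℂ Q] [LieRingModule L Q] [LieModule ℂ L Q]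
    (g : M.X (k + 1) →ₗ⁅ℂ, L⁆ Q) (v : V) (n : N) : actHom N g (v ⊗ₜ n) = g (M.act k v n.1) := rfl

/-- The part of degree `k` of the common kernel of all homomorphisms to simple modules
`V(λ)` with `(λ, k) ∈ Γ`. -/
def goodKer (Γ : Set (Lam b)) (M : GrMod L V) (k : ℤ) : LieSubmodule ℂ L (M.X k) where
  carrier := {m | ∀ lam : DomWeight b, (lam, k) ∈ Γ → ∀ (S : SimpleModel.{u, v} b lam)
    (g : M.X k →ₗ⁅ℂ, L⁆ S.carrier), g m = 0}
  add_mem' := fun h1 h2 lam hl S g => by rw [map_add, h1 lam hl S g, h2 lam hl S g, add_zero]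
  zero_mem' := fun lam hl S g => map_zero g
  smul_mem' := fun c m h lam hl S g => by rw [map_smul, h lam hl S g, smul_zero]
  lie_mem := fun {x m} h lam hl S g => by
    rw [LieModuleHom.map_lie, show g m = 0 from h lam hl S g, lie_zero]

theorem goodKer_eq_zero {M : GrMod L V} (k : ℤ) [FiniteDimensional ℂ (M.X k)] {lam : DomWeight b}
    (hl : (lam, k) ∈ Γ) {m : M.X k} (hm : IsMaximalVector b lam.1 m) (h : m ∈ goodKer Γ M k) :
    m = 0 := by
  by_contra h0
  obtain ⟨q, hq⟩ := exists_retraction (LieSubmodule.lieSpan ℂ L {m})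
  have h1 : q m = 0 := h lam hl (hm.model h0) q
  have h2 := hq ⟨m, LieSubmodule.subset_lieSpan rfl⟩
  exact h0 (congrArg Subtype.val (h2.symm.trans h1))

/-- This is where interval-closedness enters. If `V` carried the common kernel onto some `V(λ)` with
`(λ, k + 1) ∈ Γ`, lifting the highest weight vector to `V ⊗ goodKer` would produce a maximal vector
of weight `ξ` in the kernel with `λ - ξ` a weight of `V`. The path from `p` through `(ξ, k)` to `(λ,
k + 1)` has one weight of `V` per degree, so rigidity puts all of them in `Ψ`, and `(ξ, k)` lies in
an interval with ends in `Γ`. But the kernel has no nonzero maximal vector with weight in `Γ`. -/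
theorem goodKer_act_mem (hΓ : IsTruncSet Ψ p₀ Γ)
    (hsub : (Ψ : Set (Module.Dual ℂ H)) ⊆ weights H V) (hrigid : IsRigid Ψ (weights H V))
    (hp : p ∈ Γ) {M : GrMod L V} (hM : IsStep p M) (hfd : ∀ k, FiniteDimensional ℂ (M.X k))
    (k : ℤ) (v : V) (m : M.X k) (hm : m ∈ goodKer Γ M k) :
    M.act k v m ∈ goodKer Γ M (k + 1) := by
  intro lam hl S g
  by_contra hne
  have := hfd k
  have hθ : Function.Surjective (actHom (goodKer Γ M k) g) :=
    S.surjective_of_ne_zero _ fun h => hne (by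
      have h1 := actHom_tmul (goodKer Γ M k) g v ⟨m, hm⟩
      rw [h] at h1
      exact h1.symm)
  obtain ⟨w, hw0, hw⟩ := S.isSimpleHW.2.2
  obtain ⟨z, rfl, hz⟩ := hw.exists_lift _ hθ
  obtain ⟨ξ, t, ht0, ht, a, ha0, ha⟩ := hz.exists_of_tensor
    (fun h => hw0 (by rw [h, map_zero]))
  have hξ := ht.isDominant ht0
  have ht' : IsMaximalVector b ξ t.1 := ht.map (goodKer Γ M k).incl
  have ht0' : t.1 ≠ 0 := fun h => ht0 (Subtype.ext h)
  by_cases hg : ((⟨ξ, hξ⟩, k) : Lam b) ∈ Γ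
  · exact ht0' (goodKer_eq_zero k hg ht' t.2)
  · obtain ⟨r, hr, hc, hs⟩ := hM k ξ t.1 ht0' ht'
    have hw := mem_weights_of_mem_wtSub ha ha0
    have hΨ := hrigid.forall_mem hsub (hΓ.above _ hp) (hΓ.above _ hl) (r := (lam.1 - ξ) ::ₘ r)
      (by
        intro x hx
        rcases Multiset.mem_cons.1 hx with rfl | hx
        exacts [hw, hr x hx])
      (by rw [Multiset.sum_cons, hs, sub_add_sub_cancel])
      (by rw [Multiset.card_cons]; push_cast; rw [hc]; ring)
    refine hg (hΓ.closed p _ (lam, k + 1) hp hl ((hrigid.preceq_iff hsub).2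
      ⟨r, fun x hx => hΨ x (Multiset.mem_cons_of_mem hx), hs, hc⟩)
      ((hrigid.preceq_iff hsub).2 ⟨{lam.1 - ξ}, ?_, ?_, ?_⟩))
    · intro x hx
      rw [Multiset.mem_singleton.1 hx]
      exact hΨ _ (Multiset.mem_cons_self _ _)
    · simp
    · simp

/-- A maximal vector of weight in `Γ` that dies in the truncation is zero. -/
theorem eq_zero_of_mem_genSub (hΓ : IsTruncSet Ψ p₀ Γ)
    (hsub : (Ψ : Set (Module.Dual ℂ H)) ⊆ weights H V) (hrigid : IsRigid Ψ (weights H V))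
    (hp : p ∈ Γ) {M : GrMod L V} (hM : IsStep p M) (hfd : ∀ k, FiniteDimensional ℂ (M.X k))
    {k : ℤ} {lam : DomWeight b} (hl : (lam, k) ∈ Γ) {m : M.X k} (hm : IsMaximalVector b lam.1 m)
    (h : m ∈ (genSub Γ M).N k) : m = 0 := by
  have := hfd k
  -- The common kernel is a graded submodule that contains the bad maximal vectors, because maps to
  -- simple modules preserve highest weights; hence it contains everything they generate.
  refine goodKer_eq_zero k hl hm (h ⟨goodKer Γ M, goodKer_act_mem hΓ hsub hrigid hp hM hfd⟩ ?_)
  intro s η n hη hn lam' hl' S g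
  by_contra h0
  exact hη (by
    rwa [show η = lam' from Subtype.ext (S.isSimpleHW.eq_of_isMaximalVector h0 (hn.map g))])

/-- A criterion for exactness after truncation. -/
theorem exists_truncMap_eq {A B C : GrMod L V} (hfd : ∀ k, FiniteDimensional ℂ (B.X k))
    (f : A ⟶ B) (h : truncObj Γ B ⟶ C)
    (hex : ∀ (k : ℤ) (lam : DomWeight b) (m : B.X k), (lam, k) ∈ Γ → IsMaximalVector b lam.1 m →
      h.f k ((truncPr Γ B).f k m) = 0 → ∃ m', f.f k m' = m)
    (k : ℤ) (y : (truncObj Γ B).X k) (hy : h.f k y = 0) : ∃ x, (truncMap Γ f).f k x = y := by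
  have := hfd k
  have : FiniteDimensional ℂ ((truncObj Γ B).X k) :=
    Module.Finite.of_surjective ((truncPr Γ B).f k : B.X k →ₗ[ℂ] (truncObj Γ B).X k)
      ((genSub Γ B).proj_surjective k)
  -- It suffices to reach the maximal vectors of the kernel. Each lifts to a maximal vector of `B`;
  -- those with weight outside `Γ` are zero in the truncation, and the others are covered by `hex`.
  refine (LieModuleHom.mem_range _ _).1 (le_of_forall_isMaximalVector (b := b) (h.f k).ker
    ((truncMap Γ f).f k).range (fun lam n hn hmax => ?_) (LieModuleHom.mem_ker.2 hy))
  obtain ⟨m, rfl, hm⟩ := hmax.exists_lift ((truncPr Γ B).f k) ((genSub Γ B).proj_surjective k)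
  by_cases hl : (lam, k) ∈ Γ
  · obtain ⟨m', rfl⟩ := hex k lam m hl hm (LieModuleHom.mem_ker.1 hn)
    exact (LieModuleHom.mem_range _ _).2 ⟨(truncPr Γ A).f k m', truncMap_proj Γ f k m'⟩
  · have : (truncPr Γ B).f k m = 0 :=
      ((genSub Γ B).proj_eq_zero_iff k m).2 (mem_genSub Γ hl hm)
    rw [this]
    exact zero_mem _

/-- The inclusion of the components of a concentrated module. -/
def concVal (E : Type v) [AddCommGroup E] [Module ℂ E] [LieRingModule L E]
    [LieModule ℂ L E] (k r : ℤ) : (concObj V E r : GrMod L V).X k →ₗ⁅ℂ, L⁆ E :=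
  (if k = r then ⊤ else ⊥ : LieSubmodule ℂ L E).incl

theorem concVal_injective (E : Type v) [AddCommGroup E] [Module ℂ E] [LieRingModule L E]
    [LieModule ℂ L E] (k r : ℤ) : Function.Injective (concVal (V := V) (L := L) E k r) :=
  Subtype.val_injective

theorem inTrunc_simpleObj (hp : p ∈ Γ) (S : SimpleModel.{u, v} b p.1) :
    inTrunc b V Γ (simpleObj V S p.2) := by
  have hfd : ∀ r, FiniteDimensional ℂ ((simpleObj V S p.2).X r) := fun r =>
    inferInstanceAs (FiniteDimensional ℂ (if r = p.2 then ⊤ else ⊥ : LieSubmodule ℂ L S.carrier))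
  have key : ∀ r, Nontrivial ((simpleObj V S p.2).X r) → r = p.2 := fun r hr => by
    by_contra hne
    exact not_nontrivial_iff_subsingleton.2 (conc_subsingleton S.carrier hne) hr
  refine ⟨hfd, (Set.finite_singleton p.2).subset key, fun lam r hl => ?_⟩
  have := hfd r
  obtain rfl := key r hl.nontrivial
  obtain ⟨m, h0, hm⟩ := hl.exists_isMaximalVector
  have h1 := S.isSimpleHW.eq_of_isMaximalVector
    (fun h => h0 (concVal_injective _ _ _ (h.trans (map_zero _).symm)))
    (hm.map (concVal (V := V) (L := L) S.carrier p.2 p.2))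
  rw [show lam = p.1 from Subtype.ext h1]
  exact hp

theorem finiteDimensional_inducedObj (F : Type v) [AddCommGroup F] [Module ℂ F]
    [LieRingModule L F] [LieModule ℂ L F] [FiniteDimensional ℂ F] (r k : ℤ) :
    FiniteDimensional ℂ ((inducedObj V F r : GrMod L V).X k) :=
  inferInstanceAs (FiniteDimensional ℂ (symPart L V (k - r) ⊗[ℂ] F))

variable (V) in
/-- The truncated Koszul complex of a simple module. -/
def truncKoszul (hΓ : Γ.Finite) (S : SimpleModel.{u, v} b p.1) (j : ℕ) : TruncCat b V Γ :=
  ⟨truncObj Γ (koszulObj L V S.carrier p.2 j),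
    inTrunc_truncObj _ hΓ (finiteDimensional_inducedObj _ _)⟩

variable (V) in
/-- The differential of the truncated Koszul complex. -/
def truncKoszulD (hΓ : Γ.Finite) (S : SimpleModel.{u, v} b p.1) (j : ℕ) :
    truncKoszul V hΓ S (j + 1) ⟶ truncKoszul V hΓ S j :=
  ObjectProperty.homMk (truncMap Γ (koszulD V S.carrier p.2 j))

variable (V) in
/-- The augmentation of the truncated Koszul complex. -/
def truncKoszulAug (hΓ : Γ.Finite) (hp : p ∈ Γ) (S : SimpleModel.{u, v} b p.1) :
    truncKoszul V hΓ S 0 ⟶ ⟨simpleObj V S p.2, inTrunc_simpleObj hp S⟩ :=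
  ObjectProperty.homMk (truncDesc (inTrunc_simpleObj hp S) (koszulAug V S.carrier p.2))

/-- A maximal vector with weight in `Γ` whose differential dies after truncation has zero
differential before truncation, by `eq_zero_of_mem_genSub`; exactness of the Koszul complex then
applies. At the augmentation nothing is lost, since the simple object is already truncated. -/
theorem isResolution_truncKoszul (hΓ : IsTruncSet Ψ p₀ Γ)
    (hsub : (Ψ : Set (Module.Dual ℂ H)) ⊆ weights H V) (hrigid : IsRigid Ψ (weights H V))
    (hp : p ∈ Γ) (S : SimpleModel.{u, v} b p.1) :
    IsResolution _ (truncKoszul V hΓ.finite S) (truncKoszulD V hΓ.finite S)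
      (truncKoszulAug V hΓ.finite hp S) where
  epi := TruncCat.epi_of_surjective _ fun r y => by
    obtain ⟨x, rfl⟩ := koszulAug_surjective V S.carrier p.2 r y
    exact ⟨(truncPr Γ _).f r x, truncDesc_proj (inTrunc_simpleObj hp S) _ _ _⟩
  projective j := projective_truncObj _ _
  d_comp_ε := by
    apply ObjectProperty.hom_ext
    refine GrMod.Sub.quot_hom_ext _ ?_
    refine GrMod.hom_ext fun r m => ?_
    have h1 := congrArg (fun g : koszulObj L V S.carrier p.2 (0 + 1) ⟶ concObj V S.carrier p.2 =>
      g.f r m) (koszulD_aug V S.carrier p.2)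
    change (truncDesc (inTrunc_simpleObj hp S) (koszulAug V S.carrier p.2)).f r
      ((truncMap Γ (koszulD V S.carrier p.2 0)).f r ((truncPr Γ _).f r m)) = 0
    rw [truncMap_proj]
    exact (truncDesc_proj (inTrunc_simpleObj hp S) (koszulAug V S.carrier p.2) r _).trans h1
  exact_zero := by
    refine TruncCat.exact_of_exact _ _ _ (exists_truncMap_eq (finiteDimensional_inducedObj _ _) _ _
      fun k lam m hl hm h => ?_)
    exact koszulAug_exact V S.carrier p.2 k m 
      ((truncDesc_proj (inTrunc_simpleObj hp S) _ _ _).symm.trans h)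
  comp j := by
    apply ObjectProperty.hom_ext
    refine GrMod.Sub.quot_hom_ext _ ?_
    refine GrMod.hom_ext fun r m => ?_
    have h1 := congrArg (fun g : koszulObj L V S.carrier p.2 (j + 1 + 1) ⟶
      koszulObj L V S.carrier p.2 j => g.f r m) (koszulD_comp V S.carrier p.2 j)
    change (truncMap Γ (koszulD V S.carrier p.2 j)).f r
      ((truncMap Γ (koszulD V S.carrier p.2 (j + 1))).f r ((truncPr Γ _).f r m)) = 0
    rw [truncMap_proj, truncMap_proj]
    exact (congrArg ((truncPr Γ _).f r) h1).trans (map_zero _)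
  exact j := by
    refine TruncCat.exact_of_exact _ _ _ (exists_truncMap_eq (finiteDimensional_inducedObj _ _) _ _
      fun k lam m hl hm h => ?_)
    have h1 : (truncPr Γ _).f k ((koszulD V S.carrier p.2 j).f k m) = 0 :=
      (truncMap_proj Γ _ k m).symm.trans h
    exact koszulD_exact V S.carrier p.2 j k m (eq_zero_of_mem_genSub hΓ hsub hrigid hp
      (isStep_koszulObj S j) (finiteDimensional_inducedObj _ _) hl (hm.map _)
      (((genSub Γ _).proj_eq_zero_iff k _).1 h1))

end TruncKoszul

/-! ## Homomorphisms, extensions and projective dimensions -/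

section Bounds

set_option linter.unusedSectionVars false

open LieModule LieAlgebra

variable {L : Type u} [LieRing L] [LieAlgebra ℂ L] [FiniteDimensional ℂ L]
  [LieAlgebra.IsSemisimple ℂ L] {H : LieSubalgebra ℂ L} [H.IsCartanSubalgebra]
  {b : (LieAlgebra.IsKilling.rootSystem H).Base}
  {V : Type v} [AddCommGroup V] [Module ℂ V] [LieRingModule L V] [LieModule ℂ L V]
  [FiniteDimensional ℂ V]

theorem SimpleModel.exists_isMaximalVector_of_hom {lam : DomWeight b}
    (S : SimpleModel.{u, v} b lam) {N : Type v} [AddCommGroup N] [Module ℂ N] [LieRingModule L N]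
    [LieModule ℂ L N] {φ : S.carrier →ₗ⁅ℂ, L⁆ N} (hφ : φ ≠ 0) :
    ∃ n : N, n ≠ 0 ∧ IsMaximalVector b lam.1 n := by
  obtain ⟨v, hv0, hv⟩ := S.isSimpleHW.2.2
  refine ⟨φ v, fun h0 => hφ ?_, hv.map φ⟩
  have h1 : φ.ker = ⊤ := by
    rw [eq_top_iff, ← S.isSimpleHW.lieSpan_eq_top hv0, LieSubmodule.lieSpan_le]
    rintro x rfl
    exact LieModuleHom.mem_ker.2 h0
  ext x
  exact LieModuleHom.mem_ker.1 (h1 ▸ LieSubmodule.mem_top x : x ∈ φ.ker)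

/-! ### Morphisms out of concentrated modules -/

section Extend

variable {E : Type v} [AddCommGroup E] [Module ℂ E] [LieRingModule L E] [LieModule ℂ L E]
  {M : GrMod L V} {r : ℤ}

variable (M) in
/-- The identification of components of equal degrees. -/
def castHom {k : ℤ} (h : k = r) : M.X r →ₗ⁅ℂ, L⁆ M.X k := h ▸ LieModuleHom.id

/-- The morphism from a concentrated module determined by a homomorphism of `L`-modules into
a component of `M` followed by a zero component. -/
def concDesc (φ : E →ₗ⁅ℂ, L⁆ M.X r) (hM : Subsingleton (M.X (r + 1))) : concObj V E r ⟶ M where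
  f k := if h : k = r then (castHom M h).comp (φ.comp (concVal E k r)) else 0
  f_act k v m := by
    by_cases h : k = r
    · have : Subsingleton (M.X (k + 1)) := by rwa [h]
      exact this.elim _ _
    · have := (conc_subsingleton (L := L) (V := V) E h).elim m 0
      subst this
      rw [map_zero, map_zero, map_zero, map_zero]

theorem concDesc_f (φ : E →ₗ⁅ℂ, L⁆ M.X r) (hM : Subsingleton (M.X (r + 1)))
    (e : (concObj V E r : GrMod L V).X r) :
    (concDesc φ hM).f r e = φ (concVal E r r e) := by
  have : (concDesc φ hM).f r = (castHom M rfl).comp (φ.comp (concVal E r r)) := dif_pos rfl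
  rw [this]
  rfl

theorem concDesc_injective (φ : E →ₗ⁅ℂ, L⁆ M.X r) (hM : Subsingleton (M.X (r + 1)))
    (hφ : Function.Injective φ) (k : ℤ) : Function.Injective ((concDesc φ hM).f k) := by
  by_cases h : k = r
  · subst h
    intro x y hxy
    rw [concDesc_f, concDesc_f] at hxy
    exact concVal_injective _ _ _ (hφ hxy)
  · have := conc_subsingleton (L := L) (V := V) E h
    exact Function.injective_of_subsingleton _

end Extend

variable {Ψ : Finset (Module.Dual ℂ H)} {p₀ p p' : Lam b} {Γ : Set (Lam b)}

theorem inTrunc_truncProj (hΓ : Γ.Finite) (S : SimpleModel.{u, v} b p.1) :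
    inTrunc b V Γ (truncProj V Γ S p.2) :=
  inTrunc_truncObj _ hΓ (finiteDimensional_inducedObj _ _)

/-- The image of the generating highest weight vector is a maximal vector of the target. It lifts to
the untruncated induced module, where weights grow by one weight of `V` per degree. -/
theorem preceq_of_hom (hΓ : IsTruncSet Ψ p₀ Γ)
    (hsub : (Ψ : Set (Module.Dual ℂ H)) ⊆ weights H V) (hrigid : IsRigid Ψ (weights H V))
    (hp : p ∈ Γ) (hp' : p' ∈ Γ) (S : SimpleModel.{u, v} b p.1) (S' : SimpleModel.{u, v} b p'.1)
    (f : (⟨truncProj V Γ S p.2, inTrunc_truncProj hΓ.finite S⟩ : TruncCat b V Γ) ⟶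
      ⟨truncProj V Γ S' p'.2, inTrunc_truncProj hΓ.finite S'⟩) (hf : f ≠ 0) : preceq Ψ p' p := by
  let g : inducedObj V S.carrier p.2 ⟶ truncProj V Γ S' p'.2 := truncPr Γ _ ≫ f.hom
  have hg : (g.f p.2).comp (inducedGen V p.2) ≠ 0 := fun h => hf (by
    have h1 := inducedObj_hom_eq_zero h
    apply ObjectProperty.hom_ext
    refine GrMod.Sub.quot_hom_ext _ (h1.trans ?_)
    rfl)
  obtain ⟨n, hn0, hn⟩ := S.exists_isMaximalVector_of_hom hg
  have := finiteDimensional_inducedObj (L := L) (V := V) S'.carrier p'.2 p.2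
  obtain ⟨m, rfl, hm⟩ := hn.exists_lift ((truncPr Γ _).f p.2) ((genSub Γ _).proj_surjective p.2)
  exact hΓ.preceq_of_stepSet hsub hrigid hp' hp (isStep_induced_simple S' p.2 p.1.1 m
    (fun h => hn0 ((congrArg _ h).trans (map_zero _))) hm)

/-- A map is determined on the generators `⋀ʲ V ⊗ V(ν')`, all in one degree, and the simple target
is concentrated in one degree. -/
theorem exists_hom_of_truncKoszul_hom (hΓ : Γ.Finite) (hp : p ∈ Γ) (S : SimpleModel.{u, v} b p.1)
    (S' : SimpleModel.{u, v} b p'.1) (j : ℕ)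
    (f : truncKoszul V hΓ S' j ⟶ ⟨simpleObj V S p.2, inTrunc_simpleObj hp S⟩) (hf : f ≠ 0) :
    p'.2 + j = p.2 ∧ ∃ φ : extPart L V j ⊗[ℂ] S'.carrier →ₗ⁅ℂ, L⁆ S.carrier, φ ≠ 0 := by
  let g : koszulObj L V S'.carrier p'.2 j ⟶ simpleObj V S p.2 := truncPr Γ _ ≫ f.hom
  have hg : (g.f (p'.2 + j)).comp (inducedGen V (p'.2 + j)) ≠ 0 := fun h => hf (by
    have h1 := inducedObj_hom_eq_zero h
    apply ObjectProperty.hom_ext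
    refine GrMod.Sub.quot_hom_ext _ (h1.trans ?_)
    rfl)
  refine ⟨?_, (concVal S.carrier (p'.2 + j) p.2).comp
    ((g.f (p'.2 + j)).comp (inducedGen V (p'.2 + j))), fun h => hg ?_⟩
  · by_contra hne
    have := conc_subsingleton (L := L) (V := V) S.carrier hne
    exact hg (LieModuleHom.ext fun m => this.elim _ _)
  · ext m
    exact concVal_injective _ _ _
      (congrArg (fun φ : extPart L V j ⊗[ℂ] S'.carrier →ₗ⁅ℂ, L⁆ S.carrier => φ m) h)

/-- A nonzero class forces a nonzero map from the `j`-th resolution term, hence `V(ν)` occurs in `⋀ʲ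
V ⊗ V(ν')` and the degrees differ by `j`. Weights of `⋀ʲ V` are sums of `j` weights of `V`, so the
order relation follows, and with it the distance. -/
theorem preceq_of_ext (hΓ : IsTruncSet Ψ p₀ Γ)
    (hsub : (Ψ : Set (Module.Dual ℂ H)) ⊆ weights H V) (hrigid : IsRigid Ψ (weights H V))
    (hp : p ∈ Γ) (hp' : p' ∈ Γ) (S : SimpleModel.{u, v} b p.1) (S' : SimpleModel.{u, v} b p'.1)
    {j : ℕ} (e : Ext.{max u (v + 1)} (⟨simpleObj V S' p'.2, inTrunc_simpleObj hp' S'⟩ :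
      TruncCat b V Γ) ⟨simpleObj V S p.2, inTrunc_simpleObj hp S⟩ j) (he : e ≠ 0) :
    preceq Ψ p' p ∧ j = psiDist Ψ p'.1.1 p.1.1 := by
  obtain ⟨f, hf⟩ : ∃ f : truncKoszul V hΓ.finite S' j ⟶
      ⟨simpleObj V S p.2, inTrunc_simpleObj hp S⟩, f ≠ 0 := by
    by_contra! hc
    exact he ((isResolution_truncKoszul hΓ hsub hrigid hp' S').ext_eq_zero hc e)
  obtain ⟨hj, φ, hφ⟩ := exists_hom_of_truncKoszul_hom hΓ.finite hp S S' j f hf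
  obtain ⟨w, hw0, hw⟩ := S.isSimpleHW.2.2
  obtain ⟨t, rfl, ht⟩ := hw.exists_lift φ (S.surjective_of_ne_zero φ hφ)
  have h1 := sub_mem_stepSet_of_extPart_tensor S' (fun h => hw0 (by rw [h, map_zero])) ht
  have h2 : preceq Ψ p' p := hΓ.preceq_of_stepSet hsub hrigid hp' hp (by
    rwa [show p.2 - p'.2 = (j : ℤ) by omega])
  have h3 := h2.2
  exact ⟨h2, by omega⟩

theorem mem_weights_basis {d : ℕ} {e : Module.Basis (Fin d) ℂ V} {ζ : Fin d → Module.Dual ℂ H}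
    (he : ∀ i, e i ∈ wtSub V (ζ i)) (i : Fin d) : ζ i ∈ weights H V :=
  mem_weights_of_mem_wtSub (he i) (e.ne_zero i)

variable (Ψ V) in
/-- The sum of the dimensions of the weight spaces with weights in `Ψ`. -/
def psiDim : ℕ := ∑ ξ ∈ Ψ, Module.finrank ℂ (weightSpace V (ξ : H → ℂ))

open scoped Classical in
theorem card_filter_mem {d : ℕ} {ζ : Fin d → Module.Dual ℂ H}
    (hζ : ∀ ξ, {i | ζ i = ξ}.ncard = Module.finrank ℂ (wtSub V ξ)) :
    (Finset.univ.filter fun i => ζ i ∈ Ψ).card = psiDim V Ψ := by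
  rw [Finset.card_eq_sum_card_fiberwise (f := ζ) (t := Ψ)
    (s := Finset.univ.filter fun i => ζ i ∈ Ψ)
    (fun i hi => (Finset.mem_filter.1 (Finset.mem_coe.1 hi)).2)]
  refine Finset.sum_congr rfl fun ξ hξ => ?_
  have h1 := hζ ξ
  rw [wtSub_eq_weightSpace] at h1
  refine Eq.trans ?_ h1
  rw [Set.ncard_eq_toFinset_card', Set.toFinset_ofPred, Finset.filter_filter]
  congr 1
  ext i
  simp only [Finset.mem_filter, Finset.mem_univ, true_and]
  exact ⟨fun h => h.2, fun h => ⟨h ▸ hξ, h⟩⟩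

/-- A surviving constituent is reached from `p` by a set of `j` weight basis vectors of `V` followed
by further weights from the symmetric factor. Rigidity places all these weights in `Ψ`, but only
`psiDim V Ψ` basis vectors have such weights. -/
theorem isZero_truncKoszul (hΓ : IsTruncSet Ψ p₀ Γ)
    (hsub : (Ψ : Set (Module.Dual ℂ H)) ⊆ weights H V) (hrigid : IsRigid Ψ (weights H V))
    (hp : p ∈ Γ) (S : SimpleModel.{u, v} b p.1) {j : ℕ} (hj : psiDim V Ψ < j) :
    IsZero (truncKoszul V hΓ.finite S j) := by
  classical
  refine TruncCat.isZero_of_subsingleton fun k => not_nontrivial_iff_subsingleton.1 fun hn => ?_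
  have h := (truncKoszul V hΓ.finite S j).property
  have := h.1 k
  obtain ⟨ν, hν⟩ := exists_hasConstituent b ((truncKoszul V hΓ.finite S j).obj.X k)
  have hl := h.2.2 ν k hν
  obtain ⟨n, hn0, hn⟩ := hν.exists_isMaximalVector
  have := finiteDimensional_inducedObj (L := L) (V := V) (extPart L V j ⊗[ℂ] S.carrier) (p.2 + j) k
  obtain ⟨m, rfl, hm⟩ := hn.exists_lift ((truncPr Γ _).f k) ((genSub Γ _).proj_surjective k)
  have hm0 : m ≠ 0 := fun h => hn0 ((congrArg _ h).trans (map_zero _))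
  obtain ⟨ξ, t, ht0, ht, a, ha0, ha⟩ := IsMaximalVector.exists_of_tensor
    (A := symPart L V (k - (p.2 + j))) (F := extPart L V j ⊗[ℂ] S.carrier) hm hm0
  obtain ⟨η, x, hx0, hx, ω, hω0, hω⟩ := ht.exists_of_tensor ht0
  rw [S.isSimpleHW.eq_of_isMaximalVector hx0 hx] at hω
  obtain ⟨d, e, ζ, he, -, hζ⟩ := exists_weightBasis b V
  obtain ⟨s, hs, hsum⟩ := exists_finset_of_extPart he hω0 hω
  obtain ⟨r, hr, hc, hrs⟩ := mem_stepSet_of_symPart b ha0 ha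
  have hΨ := hrigid.forall_mem hsub (hΓ.above _ hp) (hΓ.above _ hl) (r := r + s.val.map ζ)
    (by
      intro x hx
      rcases Multiset.mem_add.1 hx with hx | hx
      · exact hr x hx
      · obtain ⟨i, -, rfl⟩ := Multiset.mem_map.1 hx
        exact mem_weights_basis he i)
    (by
      rw [Multiset.sum_add, hrs, show (s.val.map ζ).sum = _ from hsum, sub_add_sub_cancel])
    (by
      rw [Multiset.card_add, Multiset.card_map, Finset.card_val, hs]
      push_cast
      rw [hc]
      ring)
  have hss : s ⊆ Finset.univ.filter fun i => ζ i ∈ Ψ := fun i hi => by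
    rw [Finset.mem_filter]
    exact ⟨Finset.mem_univ _, hΨ _ (Multiset.mem_add.2 (Or.inr (Multiset.mem_map_of_mem ζ hi)))⟩
  have := Finset.card_le_card hss
  rw [hs, card_filter_mem hζ] at this
  omega

theorem hasProjectiveDimensionLT_simpleObj (hΓ : IsTruncSet Ψ p₀ Γ)
    (hsub : (Ψ : Set (Module.Dual ℂ H)) ⊆ weights H V) (hrigid : IsRigid Ψ (weights H V))
    (hp : p ∈ Γ) (S : SimpleModel.{u, v} b p.1) :
    HasProjectiveDimensionLT (⟨simpleObj V S p.2, inTrunc_simpleObj hp S⟩ : TruncCat b V Γ)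
      (psiDim V Ψ + 1) :=
  (isResolution_truncKoszul hΓ hsub hrigid hp S).hasProjectiveDimensionLT fun _ hj =>
    isZero_truncKoszul hΓ hsub hrigid hp S hj

/-- If all simple objects have projective dimension less than `n`, so has every object. -/
theorem hasProjectiveDimensionLT_of_simple {n : ℕ}
    (h : ∀ (p : Lam b) (hp : p ∈ Γ) (S : SimpleModel.{u, v} b p.1), HasProjectiveDimensionLT
      (⟨simpleObj V S p.2, inTrunc_simpleObj hp S⟩ : TruncCat b V Γ) n)
    (X : TruncCat b V Γ) : HasProjectiveDimensionLT X n := by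
  suffices H : ∀ (N : ℕ) (X : TruncCat b V Γ) (T : Finset ℤ),
      (∀ k, Nontrivial (X.obj.X k) → k ∈ T) → ∑ k ∈ T, Module.finrank ℂ (X.obj.X k) ≤ N →
      HasProjectiveDimensionLT X n from
    H _ X X.property.2.1.toFinset (fun k hk => X.property.2.1.mem_toFinset.2 hk) le_rfl
  intro N
  induction N with
  | zero =>
    intro X T hT hN
    have : IsZero X := TruncCat.isZero_of_subsingleton fun k =>
      not_nontrivial_iff_subsingleton.1 fun hk => by
        have := X.property.1 k
        have h1 := Module.finrank_pos (R := ℂ) (M := X.obj.X k)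
        have h2 := Finset.single_le_sum (f := fun k => Module.finrank ℂ (X.obj.X k))
          (fun _ _ => Nat.zero_le _) (hT k hk)
        omega
    have := this.hasProjectiveDimensionLT_zero
    exact hasProjectiveDimensionLT_of_ge X 0 n (Nat.zero_le _)
  | succ N ih =>
    intro X T hT hN
    have hfin := X.property.2.1
    by_cases hne : hfin.toFinset.Nonempty
    -- In the top nonzero degree `V` acts by zero, so a simple `L`-submodule there is a simple
    -- graded subobject; the quotient by it has smaller total dimension.
    · obtain ⟨r, hr, hmax⟩ := hfin.toFinset.exists_max_image id hne
      have hr : Nontrivial (X.obj.X r) := hfin.mem_toFinset.1 hr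
      have hr1 : Subsingleton (X.obj.X (r + 1)) := not_nontrivial_iff_subsingleton.1 fun hk => by
        have : r + 1 ≤ r := hmax (r + 1) (hfin.mem_toFinset.2 hk)
        omega
      have := X.property.1 r
      obtain ⟨lam, m, hm0, hm⟩ := exists_isMaximalVector b (X.obj.X r)
      let p : Lam b := (⟨lam, hm.isDominant hm0⟩, r)
      have hp : p ∈ Γ := X.property.2.2 _ _
        (hasConstituent_of_isMaximalVector (lam := ⟨lam, hm.isDominant hm0⟩) hm hm0)
      let S : SimpleModel.{u, v} b p.1 := hm.model hm0
      let i₀ : simpleObj V S p.2 ⟶ X.obj := concDesc (LieSubmodule.incl _) hr1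
      have hi₀ : ∀ k, Function.Injective (i₀.f k) :=
        concDesc_injective _ hr1 Subtype.val_injective
      let W := GrMod.rangeSub i₀
      let Q : TruncCat b V Γ := ⟨W.quot, X.property.of_surjective _ W.proj_surjective⟩
      let i : (⟨simpleObj V S p.2, inTrunc_simpleObj hp S⟩ : TruncCat b V Γ) ⟶ X :=
        ObjectProperty.homMk i₀
      let q : X ⟶ Q := ObjectProperty.homMk W.proj
      have w : i ≫ q = 0 := by
        apply ObjectProperty.hom_ext
        refine GrMod.hom_ext fun k x => ?_
        exact (W.proj_eq_zero_iff k _).2 ((LieModuleHom.mem_range _ _).2 ⟨x, rfl⟩)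
      have := TruncCat.mono_of_injective i hi₀
      have := TruncCat.epi_of_surjective q W.proj_surjective
      have hse : (ShortComplex.mk i q w).ShortExact :=
        { exact := TruncCat.exact_of_exact _ _ _ fun k y hy =>
            (LieModuleHom.mem_range _ _).1 ((W.proj_eq_zero_iff k y).1 hy) }
      refine hse.hasProjectiveDimensionLT_X₂ n (h p hp S) (ih Q T (fun k hk => hT k ?_) ?_)
      · exact (W.proj_surjective k).nontrivial
      · have hle : ∀ k, Module.finrank ℂ (Q.obj.X k) ≤ Module.finrank ℂ (X.obj.X k) := fun k =>
          have := X.property.1 k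
          Submodule.finrank_quotient_le (W.N k).toSubmodule
        have hlt : Module.finrank ℂ (Q.obj.X r) < Module.finrank ℂ (X.obj.X r) := by
          have h1 := Submodule.finrank_quotient_add_finrank (W.N r).toSubmodule
          have h2 : 0 < Module.finrank ℂ (W.N r).toSubmodule := by
            have : Nontrivial (W.N r).toSubmodule := by
              refine ⟨⟨m, (LieModuleHom.mem_range _ _).2
                ⟨concMk _ rfl ⟨m, LieSubmodule.subset_lieSpan rfl⟩, ?_⟩⟩, 0, fun h0 => hm0
                (congrArg Subtype.val h0)⟩
              exact concDesc_f _ hr1 _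
            exact Module.finrank_pos
          have h3 : Module.finrank ℂ (Q.obj.X r) =
            Module.finrank ℂ (X.obj.X r ⧸ (W.N r).toSubmodule) := rfl
          omega
        have := Finset.sum_lt_sum (fun k _ => hle k) ⟨r, hT r hr, hlt⟩
        omega
    · have : IsZero X := TruncCat.isZero_of_subsingleton fun k =>
        not_nontrivial_iff_subsingleton.1 fun hk => hne ⟨k, hfin.mem_toFinset.2 hk⟩
      have := this.hasProjectiveDimensionLT_zero
      exact hasProjectiveDimensionLT_of_ge X 0 n (Nat.zero_le _)

theorem globalDim_le (hΓ : IsTruncSet Ψ p₀ Γ)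
    (hsub : (Ψ : Set (Module.Dual ℂ H)) ⊆ weights H V) (hrigid : IsRigid Ψ (weights H V)) :
    globalDim (TruncCat b V Γ) ≤ ((psiDim V Ψ : ℕ) : WithBot ℕ∞) :=
  iSup_le fun X => (projectiveDimension_le_iff X _).2 (hasProjectiveDimensionLT_of_simple
    (fun _ hp S => hasProjectiveDimensionLT_simpleObj hΓ hsub hrigid hp S) X)

end Bounds

/-! ## Maximal vectors in tensor products -/

section TensorMax

set_option linter.unusedSectionVars false

open LieModule LieAlgebra

variable {L : Type u} [LieRing L] [LieAlgebra ℂ L] [FiniteDimensional ℂ L]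
  [LieAlgebra.IsSemisimple ℂ L] {H : LieSubalgebra ℂ L} [H.IsCartanSubalgebra]
  {b : (LieAlgebra.IsKilling.rootSystem H).Base}

/-! ### Wedges of initial segments of a weight basis -/

section Flag

variable {A : Type v} [AddCommGroup A] [Module ℂ A] [LieRingModule L A] [LieModule ℂ L A]
  {d : ℕ} {a : Module.Basis (Fin d) ℂ A} {η : Fin d → Module.Dual ℂ H}

/-- The coordinates of a weight vector are zero except for those of the same weight. -/
theorem coord_eq_zero_of_ne (ha : ∀ i, a i ∈ wtSub A (η i)) {ξ : Module.Dual ℂ H} {m : A}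
    (hm : m ∈ wtSub A ξ) {i : Fin d} (hi : η i ≠ ξ) : a.coord i m = 0 := by
  by_contra h0
  refine hi (LinearMap.ext fun h => ?_)
  have h1 : a.coord i ⁅(h : L), m⁆ = η i h * a.coord i m := by
    conv_lhs => rw [← a.sum_repr m]
    rw [lie_sum, map_sum, Finset.sum_eq_single i]
    · rw [lie_smul, ha i h, map_smul, map_smul]
      simp [mul_comm]
    · intro j _ hj
      rw [lie_smul, ha j h, map_smul, map_smul]
      simp [hj]
    · simp
  rw [hm h, map_smul, smul_eq_mul] at h1
  exact (mul_right_cancel₀ h0 h1).symm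

variable [FiniteDimensional ℂ A]

variable (b a) in
/-- A wedge product of the first `k` vectors of a basis, characterised by its properties. -/
structure IsFlagVector (k : ℕ) (τ : Module.Dual ℂ H) (ω : ExteriorAlgebra ℂ A) : Prop where
  mem : ω ∈ extPart L A k
  ne_zero : ω ≠ 0
  isMaximal : IsMaximalVector b τ ω
  mul (j : Fin d) : j.1 < k → ExteriorAlgebra.ι ℂ (a j) * ω = 0
  con (j : Fin d) : k ≤ j.1 → extContract A (a.coord j) ω = 0

theorem IsFlagVector.zero : IsFlagVector b a 0 0 1 where
  mem := by
    change _ ∈ (LinearMap.range (ExteriorAlgebra.ι ℂ) : Submodule ℂ (ExteriorAlgebra ℂ A)) ^ 0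
    simp
  ne_zero := one_ne_zero
  isMaximal := by
    have h (x : L) : ⁅x, (1 : ExteriorAlgebra ℂ A)⁆ = 0 := by
      rw [← map_one (algebraMap ℂ _), ext_lie_algebraMap]
    exact ⟨fun _ _ x _ => h x, fun x => by rw [h]; simp⟩
  mul j h := by omega
  con j _ := by rw [← map_one (algebraMap ℂ _), extContract_algebraMap]

/-- A positive root vector raises the weight of `a i`. As the basis descends in height, the result
is a combination of earlier basis vectors, whose wedge with `ω` vanishes. Contraction with the
coordinate of `a i` recovers `ω`, so the new wedge is nonzero. -/
theorem IsFlagVector.succ (ha : ∀ i, a i ∈ wtSub A (η i))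
    (hη : Antitone fun i => (height b (η i)).re) {i : Fin d} {τ : Module.Dual ℂ H}
    {ω : ExteriorAlgebra ℂ A} (h : IsFlagVector b a i.1 τ ω) :
    IsFlagVector b a (i.1 + 1) (η i + τ) (ExteriorAlgebra.ι ℂ (a i) * ω) where
  mem := ι_mul_mem_extPart (L := L) (a i) h.mem
  ne_zero h0 := h.ne_zero <| by
    have h1 := extContract_ι_mul (a.coord i) (a i) ω
    rw [h0, map_zero, h.con i le_rfl, mul_zero, sub_zero] at h1
    simpa using h1.symm
  isMaximal := by
    refine isMaximalVector_iff.2 ⟨fun α x hx => ?_, fun x => ?_⟩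
    · rw [ext_lie_ι_mul, h.isMaximal.lie_pos hx, mul_zero, add_zero]
      have hw := lie_mem_wtSub_of_pos _ hx (ha i)
      conv_lhs => rw [← a.sum_repr ⁅x, a i⁆]
      rw [map_sum, Finset.sum_mul]
      refine Finset.sum_eq_zero fun j _ => ?_
      rw [map_smul, smul_mul_assoc]
      by_cases hj : η j = η i + α
      · rw [h.mul j, smul_zero]
        by_contra hc
        have h1 := hη (Fin.not_lt.1 hc)
        have h2 := hx.one_le_height
        simp only [hj, map_add, Complex.add_re] at h1
        linarith
      · rw [show a.repr ⁅x, a i⁆ j = 0 from coord_eq_zero_of_ne ha hw hj, zero_smul]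
    · rw [ext_lie_ι_mul, ha i x, h.isMaximal.2 x, map_smul, smul_mul_assoc, mul_smul_comm,
        ← add_smul]
      rfl
  mul j hj := by
    rcases Nat.lt_succ_iff_lt_or_eq.1 hj with hj | hj
    · rw [ext_ι_mul_ι_mul, h.mul j hj, mul_zero, neg_zero]
    · rw [Fin.ext hj, ← mul_assoc, ExteriorAlgebra.ι_sq_zero, zero_mul]
  con j hj := by
    rw [extContract_ι_mul, h.con j (by omega), mul_zero, sub_zero]
    have : j ≠ i := fun h => by omega
    simp [this.symm]

theorem exists_isFlagVector (ha : ∀ i, a i ∈ wtSub A (η i))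
    (hη : Antitone fun i => (height b (η i)).re) (k : ℕ) (hk : k ≤ d) :
    ∃ τ ω, IsFlagVector b a k τ ω := by
  induction k with
  | zero => exact ⟨0, 1, IsFlagVector.zero⟩
  | succ k ih =>
    obtain ⟨τ, ω, h⟩ := ih (by omega)
    exact ⟨_, _, IsFlagVector.succ ha hη (i := ⟨k, hk⟩) h⟩

end Flag

variable {W : Type v} [AddCommGroup W] [Module ℂ W] [LieRingModule L W] [LieModule ℂ L W]
  [FiniteDimensional ℂ W]

/-! ### Maximal vectors from the canonical element of `W ⊗ W*` -/

section DualTensor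

variable {Q : Type v} [AddCommGroup Q] [Module ℂ Q] [LieRingModule L Q] [LieModule ℂ L Q] {k : ℕ}
  (q : extPart L (Module.Dual ℂ W) (k + 1) →ₗ⁅ℂ, L⁆ Q) (ω : extPart L (Module.Dual ℂ W) k)

/-- The bilinear map `(v, f) ↦ v ⊗ q (f ∧ ω)`. -/
def dualTensorBilin : W →ₗ[ℂ] Module.Dual ℂ W →ₗ[ℂ] W ⊗[ℂ] Q :=
  LinearMap.mk₂ ℂ (fun v f => v ⊗ₜ[ℂ] q (extMul L k f ω))
    (fun _ _ _ => TensorProduct.add_tmul _ _ _) (fun _ _ _ => rfl)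
    (fun v f g => by
      rw [show extMul L k (f + g) ω = extMul L k f ω + extMul L k g ω from
        Subtype.ext (by simp [add_mul]), map_add, TensorProduct.tmul_add])
    (fun c v f => by
      rw [show extMul L k (c • f) ω = c • extMul L k f ω from Subtype.ext (by simp), map_smul,
        TensorProduct.tmul_smul])

theorem dualTensorBilin_apply (v : W) (f : Module.Dual ℂ W) :
    dualTensorBilin q ω v f = v ⊗ₜ[ℂ] q (extMul L k f ω) := rfl

/-- The image of the canonical element of `W ⊗ W*` under `v ⊗ f ↦ v ⊗ q (f ∧ ω)`. -/
def dualTensor : W ⊗[ℂ] Q :=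
  ∑ j, dualTensorBilin q ω (Module.finBasis ℂ W j) ((Module.finBasis ℂ W).coord j)

/-- The canonical element is invariant and `q` is equivariant, so the tensor transforms exactly as
`ω` does; in particular it inherits maximality and the weight. -/
theorem lie_dualTensor {x : L} {c : ℂ} (hc : ⁅x, ω⁆ = c • ω) :
    ⁅x, dualTensor q ω⁆ = c • dualTensor q ω := by
  have h1 : ∀ v f, ⁅x, dualTensorBilin q ω v f⁆ = dualTensorBilin q ω (toEnd ℂ L W x v) f -
      dualTensorBilin q ω v (f ∘ₗ toEnd ℂ L W x) + c • dualTensorBilin q ω v f := by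
    intro v f
    have h2 : ⁅x, extMul L k f ω⁆ = -extMul L k (f ∘ₗ toEnd ℂ L W x) ω + c • extMul L k f ω := by
      have h3 : ⁅x, (ω : ExteriorAlgebra ℂ (Module.Dual ℂ W))⁆ =
        c • (ω : ExteriorAlgebra ℂ (Module.Dual ℂ W)) := congrArg Subtype.val hc
      refine Subtype.ext ?_
      change ⁅x, ExteriorAlgebra.ι ℂ f * (ω : ExteriorAlgebra ℂ (Module.Dual ℂ W))⁆ =
        -(ExteriorAlgebra.ι ℂ (f ∘ₗ toEnd ℂ L W x) * (ω : ExteriorAlgebra ℂ (Module.Dual ℂ W))) +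
          c • (ExteriorAlgebra.ι ℂ f * (ω : ExteriorAlgebra ℂ (Module.Dual ℂ W)))
      rw [ext_lie_ι_mul, h3, mul_smul_comm, show ⁅x, f⁆ = -(f ∘ₗ toEnd ℂ L W x) from rfl, map_neg,
        neg_mul]
    simp only [dualTensorBilin_apply]
    rw [TensorProduct.LieModule.lie_tmul_right, ← LieModuleHom.map_lie, h2, map_add, map_neg,
      map_smul, TensorProduct.tmul_add, TensorProduct.tmul_neg, TensorProduct.tmul_smul,
      toEnd_apply_apply]
    abel
  simp only [dualTensor, lie_sum, h1, Finset.sum_add_distrib, Finset.sum_sub_distrib]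
  rw [sum_apply_coord, sub_self, zero_add, Finset.smul_sum]

theorem contractFst_dualTensor (f : Module.Dual ℂ W) :
    contractFst W Q f (dualTensor q ω) = q (extMul L k f ω) := by
  have h2 : f = ∑ j, f (Module.finBasis ℂ W j) • (Module.finBasis ℂ W).coord j :=
    (Module.finBasis ℂ W).ext fun k => by simp
  have h3 : extMul L k f ω = ∑ j, f (Module.finBasis ℂ W j) •
      extMul L k ((Module.finBasis ℂ W).coord j) ω := Subtype.ext (by
    change ExteriorAlgebra.ι ℂ f * (ω : ExteriorAlgebra ℂ (Module.Dual ℂ W)) = _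
    have h4 : ExteriorAlgebra.ι ℂ f * (ω : ExteriorAlgebra ℂ (Module.Dual ℂ W)) =
        ∑ j, f (Module.finBasis ℂ W j) • (ExteriorAlgebra.ι ℂ ((Module.finBasis ℂ W).coord j) *
          (ω : ExteriorAlgebra ℂ (Module.Dual ℂ W))) := by
      conv_lhs => rw [h2]
      simp only [map_sum, map_smul, Finset.sum_mul, smul_mul_assoc]
    refine h4.trans ?_
    simp)
  rw [h3, map_sum, dualTensor, map_sum]
  refine Finset.sum_congr rfl fun j _ => ?_
  rw [map_smul]
  rfl

end DualTensor

theorem IsMaximalVector.exists_hom_model {lam : Module.Dual ℂ H} {m : W}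
    (h : IsMaximalVector b lam m) (h0 : m ≠ 0) :
    ∃ (S : SimpleModel.{u, v} b ⟨lam, h.isDominant h0⟩) (q : W →ₗ⁅ℂ, L⁆ S.carrier), q m ≠ 0 := by
  obtain ⟨q, hq⟩ := exists_retraction (LieSubmodule.lieSpan ℂ L {m})
  exact ⟨h.model h0, q, fun h1 => h0
    (congrArg Subtype.val ((hq ⟨m, LieSubmodule.subset_lieSpan rfl⟩).symm.trans h1))⟩

/-- A module with a vector of weight `κ` has, tensored with a suitable simple module of highest
weight `λ`, a maximal vector of weight `λ + κ`. -/
theorem exists_isMaximalVector_tensor {κ : Module.Dual ℂ H} {w : W} (hw : w ∈ wtSub W κ)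
    (hw0 : w ≠ 0) : ∃ (lam : DomWeight b) (S : SimpleModel.{u, v} b lam) (t : W ⊗[ℂ] S.carrier),
      t ≠ 0 ∧ IsMaximalVector b (lam.1 + κ) t := by
  obtain ⟨d, a, η, ha, hη, -⟩ := exists_weightBasis b (Module.Dual ℂ W)
  obtain ⟨i, hi⟩ : ∃ i, a i w ≠ 0 := by
    by_contra! hc
    refine hw0 ((Module.forall_dual_apply_eq_zero_iff ℂ w).1 fun f => ?_)
    have h1 := a.sum_repr f
    rw [← h1, LinearMap.sum_apply]
    exact Finset.sum_eq_zero fun i _ => by rw [LinearMap.smul_apply, hc, smul_zero]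
  -- A weight functional that does not vanish at a vector of weight `κ` has weight `-κ`.
  have hηi : η i = -κ := LinearMap.ext fun h => by
    have h1 := LinearMap.congr_fun (ha i h) w
    rw [Module.Dual.lie_apply, hw h, map_smul, LinearMap.smul_apply, smul_eq_mul, smul_eq_mul,
      ← neg_mul] at h1
    exact (mul_right_cancel₀ hi h1).symm
  -- The simple module is found inside an exterior power of `W*`: `ω` wedges the basis vectors
  -- before `a i` and has weight `τ`, and `y = a i ∧ ω` is maximal of weight `λ = τ - κ`. The tensor
  -- built from `ω` and a projection to `V(λ)` is maximal of weight `τ = λ + κ`, and contracting it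
  -- with `a i` gives the nonzero image of `y`.
  obtain ⟨τ, ω, hω⟩ := exists_isFlagVector (b := b) ha hη i.1 i.2.le
  have hω' := hω.succ ha hη
  let ω₀ : extPart L (Module.Dual ℂ W) i.1 := ⟨ω, hω.mem⟩
  have hω₀ : IsMaximalVector b τ ω₀ := IsMaximalVector.of_injective
    (extPart L (Module.Dual ℂ W) i.1).incl Subtype.val_injective hω.isMaximal
  let y := extMul L i.1 (a i) ω₀
  have hy : IsMaximalVector b (η i + τ) y := IsMaximalVector.of_injective
    (extPart L (Module.Dual ℂ W) (i.1 + 1)).incl Subtype.val_injective hω'.isMaximal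
  have hy0 : y ≠ 0 := fun h => hω'.ne_zero (congrArg Subtype.val h)
  obtain ⟨S, q, hq⟩ := hy.exists_hom_model hy0
  refine ⟨_, S, dualTensor q ω₀, fun h0 => hq ?_,
    isMaximalVector_iff.2 ⟨fun α x hx => ?_, fun x => ?_⟩⟩
  · rw [← contractFst_dualTensor, h0, map_zero]
  · rw [lie_dualTensor _ _ (c := 0) (by rw [hω₀.lie_pos hx, zero_smul]), zero_smul]
  · rw [lie_dualTensor _ _ (hω₀.2 x)]
    congr 1
    change τ x = (η i + τ + κ) x
    rw [hηi]
    simp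

end TensorMax

/-! ## Sharpness of the bound -/

section Sharp

set_option linter.unusedSectionVars false

open LieModule LieAlgebra

variable {L : Type u} [LieRing L] [LieAlgebra ℂ L] [FiniteDimensional ℂ L]
  [LieAlgebra.IsSemisimple ℂ L] {H : LieSubalgebra ℂ L} [H.IsCartanSubalgebra]
  {b : (LieAlgebra.IsKilling.rootSystem H).Base}
  {V : Type v} [AddCommGroup V] [Module ℂ V] [LieRingModule L V] [LieModule ℂ L V]
  [FiniteDimensional ℂ V]
  {Ψ : Finset (Module.Dual ℂ H)} {p₀ p q : Lam b} {Γ : Set (Lam b)}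

/-- Degrees allow maps to the simple target only from the `n`-th resolution term, so every such map
is a cocycle and no nonzero one is a coboundary. -/
theorem exists_ext_simpleObj_ne_zero (hΓ : IsTruncSet Ψ p₀ Γ)
    (hsub : (Ψ : Set (Module.Dual ℂ H)) ⊆ weights H V) (hrigid : IsRigid Ψ (weights H V))
    (hp : p ∈ Γ) (hq : q ∈ Γ) {n : ℕ} (hn : p.2 + n = q.2) (S : SimpleModel.{u, v} b p.1)
    (S' : SimpleModel.{u, v} b q.1) {φ : extPart L V n ⊗[ℂ] S.carrier →ₗ⁅ℂ, L⁆ S'.carrier}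
    {t : extPart L V n ⊗[ℂ] S.carrier} (hφ : φ t ≠ 0) :
    ∃ e : Ext.{max u (v + 1)} (⟨simpleObj V S p.2, inTrunc_simpleObj hp S⟩ : TruncCat b V Γ)
      ⟨simpleObj V S' q.2, inTrunc_simpleObj hq S'⟩ n, e ≠ 0 := by
  let g : koszulObj L V S.carrier p.2 n ⟶ simpleObj V S' q.2 :=
    inducedDesc ((concMk S'.carrier hn).comp φ)
  let f : truncKoszul V hΓ.finite S n ⟶ ⟨simpleObj V S' q.2, inTrunc_simpleObj hq S'⟩ :=
    ObjectProperty.homMk (truncDesc (inTrunc_simpleObj hq S') g)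
  have hf : f ≠ 0 := fun h => hφ <| by
    have h1 : f.hom.f (p.2 + n) ((truncPr Γ _).f (p.2 + n) (inducedGen V (p.2 + n) t)) = 0 := by
      rw [h]; rfl
    have h2 : g.f (p.2 + n) (inducedGen V (p.2 + n) t) = 0 :=
      (truncDesc_proj (inTrunc_simpleObj hq S') g _ _).symm.trans h1
    have h3 : concMk S'.carrier hn (φ t) = 0 :=
      (inducedDesc_gen (M := simpleObj V S' q.2) ((concMk S'.carrier hn).comp φ) t).symm.trans h2
    exact congrArg Subtype.val h3
  have hdeg : ∀ j : ℕ, j ≠ n → ∀ f : truncKoszul V hΓ.finite S j ⟶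
      ⟨simpleObj V S' q.2, inTrunc_simpleObj hq S'⟩, f = 0 := fun j hj f => by
    by_contra h0
    have := (exists_hom_of_truncKoszul_hom hΓ.finite hq S' S j f h0).1
    omega
  exact (isResolution_truncKoszul hΓ hsub hrigid hp S).exists_ext_ne_zero hf
    (hdeg (n + 1) (by omega) _) fun j hj => hdeg j hj.ne

variable (Ψ) in
/-- The elements above `p` in degrees at most `n` above that of `p`. -/
def upperSet (p : Lam b) (n : ℕ) : Set (Lam b) := {q | preceq Ψ p q ∧ q.2 ≤ p.2 + n}

theorem isTruncSet_upperSet (hsub : (Ψ : Set (Module.Dual ℂ H)) ⊆ weights H V)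
    (hrigid : IsRigid Ψ (weights H V)) (p : Lam b) (n : ℕ) :
    IsTruncSet Ψ p (upperSet Ψ p n) where
  finite := by
    classical
    refine Set.Finite.of_finite_image (f := fun q : Lam b => (q.1.1, q.2)) ?_ ?_
    -- A path of at most `n` steps in `Ψ` uses each element at most `n` times, so it is a
    -- submultiset of `n` copies of `Ψ`.
    · refine ((Multiset.finite_toSet ((n • Ψ.val).powerset)).image
        fun m : Multiset (Module.Dual ℂ H) => (p.1.1 + m.sum, p.2 + (m.card : ℤ))).subset ?_
      rintro _ ⟨q, ⟨hq, hn⟩, rfl⟩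
      obtain ⟨m, hm, hs, hc⟩ := (hrigid.preceq_iff hsub).1 hq
      refine ⟨m, Multiset.mem_powerset.2 (Multiset.le_iff_count.2 fun x => ?_),
        Prod.ext ?_ ?_⟩
      · by_cases hx : x ∈ m
        · rw [Multiset.count_nsmul, Multiset.count_eq_one_of_mem Ψ.nodup (hm x hx)]
          have := Multiset.count_le_card x m
          omega
        · rw [Multiset.count_eq_zero_of_notMem hx]
          exact Nat.zero_le _
      · simp [hs]
      · simp [hc]
    · rintro ⟨⟨q, hq⟩, k⟩ - ⟨⟨q', hq'⟩, k'⟩ - h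
      obtain ⟨rfl, rfl⟩ := Prod.mk.inj h
      rfl
  closed q₁ q₂ q₃ h₁ h₃ h₁₂ h₂₃ := by
    obtain ⟨m, hm, hs, hc⟩ := (hrigid.preceq_iff hsub).1 h₁.1
    obtain ⟨m', hm', hs', hc'⟩ := (hrigid.preceq_iff hsub).1 h₁₂
    refine ⟨(hrigid.preceq_iff hsub).2 ⟨m + m', fun x hx => ?_, ?_, ?_⟩, ?_⟩
    · exact (Multiset.mem_add.1 hx).elim (hm x) (hm' x)
    · rw [Multiset.sum_add, hs, hs', add_comm, sub_add_sub_cancel]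
    · rw [Multiset.card_add]
      push_cast
      omega
    · have h1 := h₂₃.2
      have h2 := h₃.2
      omega
  above q hq := hq.1

variable (b) in
/-- The bound on the global dimension is attained. -/
theorem exists_globalDim_eq (hsub : (Ψ : Set (Module.Dual ℂ H)) ⊆ weights H V)
    (hrigid : IsRigid Ψ (weights H V)) :
    ∃ (p₀ : Lam b) (Γ : Set (Lam b)), IsTruncSet Ψ p₀ Γ ∧
      globalDim (TruncCat b V Γ) = ((psiDim V Ψ : ℕ) : WithBot ℕ∞) := by
  classical
  obtain ⟨d, e, ζ, he, -, hζ⟩ := exists_weightBasis b V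
  -- All basis vectors with weight in `Ψ` are wedged together; their number is the claimed bound.
  let s := Finset.univ.filter fun i => ζ i ∈ Ψ
  have hs : s.card = psiDim V Ψ := card_filter_mem hζ
  obtain ⟨ω, hω0, hω⟩ := exists_extPart_mem_wtSub he s
  obtain ⟨lam, S, t, ht0, ht⟩ := exists_isMaximalVector_tensor (b := b) hω hω0
  let p : Lam b := (lam, 0)
  -- The weights indexed by `s` form a path in `Ψ` from `p` to `q`, so both ends lie in the chosen
  -- truncation set.
  let q : Lam b := (⟨_, ht.isDominant ht0⟩, 0 + s.card)
  have hΓ := isTruncSet_upperSet hsub hrigid p s.card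
  have hp : p ∈ upperSet Ψ p s.card :=
    ⟨(hrigid.preceq_iff hsub).2 ⟨0, by simp, by simp, by simp⟩, by simp⟩
  have hq : q ∈ upperSet Ψ p s.card := by
    refine ⟨(hrigid.preceq_iff hsub).2 ⟨s.val.map ζ, fun x hx => ?_, ?_, ?_⟩, le_rfl⟩
    · obtain ⟨i, hi, rfl⟩ := Multiset.mem_map.1 hx
      exact (Finset.mem_filter.1 (show i ∈ s from hi)).2
    · exact (add_sub_cancel_left lam.1 _).symm
    · simp [p, q]
  obtain ⟨S', φ, hφ⟩ := ht.exists_hom_model ht0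
  obtain ⟨x, hx⟩ := exists_ext_simpleObj_ne_zero hΓ hsub hrigid hp hq rfl S S' hφ
  refine ⟨p, _, hΓ, le_antisymm (globalDim_le hΓ hsub hrigid) ?_⟩
  refine le_trans ?_ (le_iSup (fun X => projectiveDimension X)
    (⟨simpleObj V S p.2, inTrunc_simpleObj hp S⟩ : TruncCat b V (upperSet Ψ p s.card)))
  rw [projectiveDimension_ge_iff, ← hs]
  exact fun h => hx (x.eq_zero_of_hasProjectiveDimensionLT _ le_rfl)

end Sharp

end GrRep

end

/-! ### The theorem -/

open GrRep in
theorem lemmaL75 {L : Type u} [LieRing L] [LieAlgebra ℂ L] [FiniteDimensional ℂ L]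
    [LieAlgebra.IsSemisimple ℂ L] (H : LieSubalgebra ℂ L) [H.IsCartanSubalgebra]
    (b : (LieAlgebra.IsKilling.rootSystem H).Base)
    (V : Type v) [AddCommGroup V] [Module ℂ V] [LieRingModule L V] [LieModule ℂ L V]
    [FiniteDimensional ℂ V]
    (Ψ : Finset (Module.Dual ℂ H)) (hne : Ψ.Nonempty)
    (hsub : (Ψ : Set (Module.Dual ℂ H)) ⊆ weights H V) (hrigid : IsRigid Ψ (weights H V)) :
    (∀ (p₀ : Lam b) (Γ : Set (Lam b)), Γ.Finite → IsIntervalClosed Ψ Γ →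
      (∀ q ∈ Γ, preceq Ψ p₀ q) →
      -- homomorphisms between the truncated projectives
      (∀ p ∈ Γ, ∀ p' ∈ Γ, ∀ (S : SimpleModel.{u, v} b p.1) (S' : SimpleModel.{u, v} b p'.1),
        ∃ (h : inTrunc b V Γ (truncProj V Γ S p.2)) (h' : inTrunc b V Γ (truncProj V Γ S' p'.2)),
          (∃ f : (⟨truncProj V Γ S p.2, h⟩ : TruncCat b V Γ) ⟶ ⟨truncProj V Γ S' p'.2, h'⟩,
            f ≠ 0) → preceq Ψ p' p) ∧
      -- extensions between the simple objects
      (∀ p ∈ Γ, ∀ p' ∈ Γ, ∀ (S : SimpleModel.{u, v} b p.1) (S' : SimpleModel.{u, v} b p'.1),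
        ∃ (h : inTrunc b V Γ (simpleObj V S p.2)) (h' : inTrunc b V Γ (simpleObj V S' p'.2)),
          ∀ j : ℕ, (∃ e : Ext.{max u (v + 1)} (⟨simpleObj V S' p'.2, h'⟩ : TruncCat b V Γ)
            ⟨simpleObj V S p.2, h⟩ j, e ≠ 0) →
            preceq Ψ p' p ∧ j = psiDist Ψ p'.1.1 p.1.1) ∧
      globalDim (TruncCat b V Γ) ≤
        ((∑ ξ ∈ Ψ, Module.finrank ℂ (LieModule.weightSpace V (ξ : H → ℂ)) : ℕ) : WithBot ℕ∞)) ∧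
    ∃ (p₀ : Lam b) (Γ : Set (Lam b)), Γ.Finite ∧ IsIntervalClosed Ψ Γ ∧
      (∀ q ∈ Γ, preceq Ψ p₀ q) ∧
      globalDim (TruncCat b V Γ) =
        ((∑ ξ ∈ Ψ, Module.finrank ℂ (LieModule.weightSpace V (ξ : H → ℂ)) : ℕ) : WithBot ℕ∞) := by
  refine ⟨fun p₀ Γ hf hc ha => ?_, ?_⟩
  · have hΓ : IsTruncSet Ψ p₀ Γ := ⟨hf, hc, ha⟩
    refine ⟨fun p hp p' hp' S S' => ⟨inTrunc_truncProj hf S, inTrunc_truncProj hf S', ?_⟩,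
      fun p hp p' hp' S S' => ⟨inTrunc_simpleObj hp S, inTrunc_simpleObj hp' S', ?_⟩,
      globalDim_le hΓ hsub hrigid⟩
    · rintro ⟨f, h0⟩
      exact preceq_of_hom hΓ hsub hrigid hp hp' S S' f h0
    · rintro j ⟨e, h0⟩
      exact preceq_of_ext hΓ hsub hrigid hp hp' S S' e h0
  · obtain ⟨p₀, Γ, hΓ, h⟩ := exists_globalDim_eq b hsub hrigid
    exact ⟨p₀, Γ, hΓ.finite, hΓ.closed, hΓ.above, h⟩
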